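/- Let $N\ge 2$ and $p>1$, and put $p^*=\frac{Np}{N-p}$ if $p<N$ and $p^*=+\infty$ if $p\ge N$. Let $V:\mathbb R^N\to\mathbb R$ be Lebesgue measurable and $A,g:\mathbb R^N\times\mathbb R\to\mathbb R$. A $\mathcal C^k$-Carathéodory function is a function $h:\mathbb R^N\times\mathbb R\to\mathbb R$ such that $h(\cdot,t)$ is measurable for all $t\in\mathbb R$ and $h(x,\cdot)$ is of class $\mathcal C^k$ for a.e. $x\in\mathbb R^N$. Write $B_R(x)=\{y\in\mathbb R^N:|y-x|<R\}$, $B_R=B_R(0)$, $A_t=\partial A/\partial t$ and $G(x,t)=\int_0^t g(x,s)\,ds$. For an open set $\Omega\subset\mathbb R^N$ let $W_V^{1,p}(\Omega)$ (respectively $W_{0,V}^{1,p}(\Omega)$) be the space of all $u\in W^{1,p}(\Omega)$ (respectively $u\in W^{1,p}_0(\Omega)$) with $\int_\Omega V|u|^p\,dx<+\infty$, with the norm $$\|u\|_{\Omega,V}=\Big(\int_\Omega|\nabla u|^p\,dx+\int_\Omega V(x)|u|^p\,dx\Big)^{1/p};$$ write $\|u\|_V$ for $\Omega=\mathbb R^N$.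 Let $X_\Omega=W_{0,V}^{1,p}(\Omega)\cap L^\infty(\Omega)$, whose elements are extended by $0$ to $\mathbb R^N$. Assume: - $(V_1)$ $\operatorname{ess\,inf}_{\mathbb R^N}V>0$; - $(V_2)$ $\lim_{|x|\to+\infty}\int_{B_1(x)}\frac{dy}{V(y)}=0$; - $(V_3)$ $\operatorname{ess\,sup}_{|x|\le\varrho}V(x)<+\infty$ for every $\varrho>0$; - $(h_0)$ $A$ is a $\mathcal C^1$-Carathéodory function; - $(h_1)$ $\sup_{|t|\le\rho}|A(\cdot,t)|\in L^\infty(\mathbb R^N)$ and $\sup_{|t|\le\rho}|A_t(\cdot,t)|\in L^\infty(\mathbb R^N)$ for every $\rho>0$; - $(h_2)$ there is $\alpha_0>0$ with $A(x,t)\ge\alpha_0$ for a.e. $x$ and all $t$; - $(h_3)$ there are $\mu>p$ and $\alpha_1>0$ with $(\mu-p)A(x,t)-A_t(x,t)t\ge\alpha_1A(x,t)$ for a.e. $x$ and all $t$; - $(h_4)$ there is $\alpha_2>0$ with $pA(x,t)+A_t(x,t)t\ge\alpha_2A(x,t)$ for a.e. $x$ and all $t$; - $(g_0)$ $g$ is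 a $\mathcal C^0$-Carathéodory function; - $(g_1)$ there are $a_1,a_2>0$ and $q$ with $p\le q<p^*$ such that $|g(x,t)|\le a_1|t|^{p-1}+a_2|t|^{q-1}$ for a.e. $x$ and all $t$; - $(g_2)$ there is a real number $\bar\alpha<\alpha_0/\tau_p^p$ such that $\lim_{t\to0}\frac{g(x,t)}{|t|^{p-2}t}=\bar\alpha$ uniformly for a.e. $x$, where $\alpha_0$ is as in $(h_2)$ and $\tau_p>0$ is the best constant in $|w|_{L^p(\mathbb R^N)}\le\tau_p\|w\|_V$ for all $w\in W_V^{1,p}(\mathbb R^N)$; - $(g_3)$ $0<\mu G(x,t)\le g(x,t)t$ for a.e. $x$ and all $t\ne0$, with $\mu$ as in $(h_3)$. For bounded $u,v\in W_V^{1,p}(\mathbb R^N)$ let $$\mathcal J(u)=\frac1p\int_{\mathbb R^N}A(x,u)|\nabla u|^p\,dx+\frac1p\int_{\mathbb R^N}V(x)|u|^p\,dx-\int_{\mathbb R^N}G(x,u)\,dx,$$ $$\langle d\mathcal J(u),v\rangle=\int_{\mathbb R^N}A(x,u)|\nabla u|^{p-2}\nabla u\cdot\nabla v\,dx+\frac1p\int_{\mathbb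 R^N}A_t(x,u)v|\nabla u|^p\,dx+\int_{\mathbb R^N}V(x)|u|^{p-2}uv\,dx-\int_{\mathbb R^N}g(x,u)v\,dx.$$ Let $(u_k)_{k\ge1}$ be a sequence of functions on $\mathbb R^N$ and $\alpha^*,\alpha^{**}\in\mathbb R$ constants such that, for every integer $k\ge1$: - $(i)$ $u_k\in X_{B_k}$, with $u_k=0$ in $\mathbb R^N\setminus B_k$; - $(ii)$ $\alpha^*\le\mathcal J(u_k)\le\alpha^{**}$; - $(iii)$ $\langle d\mathcal J(u_k),v\rangle=0$ for all $v\in X_{B_k}$. Let $u_\infty\in W_V^{1,p}(\mathbb R^N)$ be the weak limit in $W_V^{1,p}(\mathbb R^N)$ of $(u_k)_k$, or of a subsequence of it (then still denoted by $(u_k)_k$). Then $$u_k\to u_\infty\quad\text{strongly in }W_V^{1,p}(B_R)\quad\text{for all }R\ge1.$$ -/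

import Mathlib

open MeasureTheory Filter Set Metric
open scoped Topology ContDiff

namespace QuasilinearSchrodinger

/-- The Euclidean space `ℝ^N`. -/
abbrev RN (N : ℕ) : Type := EuclideanSpace ℝ (Fin N)

/-- `h : ℝ^N × ℝ → ℝ` is a `C^k`-Carathéodory function: `h(·,t)` is Lebesgue measurable for all `t`,
and `h(x,·)` is of class `C^k` for almost every `x`. -/
def IsCaratheodory {N : ℕ} (k : ℕ) (h : RN N → ℝ → ℝ) : Prop :=
  (∀ t : ℝ, AEMeasurable (fun x => h x t) volume) ∧
    ∀ᵐ x : RN N, ContDiff ℝ (k : WithTop ℕ∞) (h x)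

/-- `φ ∈ C_c^∞(Ω)`. -/
def IsTestFunction {N : ℕ} (Ω : Set (RN N)) (φ : RN N → ℝ) : Prop :=
  ContDiff ℝ ∞ φ ∧ HasCompactSupport φ ∧ tsupport φ ⊆ Ω

/-- `w` is a weak (distributional) gradient of `u` on `Ω`. -/
def IsWeakGradient {N : ℕ} (Ω : Set (RN N)) (u : RN N → ℝ) (w : RN N → RN N) : Prop :=
  LocallyIntegrableOn u Ω ∧ LocallyIntegrableOn w Ω ∧
    ∀ φ : RN N → ℝ, IsTestFunction Ω φ → ∀ e : RN N,
      ∫ x in Ω, u x * fderiv ℝ φ x e = -∫ x in Ω, φ x * inner ℝ (w x) e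

open Classical in
/-- The weak gradient `∇u` on `Ω` (unique up to null sets of an open `Ω`; `0` if there is none). -/
noncomputable def weakGradient {N : ℕ} (Ω : Set (RN N)) (u : RN N → ℝ) : RN N → RN N :=
  if h : ∃ w, IsWeakGradient Ω u w then h.choose else 0

/-- `u ∈ W^{1,p}(Ω)`. -/
def MemW {N : ℕ} (Ω : Set (RN N)) (p : ℝ) (u : RN N → ℝ) : Prop :=
  MemLp u (ENNReal.ofReal p) (volume.restrict Ω) ∧
    ∃ w, IsWeakGradient Ω u w ∧ MemLp w (ENNReal.ofReal p) (volume.restrict Ω)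

/-- The weighted norm `‖u‖_{Ω,V} = (∫_Ω |∇u|^p + ∫_Ω V |u|^p)^{1/p}`. -/
noncomputable def normV {N : ℕ} (Ω : Set (RN N)) (V : RN N → ℝ) (p : ℝ) (u : RN N → ℝ) : ℝ :=
  ((∫ x in Ω, ‖weakGradient Ω u x‖ ^ p) + ∫ x in Ω, V x * |u x| ^ p) ^ (1 / p)

/-- The standard Sobolev norm `‖u‖_Ω = (∫_Ω |∇u|^p + ∫_Ω |u|^p)^{1/p}`. -/
noncomputable def normW {N : ℕ} (Ω : Set (RN N)) (p : ℝ) (u : RN N → ℝ) : ℝ :=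
  ((∫ x in Ω, ‖weakGradient Ω u x‖ ^ p) + ∫ x in Ω, |u x| ^ p) ^ (1 / p)

/-- `u ∈ W_0^{1,p}(Ω)`, the closure of `C_c^∞(Ω)` in `W^{1,p}(Ω)`. -/
def MemW0 {N : ℕ} (Ω : Set (RN N)) (p : ℝ) (u : RN N → ℝ) : Prop :=
  MemW Ω p u ∧ ∀ ε : ℝ, 0 < ε → ∃ φ : RN N → ℝ, IsTestFunction Ω φ ∧ normW Ω p (u - φ) < ε

/-- `u ∈ W_V^{1,p}(Ω)`. -/
def MemWV {N : ℕ} (Ω : Set (RN N)) (V : RN N → ℝ) (p : ℝ) (u : RN N → ℝ) : Prop :=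
  MemW Ω p u ∧ IntegrableOn (fun x => V x * |u x| ^ p) Ω

/-- The constant `τ_p` of the embedding of `W_V^{1,p}(ℝ^N)` in `L^p(ℝ^N)`: the best `τ > 0` with
`|w|_p ≤ τ ‖w‖_V` for all `w`. Such `τ` exist as soon as `V` is bounded below by a positive constant
(any `τ ≥ c^{-1/p}` will do if `V ≥ c > 0`). -/
noncomputable def embeddingConstant {N : ℕ} (V : RN N → ℝ) (p : ℝ) : ℝ :=
  sInf {τ : ℝ | 0 < τ ∧ ∀ w : RN N → ℝ, MemWV univ V p w →
    (∫ x, |w x| ^ p) ^ (1 / p) ≤ τ * normV univ V p w}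

/-- `u : ℝ^N → ℝ` is the trivial extension, by `0` outside `Ω`, of an element of
`X_Ω = W_{0,V}^{1,p}(Ω) ∩ L^∞(Ω)`. -/
def MemXOn {N : ℕ} (Ω : Set (RN N)) (V : RN N → ℝ) (p : ℝ) (u : RN N → ℝ) : Prop :=
  MemW0 Ω p u ∧ IntegrableOn (fun x => V x * |u x| ^ p) Ω ∧
    MemLp u ⊤ (volume.restrict Ω) ∧ ∀ᵐ x : RN N, x ∉ Ω → u x = 0

/-- The functional
`J(u) = (1/p) ∫ A(x,u) |∇u|^p + (1/p) ∫ V |u|^p - ∫ G(x,u)`, with `G(x,t) = ∫_0^t g(x,s) ds`. -/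
noncomputable def energy {N : ℕ} (p : ℝ) (V : RN N → ℝ) (A g : RN N → ℝ → ℝ)
    (u : RN N → ℝ) : ℝ :=
  (1 / p) * (∫ x, A x (u x) * ‖weakGradient univ u x‖ ^ p)
    + (1 / p) * (∫ x, V x * |u x| ^ p)
    - ∫ x, ∫ s in (0 : ℝ)..(u x), g x s

/-- The differential `⟨dJ(u), v⟩` of the functional, with `A_t = ∂A/∂t`:
`∫ A(x,u) |∇u|^{p-2} ∇u·∇v + (1/p) ∫ A_t(x,u) v |∇u|^p + ∫ V |u|^{p-2} u v - ∫ g(x,u) v`. -/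
noncomputable def energyDifferential {N : ℕ} (p : ℝ) (V : RN N → ℝ) (A g : RN N → ℝ → ℝ)
    (u v : RN N → ℝ) : ℝ :=
  (∫ x, A x (u x) * ‖weakGradient univ u x‖ ^ (p - 2)
      * inner ℝ (weakGradient univ u x) (weakGradient univ v x))
    + (1 / p) * (∫ x, deriv (A x) (u x) * v x * ‖weakGradient univ u x‖ ^ p)
    + (∫ x, V x * |u x| ^ (p - 2) * u x * v x)
    - ∫ x, g x (u x) * v x

/-- `ℓ` is (an arbitrary extension to all functions of) an element of the dual space of
`W_V^{1,p}(Ω)`: it is linear and bounded on `W_V^{1,p}(Ω)`. -/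
def IsDualWV {N : ℕ} (Ω : Set (RN N)) (V : RN N → ℝ) (p : ℝ) (ℓ : (RN N → ℝ) → ℝ) : Prop :=
  (∀ v w : RN N → ℝ, MemWV Ω V p v → MemWV Ω V p w → ∀ a b : ℝ,
      ℓ (a • v + b • w) = a * ℓ v + b * ℓ w) ∧
    ∃ C : ℝ, ∀ w : RN N → ℝ, MemWV Ω V p w → |ℓ w| ≤ C * normV Ω V p w

/-- `u_n ⇀ u` weakly in `W_V^{1,p}(Ω)`. -/
def WeaklyConvergesWV {N : ℕ} (Ω : Set (RN N)) (V : RN N → ℝ) (p : ℝ)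
    (u : ℕ → RN N → ℝ) (uLim : RN N → ℝ) : Prop :=
  (∀ n, MemWV Ω V p (u n)) ∧ MemWV Ω V p uLim ∧
    ∀ ℓ : (RN N → ℝ) → ℝ, IsDualWV Ω V p ℓ → Tendsto (fun n => ℓ (u n)) atTop (𝓝 (ℓ uLim))

/-- `u_n → u` strongly in `W_V^{1,p}(Ω)`. -/
def StronglyConvergesWV {N : ℕ} (Ω : Set (RN N)) (V : RN N → ℝ) (p : ℝ)
    (u : ℕ → RN N → ℝ) (uLim : RN N → ℝ) : Prop :=
  (∀ n, MemWV Ω V p (u n)) ∧ MemWV Ω V p uLim ∧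
    Tendsto (fun n => normV Ω V p (u n - uLim)) atTop (𝓝 0)

/-- The critical Sobolev exponent `p^* = Np/(N-p)` if `p < N`, and `p^* = +∞` if `p ≥ N`. -/
noncomputable def criticalExponent (N : ℕ) (p : ℝ) : EReal :=
  if p < N then ((N * p / (N - p) : ℝ) : EReal) else ⊤

end QuasilinearSchrodinger

open QuasilinearSchrodinger

namespace QuasilinearSchrodinger

/-! ### Calculus of weak gradients. -/

section WeakGradient

variable {N : ℕ} {Ω : Set (RN N)}

/-! A critical point satisfies μ J(u) = μ J(u) - ⟨dJ(u), u⟩. In this combination the upper growth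
condition on A_t and the Ambrosetti–Rabinowitz condition make every term nonnegative, so the upper
bound on the levels controls ∫ |∇u_k|^p and ∫ V |u_k|^p uniformly in k
(`IsCriticalOn.energy_bound`).

The sup norms are uniformly bounded as well. Testing with a smooth truncation of u_k above a level h
≥ 1, where the lower bound on pA + A_t t keeps the principal part coercive, gives an energy
inequality on superlevel sets with constants independent of k (`IsCriticalOn.level_energy`). De
Giorgi's iteration (`exists_bound_of_energy_inequality`), run with a Sobolev constant that does not
see the ball, turns it into |u_k| ≤ M.

The remaining obstacle is A_t(x,u)|∇u|^p, which is bounded only in L^1. The test function η F(u_k -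
u_∞) deals with it: η is a cut-off equal to 1 on B_R, and F satisfies F' - κ|F| ≥ 1 on the range of
u_k - u_∞, with κ such that |A_t| ≤ pκA. The bad term is then absorbed by the principal part
(`mul_pGap_le`). All other terms vanish in the limit, by weak convergence of the gradients and
almost everywhere convergence of the functions. Hence the monotonicity gap of a ↦ |a|^{p-2}a between
∇u_k and ∇u_∞ tends to 0 in L^1(B_R) (`tendsto_integral_pGap`). Quantitative strict monotonicity
(`exists_norm_sub_rpow_le`) upgrades this to convergence of the gradients in L^p(B_R). The potential
part follows by dominated convergence, since V is bounded on B_R.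

Almost everywhere convergence comes from Rellich's theorem
(`WeaklyConvergesWV.exists_subseq_tendsto_ae`) along a subsequence only; applying the argument to
every subsequence gives convergence of the whole sequence.

The Sobolev calculus rests on approximation by smooth functions, in L^p for function and gradient
and almost everywhere for the function (`SmoothApprox`, `InW0`). -/

theorem IsTestFunction.to_univ {φ : RN N → ℝ} (h : IsTestFunction Ω φ) : IsTestFunction univ φ :=
  ⟨h.1, h.2.1, subset_univ _⟩

theorem IsTestFunction.eq_zero_of_notMem {φ : RN N → ℝ} (h : IsTestFunction Ω φ) {x : RN N}
    (hx : x ∉ Ω) : φ x = 0 :=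
  image_eq_zero_of_notMem_tsupport fun h' => hx (h.2.2 h')

theorem IsTestFunction.fderiv_eq_zero_of_notMem {φ : RN N → ℝ} (h : IsTestFunction Ω φ) {x : RN N}
    (hx : x ∉ Ω) : fderiv ℝ φ x = 0 :=
  image_eq_zero_of_notMem_tsupport fun h' => hx (h.2.2 (tsupport_fderiv_subset ℝ h'))

theorem IsTestFunction.continuous {φ : RN N → ℝ} (h : IsTestFunction Ω φ) : Continuous φ :=
  h.1.continuous

theorem IsTestFunction.continuous_fderiv {φ : RN N → ℝ} (h : IsTestFunction Ω φ) :
    Continuous (fderiv ℝ φ) :=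
  h.1.continuous_fderiv (by simp)

theorem IsTestFunction.continuous_fderiv_apply {φ : RN N → ℝ} (h : IsTestFunction Ω φ) (e : RN N) :
    Continuous fun x => fderiv ℝ φ x e :=
  h.continuous_fderiv.clm_apply continuous_const

theorem IsTestFunction.hasCompactSupport_fderiv_apply {φ : RN N → ℝ} (h : IsTestFunction Ω φ)
    (e : RN N) : HasCompactSupport fun x => fderiv ℝ φ x e :=
  h.2.1.fderiv_apply ℝ e

theorem tsupport_fderiv_apply_subset' {φ : RN N → ℝ} (e : RN N) :
    tsupport (fun x => fderiv ℝ φ x e) ⊆ tsupport φ :=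
  tsupport_fderiv_apply_subset ℝ e

theorem IsWeakGradient.restrict {u : RN N → ℝ} {w : RN N → RN N} (h : IsWeakGradient univ u w) :
    IsWeakGradient Ω u w := by
  refine ⟨h.1.mono_set (subset_univ _), h.2.1.mono_set (subset_univ _), fun φ hφ e => ?_⟩
  have := h.2.2 φ hφ.to_univ e
  rw [setIntegral_univ, setIntegral_univ] at this
  rw [setIntegral_eq_integral_of_forall_compl_eq_zero, this,
    setIntegral_eq_integral_of_forall_compl_eq_zero]
  · intro x hx; simp [hφ.eq_zero_of_notMem hx]
  · intro x hx; simp [hφ.fderiv_eq_zero_of_notMem hx]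

theorem integrableOn_smul_of_tsupport_subset {F : Type*} [NormedAddCommGroup F] [NormedSpace ℝ F]
    {f : RN N → F} (hf : LocallyIntegrableOn f Ω) {φ : RN N → ℝ} (hφ : Continuous φ)
    (hc : HasCompactSupport φ) (hs : tsupport φ ⊆ Ω) :
    IntegrableOn (fun x => φ x • f x) Ω := by
  have h1 : IntegrableOn f (tsupport φ) := hf.integrableOn_compact_subset hs hc
  have h2 : IntegrableOn (fun x => φ x • f x) (tsupport φ) :=
    h1.continuousOn_smul hφ.continuousOn hc
  have h3 : Integrable (fun x => φ x • f x) := by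
    refine (integrableOn_iff_integrable_of_support_subset ?_).1 h2
    exact (Function.support_smul_subset_left φ f).trans (subset_tsupport φ)
  exact h3.integrableOn

theorem LocallyIntegrableOn.inner_const' {w : RN N → RN N} (h : LocallyIntegrableOn w Ω)
    (e : RN N) : LocallyIntegrableOn (fun x => (inner ℝ (w x) e : ℝ)) Ω := by
  intro x hx
  obtain ⟨s, hs, hi⟩ := h x hx
  exact ⟨s, hs, hi.inner_const e⟩

/-- The fundamental lemma of the calculus of variations, applied to each component of the
difference. It frees later arguments from the arbitrary choice made in `weakGradient`. -/
theorem IsWeakGradient.ae_unique (hΩ : IsOpen Ω) {u : RN N → ℝ} {w₁ w₂ : RN N → RN N}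
    (h₁ : IsWeakGradient Ω u w₁) (h₂ : IsWeakGradient Ω u w₂) :
    w₁ =ᵐ[volume.restrict Ω] w₂ := by
  have key : ∀ e : RN N, ∀ᵐ x : RN N, x ∈ Ω → (inner ℝ (w₁ x) e : ℝ) - inner ℝ (w₂ x) e = 0 := by
    intro e
    refine hΩ.ae_eq_zero_of_integral_contDiff_smul_eq_zero
      ((LocallyIntegrableOn.inner_const' h₁.2.1 e).sub
        (LocallyIntegrableOn.inner_const' h₂.2.1 e)) fun φ hφ hc hs => ?_
    have ht : IsTestFunction Ω φ := ⟨hφ, hc, hs⟩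
    have e1 := h₁.2.2 φ ht e
    have e2 := h₂.2.2 φ ht e
    rw [← setIntegral_eq_integral_of_forall_compl_eq_zero (s := Ω)]
    · have i1 := integrableOn_smul_of_tsupport_subset
        (LocallyIntegrableOn.inner_const' h₁.2.1 e) hφ.continuous hc hs
      have i2 := integrableOn_smul_of_tsupport_subset
        (LocallyIntegrableOn.inner_const' h₂.2.1 e) hφ.continuous hc hs
      simp only [smul_eq_mul] at i1 i2
      simp only [smul_eq_mul, mul_sub]
      rw [integral_sub i1 i2]
      linarith
    · intro x hx; simp [ht.eq_zero_of_notMem hx]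
  rw [EventuallyEq, ae_restrict_iff' hΩ.measurableSet]
  have := ae_all_iff.2 fun i : Fin N => key (EuclideanSpace.single i 1)
  filter_upwards [this] with x hx hxΩ
  ext i
  have := hx i hxΩ
  simp only [EuclideanSpace.inner_single_right] at this
  simpa [sub_eq_zero] using this

theorem weakGradient_spec {u : RN N → ℝ} {w : RN N → RN N} (h : IsWeakGradient Ω u w) :
    IsWeakGradient Ω u (weakGradient Ω u) := by
  have : ∃ w, IsWeakGradient Ω u w := ⟨w, h⟩
  rw [weakGradient, dif_pos this]
  exact this.choose_spec

theorem weakGradient_ae_eq (hΩ : IsOpen Ω) {u : RN N → ℝ} {w : RN N → RN N}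
    (h : IsWeakGradient Ω u w) : weakGradient Ω u =ᵐ[volume.restrict Ω] w :=
  (weakGradient_spec h).ae_unique hΩ h

theorem weakGradient_univ_ae_eq {u : RN N → ℝ} {w : RN N → RN N}
    (h : IsWeakGradient univ u w) : weakGradient univ u =ᵐ[volume] w := by
  simpa using weakGradient_ae_eq isOpen_univ h

theorem IsWeakGradient.linear {u u' : RN N → ℝ} {w w' : RN N → RN N}
    (h : IsWeakGradient Ω u w) (h' : IsWeakGradient Ω u' w') (a b : ℝ) :
    IsWeakGradient Ω (a • u + b • u') (a • w + b • w') := by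
  refine ⟨(h.1.smul a).add (h'.1.smul b), (h.2.1.smul a).add (h'.2.1.smul b), fun φ hφ e => ?_⟩
  have e1 := h.2.2 φ hφ e
  have e2 := h'.2.2 φ hφ e
  have hs := (tsupport_fderiv_apply_subset' (φ := φ) e).trans hφ.2.2
  have i1 := integrableOn_smul_of_tsupport_subset h.1 (hφ.continuous_fderiv_apply e)
    (hφ.hasCompactSupport_fderiv_apply e) hs
  have i2 := integrableOn_smul_of_tsupport_subset h'.1 (hφ.continuous_fderiv_apply e)
    (hφ.hasCompactSupport_fderiv_apply e) hs
  have j1 := integrableOn_smul_of_tsupport_subset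
    (LocallyIntegrableOn.inner_const' h.2.1 e) hφ.continuous hφ.2.1 hφ.2.2
  have j2 := integrableOn_smul_of_tsupport_subset
    (LocallyIntegrableOn.inner_const' h'.2.1 e) hφ.continuous hφ.2.1 hφ.2.2
  simp only [smul_eq_mul] at i1 i2 j1 j2
  have l : ∫ x in Ω, (a • u + b • u') x * fderiv ℝ φ x e
      = a * (∫ x in Ω, u x * fderiv ℝ φ x e) + b * ∫ x in Ω, u' x * fderiv ℝ φ x e := by
    rw [← integral_const_mul, ← integral_const_mul, ← integral_add]
    · refine integral_congr_ae (ae_of_all _ fun x => ?_)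
      simp; ring
    · exact (i1.congr (ae_of_all _ fun x => mul_comm _ _)).const_mul a
    · exact (i2.congr (ae_of_all _ fun x => mul_comm _ _)).const_mul b
  have r : ∫ x in Ω, φ x * inner ℝ ((a • w + b • w') x) e
      = a * (∫ x in Ω, φ x * inner ℝ (w x) e) + b * ∫ x in Ω, φ x * inner ℝ (w' x) e := by
    rw [← integral_const_mul, ← integral_const_mul, ← integral_add (j1.const_mul a) (j2.const_mul b)]
    refine integral_congr_ae (ae_of_all _ fun x => ?_)
    simp only [Pi.add_apply, Pi.smul_apply, inner_add_left, inner_smul_left]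
    simp; ring
  rw [l, r, e1, e2]; ring

theorem IsWeakGradient.sub {u u' : RN N → ℝ} {w w' : RN N → RN N}
    (h : IsWeakGradient Ω u w) (h' : IsWeakGradient Ω u' w') :
    IsWeakGradient Ω (u - u') (w - w') := by
  have := h.linear h' 1 (-1)
  simpa [sub_eq_add_neg] using this

theorem norm_gradient_eq (φ : RN N → ℝ) (x : RN N) : ‖gradient φ x‖ = ‖fderiv ℝ φ x‖ := by
  simp [gradient]

theorem inner_gradient (φ : RN N → ℝ) (x e : RN N) :
    (inner ℝ (gradient φ x) e : ℝ) = fderiv ℝ φ x e := by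
  simp [gradient]

theorem continuous_gradient {φ : RN N → ℝ} (h : Continuous (fderiv ℝ φ)) :
    Continuous (gradient φ) :=
  (InnerProductSpace.toDual ℝ (RN N)).symm.continuous.comp h

/-- The classical gradient of a smooth function is its weak gradient. -/
theorem isWeakGradient_gradient {φ : RN N → ℝ} (h : ContDiff ℝ ∞ φ) :
    IsWeakGradient Ω φ (gradient φ) := by
  refine IsWeakGradient.restrict ⟨?_, ?_, fun ψ hψ e => ?_⟩
  · exact h.continuous.locallyIntegrable.locallyIntegrableOn _
  · exact (continuous_gradient (h.continuous_fderiv (by simp))).locallyIntegrable.locallyIntegrableOn _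
  · rw [setIntegral_univ, setIntegral_univ]
    simp only [inner_gradient]
    have c1 : Continuous fun x => fderiv ℝ φ x e :=
      (h.continuous_fderiv (by simp)).clm_apply continuous_const
    rw [integral_mul_fderiv_eq_neg_fderiv_mul_of_integrable]
    · congr 1; exact integral_congr_ae (ae_of_all _ fun x => mul_comm _ _)
    · exact (c1.mul hψ.continuous).integrable_of_hasCompactSupport hψ.2.1.mul_left
    · exact (h.continuous.mul (hψ.continuous_fderiv_apply e)).integrable_of_hasCompactSupport
        (hψ.hasCompactSupport_fderiv_apply e).mul_left
    · exact (h.continuous.mul hψ.continuous).integrable_of_hasCompactSupport hψ.2.1.mul_left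
    · exact fun x _ => (h.differentiable (by simp)).differentiableAt
    · exact fun x _ => (hψ.1.differentiable (by simp)).differentiableAt

end WeakGradient

/-! ### Passing to the limit in L^p pairings. -/

section LpLimits

variable {α F : Type*} [MeasurableSpace α] {ν : Measure α} [NormedAddCommGroup F] [NormedSpace ℝ F]

/-- By Hölder, pairing with a fixed function of the conjugate exponent is continuous in L^P. -/
theorem tendsto_integral_smul_of_tendsto_eLpNorm {P Q : ENNReal} [ENNReal.HolderConjugate Q P]
    {f : ℕ → α → F} {f₀ : α → F} {h : α → ℝ} (hf : ∀ n, MemLp (f n) P ν) (hf₀ : MemLp f₀ P ν)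
    (hh : MemLp h Q ν) (hlim : Tendsto (fun n => eLpNorm (f n - f₀) P ν) atTop (𝓝 0)) :
    Tendsto (fun n => ∫ x, h x • f n x ∂ν) atTop (𝓝 (∫ x, h x • f₀ x ∂ν)) := by
  refine tendsto_integral_of_L1' _ ?_ (Eventually.of_forall fun n => ?_) ?_
  · exact (memLp_one_iff_integrable.1 (hf₀.smul hh)).1
  · exact memLp_one_iff_integrable.1 ((hf n).smul hh)
  · have hb : ∀ n, eLpNorm ((fun x => h x • f n x) - fun x => h x • f₀ x) 1 ν
        ≤ eLpNorm h Q ν * eLpNorm (f n - f₀) P ν := fun n => by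
      have : ((fun x => h x • f n x) - fun x => h x • f₀ x) = h • (f n - f₀) := by
        ext x; simp [smul_sub]
      rw [this]
      exact eLpNorm_smul_le_mul_eLpNorm ((hf n).sub hf₀).1 hh.1
    refine tendsto_of_tendsto_of_tendsto_of_le_of_le tendsto_const_nhds ?_ (fun _ => zero_le) hb
    have := ENNReal.Tendsto.const_mul hlim (Or.inr hh.2.ne) (a := eLpNorm h Q ν)
    simpa using this

/-- A test function and its derivatives lie in every L^Q, so both sides of the integration by parts
identity are continuous for L^P convergence: the weak gradient is a closed operator. -/
theorem IsWeakGradient.of_tendsto {N : ℕ} {P : ENNReal} (hP : 1 ≤ P)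
    {u : ℕ → RN N → ℝ} {w : ℕ → RN N → RN N} {u₀ : RN N → ℝ} {w₀ : RN N → RN N}
    (h : ∀ n, IsWeakGradient univ (u n) (w n))
    (hu : ∀ n, MemLp (u n) P) (hw : ∀ n, MemLp (w n) P) (hu₀ : MemLp u₀ P) (hw₀ : MemLp w₀ P)
    (hul : Tendsto (fun n => eLpNorm (u n - u₀) P) atTop (𝓝 0))
    (hwl : Tendsto (fun n => eLpNorm (w n - w₀) P) atTop (𝓝 0)) :
    IsWeakGradient univ u₀ w₀ := by
  refine ⟨(hu₀.locallyIntegrable hP).locallyIntegrableOn _,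
    (hw₀.locallyIntegrable hP).locallyIntegrableOn _, fun φ hφ e => ?_⟩
  have : P.HolderConjugate (ENNReal.conjExponent P) := .conjExponent hP
  have : (ENNReal.conjExponent P).HolderConjugate P := this.symm
  have l1 := tendsto_integral_smul_of_tendsto_eLpNorm (Q := ENNReal.conjExponent P) hu hu₀
    ((hφ.continuous_fderiv_apply e).memLp_of_hasCompactSupport
      (hφ.hasCompactSupport_fderiv_apply e)) hul
  have l2 := tendsto_integral_smul_of_tendsto_eLpNorm (Q := ENNReal.conjExponent P) hw hw₀
    (hφ.continuous.memLp_of_hasCompactSupport hφ.2.1) hwl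
  -- Moving the inner product with e outside the integral lets the vector-valued limit `l2` be used.
  have iw : ∀ (f : RN N → RN N), MemLp f P →
      ∫ x, φ x * (inner ℝ (f x) e : ℝ) = inner ℝ (∫ x, φ x • f x) e := by
    intro f hf
    have i : Integrable fun x => φ x • f x :=
      memLp_one_iff_integrable.1 (hf.smul (p := ENNReal.conjExponent P)
        (hφ.continuous.memLp_of_hasCompactSupport hφ.2.1))
    rw [real_inner_comm, ← integral_inner i]
    refine integral_congr_ae (ae_of_all _ fun x => ?_)
    simp [inner_smul_right, real_inner_comm]
  have l3 := (l2.inner (𝕜 := ℝ) (tendsto_const_nhds (x := e))).neg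
  have e3 : ∀ n, -(inner ℝ (∫ x, φ x • w n x) e : ℝ) = ∫ x, fderiv ℝ φ x e • u n x := by
    intro n
    have := (h n).2.2 φ hφ e
    rw [setIntegral_univ, setIntegral_univ, iw _ (hw n)] at this
    rw [← this]
    exact integral_congr_ae (ae_of_all _ fun x => mul_comm _ _)
  simp only [e3] at l3
  have := tendsto_nhds_unique l1 l3
  rw [setIntegral_univ, setIntegral_univ, iw _ hw₀, ← this]
  exact integral_congr_ae (ae_of_all _ fun x => mul_comm _ _)

end LpLimits

/-! ### Translations, mollification and density of smooth functions. -/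

section Mollification

/-- Minkowski's integral inequality, in the form of an average of functions of bounded norm. -/
theorem eLpNorm_le_of_enorm_le_lintegral {X T F F' : Type*} [MeasurableSpace X]
    [MeasurableSpace T] [NormedAddCommGroup F] [NormedAddCommGroup F']
    {μ : Measure X} [SFinite μ] {ν : Measure T} [IsProbabilityMeasure ν] {p : ℝ} (hp : 1 ≤ p)
    {H : X → T → F} (hH : StronglyMeasurable (Function.uncurry H)) {G : X → F'}
    (hG : ∀ x, ‖G x‖ₑ ≤ ∫⁻ t, ‖H x t‖ₑ ∂ν) {K : ENNReal}
    (hK : ∀ᵐ t ∂ν, eLpNorm (fun x => H x t) (ENNReal.ofReal p) μ ≤ K) :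
    eLpNorm G (ENNReal.ofReal p) μ ≤ K := by
  have hp0 : 0 < p := by linarith
  have hP0 : ENNReal.ofReal p ≠ 0 := by simpa using hp0
  have hPr : (ENNReal.ofReal p).toReal = p := ENNReal.toReal_ofReal hp0.le
  have pw : ∀ (f : X → F), eLpNorm f (ENNReal.ofReal p) μ ≤ K ↔ ∫⁻ x, ‖f x‖ₑ ^ p ∂μ ≤ K ^ p := by
    intro f
    rw [eLpNorm_eq_lintegral_rpow_enorm_toReal hP0 ENNReal.ofReal_ne_top, hPr, one_div,
      ENNReal.rpow_inv_le_iff hp0]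
  rw [eLpNorm_eq_lintegral_rpow_enorm_toReal hP0 ENNReal.ofReal_ne_top, hPr, one_div,
      ENNReal.rpow_inv_le_iff hp0]
  -- Jensen's inequality for the probability measure ν, as monotonicity of L^p norms in the
  -- exponent.
  have hx : ∀ x, ‖G x‖ₑ ^ p ≤ ∫⁻ t, ‖H x t‖ₑ ^ p ∂ν := by
    intro x
    have hm : AEStronglyMeasurable (H x) ν :=
      (hH.comp_measurable measurable_prodMk_left).aestronglyMeasurable
    have := eLpNorm'_le_eLpNorm'_of_exponent_le one_pos hp ν hm
    simp only [eLpNorm', ENNReal.rpow_one, one_div, inv_one] at this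
    calc ‖G x‖ₑ ^ p ≤ (∫⁻ t, ‖H x t‖ₑ ∂ν) ^ p := by gcongr; exact hG x
      _ ≤ ((∫⁻ t, ‖H x t‖ₑ ^ p ∂ν) ^ p⁻¹) ^ p := by gcongr
      _ = _ := by rw [← ENNReal.rpow_mul, inv_mul_cancel₀ hp0.ne', ENNReal.rpow_one]
  calc ∫⁻ x, ‖G x‖ₑ ^ p ∂μ ≤ ∫⁻ x, ∫⁻ t, ‖H x t‖ₑ ^ p ∂ν ∂μ := lintegral_mono hx
    _ = ∫⁻ t, ∫⁻ x, ‖H x t‖ₑ ^ p ∂μ ∂ν := by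
        refine lintegral_lintegral_swap (f := fun x t => ‖H x t‖ₑ ^ p) ?_
        exact (hH.enorm.pow_const p).aemeasurable
    _ ≤ ∫⁻ _, K ^ p ∂ν := lintegral_mono_ae (hK.mono fun t ht => (pw _).1 ht)
    _ = K ^ p := by simp

variable {N : ℕ} {F : Type*} [NormedAddCommGroup F]

/-- Translations act continuously on L^P for finite P; the estimate is continuity of this action at
t = 0. -/
theorem exists_delta_eLpNorm_translate_le {P : ENNReal} (hP : 1 ≤ P) (hP' : P ≠ ⊤) {f : RN N → F}
    (hf : MemLp f P) {ε : ENNReal} (hε : 0 < ε) :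
    ∃ δ : ℝ, 0 < δ ∧ ∀ t : RN N, ‖t‖ < δ → eLpNorm (fun x => f (x - t) - f x) P ≤ ε := by
  have : Fact (1 ≤ P) := ⟨hP⟩
  let g : C(RN N, C(RN N, RN N)) :=
    (ContinuousMap.mk (fun a : RN N × RN N => a.2 - a.1) (by fun_prop)).curry
  have hg : ∀ t, MeasurePreserving (g t) volume volume := fun t => measurePreserving_sub_right _ t
  have hc : Continuous fun t => Lp.compMeasurePreserving (g t) (hg t) (hf.toLp f) :=
    continuous_const.compMeasurePreservingLp g.continuous hg hP'
  have h0 : Tendsto (fun t => edist (Lp.compMeasurePreserving (g t) (hg t) (hf.toLp f)) (hf.toLp f))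
      (𝓝 0) (𝓝 0) := by
    have e0 : Lp.compMeasurePreserving (g 0) (hg 0) (hf.toLp f) = hf.toLp f := by
      rw [Lp.ext_iff]
      refine (Lp.coeFn_compMeasurePreserving _ _).trans (ae_of_all _ fun x => ?_)
      simp [g]
    have := (hc.tendsto 0).edist (tendsto_const_nhds (x := hf.toLp f))
    rwa [e0, edist_self] at this
  have h1 := h0.eventually (gt_mem_nhds hε)
  obtain ⟨δ, hδ, hball⟩ := Metric.eventually_nhds_iff.1 h1
  refine ⟨δ, hδ, fun t ht => ?_⟩
  have := hball (y := t) (by simpa using ht)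
  rw [Lp.edist_def] at this
  refine le_trans (le_of_eq (eLpNorm_congr_ae ?_)) this.le
  have e1 := Lp.coeFn_compMeasurePreserving (hf.toLp f) (hg t)
  have e2 := (hg t).quasiMeasurePreserving.ae_eq_comp hf.coeFn_toLp
  filter_upwards [e1, e2, hf.coeFn_toLp] with x h1 h2 h3
  simp only [Pi.sub_apply, h1, h3]
  rw [h2]; rfl

variable [NormedSpace ℝ F]

/-- The mollification `ρ ⋆ f`. -/
noncomputable def mollify (ρ : RN N → ℝ) (f : RN N → F) (x : RN N) : F := ∫ y, ρ (x - y) • f y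

theorem mollify_eq_convolution (ρ : RN N → ℝ) (f : RN N → F) :
    mollify ρ f = convolution f ρ (ContinuousLinearMap.lsmul ℝ ℝ).flip volume := rfl

theorem integrable_mollify_integrand {f : RN N → F} (hf : LocallyIntegrable f) {ρ : RN N → ℝ}
    (hρ : Continuous ρ) (hc : HasCompactSupport ρ) (x : RN N) :
    Integrable fun y => ρ (x - y) • f y := by
  have := integrableOn_smul_of_tsupport_subset (Ω := univ) (hf.locallyIntegrableOn _)
    (φ := fun y => ρ (x - y)) (by fun_prop)
    (hc.comp_homeomorph (Homeomorph.subLeft x)) (subset_univ _)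
  simpa using this

/-- The kernel has integral one, so the mollification error is an average of translation
differences. -/
theorem mollify_sub_eq_integral [CompleteSpace F] {f : RN N → F} (hf : LocallyIntegrable f)
    (ρ : ContDiffBump (0 : RN N)) (x : RN N) :
    mollify (ρ.normed volume) f x - f x = ∫ t, ρ.normed volume t • (f (x - t) - f x) := by
  have h1 := integrable_mollify_integrand hf ρ.continuous_normed
    (ρ.hasCompactSupport_normed (μ := volume)) x
  have h2 : mollify (ρ.normed volume) f x = ∫ t, ρ.normed volume t • f (x - t) := by
    rw [mollify, ← integral_sub_left_eq_self _ _ x]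
    simp
  have h3 : Integrable fun t => ρ.normed volume t • f (x - t) := by
    have := h1.comp_sub_left x
    simpa using this
  simp only [smul_sub]
  rw [integral_sub h3, h2, integral_smul_const, ρ.integral_normed, one_smul]
  exact ρ.integrable_normed.smul_const _

theorem mollify_congr {ρ : RN N → ℝ} {f g : RN N → F} (h : f =ᵐ[volume] g) :
    mollify ρ f = mollify ρ g := by
  ext x
  exact integral_congr_ae (h.mono fun y hy => by simp only [hy])

/-- Minkowski's inequality for the average of translation differences, whose weight is a probability
density carried by ‖t‖ < `rOut`. -/
theorem eLpNorm_mollify_sub_le_of_translate [CompleteSpace F] {p : ℝ} (hp : 1 ≤ p) {f : RN N → F}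
    (hf : LocallyIntegrable f) (ρ : ContDiffBump (0 : RN N)) {K : ENNReal}
    (hK : ∀ t : RN N, ‖t‖ < ρ.rOut → eLpNorm (fun x => f (x - t) - f x) (ENNReal.ofReal p) ≤ K) :
    eLpNorm (mollify (ρ.normed volume) f - f) (ENNReal.ofReal p) ≤ K := by
  -- Minkowski's inequality needs joint measurability in (x, t). Replacing f by a measurable
  -- representative changes neither the mollification nor the norms involved.
  wlog hm : StronglyMeasurable f generalizing f
  · have ha := hf.aestronglyMeasurable
    have e := ha.ae_eq_mk
    have := this (f := ha.mk f) (hf.congr e) (fun t ht => ?_) ha.stronglyMeasurable_mk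
    · rw [← mollify_congr e] at this
      rw [eLpNorm_congr_ae (g := mollify (ρ.normed volume) f - ha.mk f)]
      · exact this
      · filter_upwards [e] with x hx using by simp [hx]
    · rw [eLpNorm_congr_ae (g := fun x => f (x - t) - f x)]
      · exact hK t ht
      · filter_upwards [e, (measurePreserving_sub_right volume t).quasiMeasurePreserving.ae_eq_comp e]
          with x h1 h2
        simp only [Function.comp_apply] at h2
        rw [h1, h2]
  have hρm : Measurable fun t => ENNReal.ofReal (ρ.normed volume t) :=
    (ρ.continuous_normed.measurable).ennreal_ofReal
  let ν : Measure (RN N) := volume.withDensity fun t => ENNReal.ofReal (ρ.normed volume t)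
  have : IsProbabilityMeasure ν := by
    refine ⟨?_⟩
    rw [withDensity_apply _ MeasurableSet.univ, setLIntegral_univ,
      ← ofReal_integral_eq_lintegral_ofReal ρ.integrable_normed
        (ae_of_all _ fun x => ρ.nonneg_normed x), ρ.integral_normed, ENNReal.ofReal_one]
  have hHm : StronglyMeasurable (Function.uncurry fun x t : RN N => f (x - t) - f x) :=
    (hm.comp_measurable (measurable_fst.sub measurable_snd)).sub (hm.comp_measurable measurable_fst)
  refine eLpNorm_le_of_enorm_le_lintegral (ν := ν) hp hHm (fun x => ?_) ?_
  · rw [Pi.sub_apply, mollify_sub_eq_integral hf ρ x]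
    refine (enorm_integral_le_lintegral_enorm _).trans (le_of_eq ?_)
    rw [lintegral_withDensity_eq_lintegral_mul _ hρm]
    · refine lintegral_congr fun t => ?_
      rw [enorm_smul, Real.enorm_of_nonneg (ρ.nonneg_normed t)]; rfl
    · exact (hHm.comp_measurable measurable_prodMk_left).enorm
  · rw [ae_withDensity_iff hρm]
    refine ae_of_all _ fun t ht => hK t ?_
    have : t ∈ Function.support (ρ.normed volume) := by
      intro h; simp [h] at ht
    rw [ρ.support_normed_eq] at this
    simpa using this

/-- Translations of a `C¹` function, in terms of its derivative. -/
theorem eLpNorm_translate_sub_le_of_contDiff {p : ℝ} (hp : 1 ≤ p) {u : RN N → ℝ} (hu : ContDiff ℝ 1 u)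
    (t : RN N) :
    eLpNorm (fun x => u (x - t) - u x) (ENNReal.ofReal p)
      ≤ ‖t‖ₑ * eLpNorm (gradient u) (ENNReal.ofReal p) := by
  have hcg : Continuous (gradient u) := continuous_gradient (hu.continuous_fderiv (by simp))
  let ν : Measure ℝ := volume.restrict (Ioc (0 : ℝ) 1)
  have : IsProbabilityMeasure ν := ⟨by simp [ν]⟩
  refine eLpNorm_le_of_enorm_le_lintegral (ν := ν) hp
    (H := fun (x : RN N) (s : ℝ) => ‖t‖ • gradient u (x - s • t)) ?_ (fun x => ?_) ?_
  · have : Continuous (Function.uncurry fun (x : RN N) (s : ℝ) => ‖t‖ • gradient u (x - s • t)) := by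
      simp only [Function.uncurry_def]; fun_prop
    exact this.stronglyMeasurable
  -- The fundamental theorem of calculus along the segment from x to x - t.
  · have hd : ∀ s ∈ uIcc (0 : ℝ) 1,
        HasDerivAt (fun s : ℝ => u (x - s • t)) (-(inner ℝ (gradient u (x - s • t)) t)) s := by
      intro s _
      have h1 : HasDerivAt (fun s : ℝ => x - s • t) (-t) s := by
        simpa using ((hasDerivAt_id s).smul_const t).const_sub x
      have h2 := ((hu.differentiable (by simp)) (x - s • t)).hasFDerivAt.comp_hasDerivAt s h1
      rw [inner_gradient]
      exact h2.congr_deriv (map_neg _ _)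
    have hcont : Continuous fun s : ℝ => -(inner ℝ (gradient u (x - s • t)) t : ℝ) := by fun_prop
    have h3 := intervalIntegral.integral_eq_sub_of_hasDerivAt hd (hcont.intervalIntegrable _ _)
    simp only [one_smul, zero_smul, sub_zero] at h3
    rw [← h3, intervalIntegral.integral_of_le zero_le_one]
    refine (enorm_integral_le_lintegral_enorm _).trans (lintegral_mono fun s => ?_)
    simp only [enorm_neg, enorm_smul, enorm_norm]
    rw [mul_comm]
    simpa [enorm_eq_nnnorm, ← ENNReal.coe_mul] using nnnorm_inner_le_nnnorm (𝕜 := ℝ) (gradient u (x - s • t)) t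
  · refine ae_of_all _ fun s => ?_
    have e : (fun x => ‖t‖ • gradient u (x - s • t))
        = ‖t‖ • ((gradient u) ∘ fun x => x - s • t) := rfl
    rw [e, eLpNorm_const_smul, enorm_norm]
    rw [eLpNorm_comp_measurePreserving hcg.aestronglyMeasurable
      (measurePreserving_sub_right volume (s • t))]

theorem contDiff_mollify {u : RN N → F} (hu : LocallyIntegrable u) (ρ : ContDiffBump (0 : RN N)) :
    ContDiff ℝ ∞ (mollify (ρ.normed volume) u) := by
  rw [mollify_eq_convolution]
  exact ρ.hasCompactSupport_normed.contDiff_convolution_right (n := (⊤ : ℕ∞)) _ hu ρ.contDiff_normed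

theorem isTestFunction_bump_sub (ρ : ContDiffBump (0 : RN N)) (x : RN N) :
    IsTestFunction univ fun y => ρ.normed volume (x - y) :=
  ⟨ρ.contDiff_normed.comp (contDiff_const.sub contDiff_id),
    ρ.hasCompactSupport_normed.comp_homeomorph (Homeomorph.subLeft x), subset_univ _⟩

/-- The derivative falls on the kernel y ↦ ρ(x - y), which is a test function; the sign from the
reflection in y cancels the one from integration by parts. -/
theorem gradient_mollify {u : RN N → ℝ} {w : RN N → RN N} (h : IsWeakGradient univ u w)
    (ρ : ContDiffBump (0 : RN N)) :
    gradient (mollify (ρ.normed volume) u) = mollify (ρ.normed volume) w := by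
  have hu : LocallyIntegrable u := locallyIntegrableOn_univ.1 h.1
  have hw : LocallyIntegrable w := locallyIntegrableOn_univ.1 h.2.1
  ext1 x
  refine ext_inner_right ℝ fun e => ?_
  rw [inner_gradient, mollify_eq_convolution,
    (ρ.hasCompactSupport_normed.hasFDerivAt_convolution_right _ hu
      ρ.contDiff_normed x).fderiv]
  rw [convolution_precompR_apply _ hu (ρ.hasCompactSupport_normed.fderiv ℝ)
    (ρ.contDiff_normed.continuous_fderiv one_ne_zero)]
  have ht := isTestFunction_bump_sub ρ x
  have hd : ∀ y, fderiv ℝ (fun y => ρ.normed volume (x - y)) y e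
      = -(fderiv ℝ (ρ.normed volume) (x - y) e) := by
    intro y
    have h1 : HasFDerivAt (fun y : RN N => x - y) (-ContinuousLinearMap.id ℝ (RN N)) y :=
      (hasFDerivAt_id y).const_sub x
    have h2 := (((ρ.contDiff_normed (μ := volume) (n := 1)).differentiable
      one_ne_zero) (x - y)).hasFDerivAt.comp y h1
    rw [HasFDerivAt.fderiv (f := fun y => ρ.normed volume (x - y)) h2]
    simp
  have hh := h.2.2 _ ht e
  rw [setIntegral_univ, setIntegral_univ] at hh
  simp only [hd, mul_neg, integral_neg, neg_inj] at hh
  have e1 : (convolution u (fun a => fderiv ℝ (ρ.normed volume) a e)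
      (ContinuousLinearMap.lsmul ℝ ℝ).flip volume) x
      = ∫ y, u y * fderiv ℝ (ρ.normed volume) (x - y) e := by
    rw [convolution_def]
    refine integral_congr_ae (ae_of_all _ fun y => ?_)
    simp [mul_comm]
  rw [e1, hh, mollify, real_inner_comm, ← integral_inner
    (integrable_mollify_integrand hw ρ.continuous_normed ρ.hasCompactSupport_normed x)]
  refine integral_congr_ae (ae_of_all _ fun y => ?_)
  simp [inner_smul_right, real_inner_comm]

/-- The bump function of outer radius `δ`. -/
noncomputable def bumpOfRadius (N : ℕ) (δ : ℝ) (hδ : 0 < δ) : ContDiffBump (0 : RN N) :=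
  ⟨δ / 2, δ, by linarith, by linarith⟩

/-- Smooth functions are dense in `W^{1,p}(ℝ^N)`. -/
theorem exists_smooth_approx {p : ℝ} (hp : 1 ≤ p) {u : RN N → ℝ} {w : RN N → RN N}
    (hu : MemLp u (ENNReal.ofReal p)) (hw : MemLp w (ENNReal.ofReal p))
    (h : IsWeakGradient univ u w) {ε : ENNReal} (hε : 0 < ε) :
    ∃ φ : RN N → ℝ, ContDiff ℝ ∞ φ ∧ eLpNorm (φ - u) (ENNReal.ofReal p) ≤ ε ∧
      eLpNorm (gradient φ - w) (ENNReal.ofReal p) ≤ ε := by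
  have hP : 1 ≤ ENNReal.ofReal p := by simpa using hp
  obtain ⟨δ₁, hδ₁, h1⟩ := exists_delta_eLpNorm_translate_le hP ENNReal.ofReal_ne_top hu hε
  obtain ⟨δ₂, hδ₂, h2⟩ := exists_delta_eLpNorm_translate_le hP ENNReal.ofReal_ne_top hw hε
  let ρ := bumpOfRadius N (min δ₁ δ₂) (lt_min hδ₁ hδ₂)
  refine ⟨mollify (ρ.normed volume) u, contDiff_mollify (hu.locallyIntegrable hP) ρ, ?_, ?_⟩
  · exact eLpNorm_mollify_sub_le_of_translate hp (hu.locallyIntegrable hP) ρ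
      fun t ht => h1 t (lt_of_lt_of_le ht (min_le_left _ _))
  · rw [gradient_mollify h]
    exact eLpNorm_mollify_sub_le_of_translate hp (hw.locallyIntegrable hP) ρ
      fun t ht => h2 t (lt_of_lt_of_le ht (min_le_right _ _))

/-- Translations of a Sobolev function, in terms of its weak gradient. -/
theorem IsWeakGradient.eLpNorm_translate_sub_le {p : ℝ} (hp : 1 ≤ p) {u : RN N → ℝ}
    {w : RN N → RN N} (hu : MemLp u (ENNReal.ofReal p)) (hw : MemLp w (ENNReal.ofReal p))
    (h : IsWeakGradient univ u w) (t : RN N) :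
    eLpNorm (fun x => u (x - t) - u x) (ENNReal.ofReal p)
      ≤ ‖t‖ₑ * eLpNorm w (ENNReal.ofReal p) := by
  have hP : 1 ≤ ENNReal.ofReal p := by simpa using hp
  refine ENNReal.le_of_forall_pos_le_add fun ε hε _ => ?_
  have hT : ‖t‖ₑ + 2 ≠ ⊤ := by finiteness
  -- The share ε / (‖t‖ + 2) is spent twice on replacing u by φ, at x and at x - t, and ‖t‖ times on
  -- the gradient.
  obtain ⟨φ, hφ, h1, h2⟩ := exists_smooth_approx hp hu hw h (ε := ε / (‖t‖ₑ + 2))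
    (ENNReal.div_pos (by exact_mod_cast hε.ne') hT)
  have e0 := fun φ hφ => eLpNorm_translate_sub_le_of_contDiff (N := N) hp (u := φ) hφ t
  generalize hκ : (ε : ENNReal) / (‖t‖ₑ + 2) = κ at h1 h2
  generalize ENNReal.ofReal p = P at *
  have mp := measurePreserving_sub_right (volume : Measure (RN N)) t
  have m1 : AEStronglyMeasurable (φ - u) volume := hφ.continuous.aestronglyMeasurable.sub hu.1
  have cg : Continuous (gradient φ) := continuous_gradient (hφ.continuous_fderiv (by simp))
  have e1 : (fun x => u (x - t) - u x)
      = ((fun x => φ (x - t) - φ x) - (φ - u) ∘ (fun x => x - t)) + (φ - u) := by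
    ext x; simp
  have e2 : eLpNorm ((φ - u) ∘ fun x => x - t) P = eLpNorm (φ - u) P :=
    eLpNorm_comp_measurePreserving m1 mp
  have m2 : AEStronglyMeasurable (fun x => φ (x - t) - φ x) volume :=
    ((hφ.continuous.comp (by fun_prop : Continuous fun x : RN N => x - t)).sub
      hφ.continuous).aestronglyMeasurable
  have m3 := m1.comp_measurePreserving mp
  have e3 : eLpNorm (gradient φ) P ≤ κ + eLpNorm w P := by
    have : gradient φ = (gradient φ - w) + w := by simp
    rw [this]
    exact (eLpNorm_add_le (cg.aestronglyMeasurable.sub hw.1) hw.1 hP).trans (by gcongr)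
  have e4 : eLpNorm (fun x => φ (x - t) - φ x) P ≤ ‖t‖ₑ * (κ + eLpNorm w P) :=
    (e0 φ (hφ.of_le (by simp))).trans (by gcongr)
  have b1 := eLpNorm_add_le (m2.sub m3) m1 hP
  have b2 := eLpNorm_sub_le m2 m3 hP
  rw [← e1] at b1
  rw [e2] at b2
  have b3 : eLpNorm (fun x => u (x - t) - u x) P ≤ ‖t‖ₑ * (κ + eLpNorm w P) + κ + κ :=
    b1.trans (add_le_add (b2.trans (add_le_add e4 h1)) h1)
  refine b3.trans (le_of_eq ?_)
  rw [← ENNReal.div_mul_cancel (a := ‖t‖ₑ + 2) (b := (ε : ENNReal)) (by simp) hT, hκ]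
  ring

/-- Averaging the translation estimate over the support of the kernel. The error is uniform over
sets with bounded gradients, which is the compactness mechanism in Rellich's theorem. -/
theorem IsWeakGradient.eLpNorm_mollify_sub_le {p : ℝ} (hp : 1 ≤ p) {u : RN N → ℝ}
    {w : RN N → RN N} (hu : MemLp u (ENNReal.ofReal p)) (hw : MemLp w (ENNReal.ofReal p))
    (h : IsWeakGradient univ u w) (ρ : ContDiffBump (0 : RN N)) :
    eLpNorm (mollify (ρ.normed volume) u - u) (ENNReal.ofReal p)
      ≤ ENNReal.ofReal ρ.rOut * eLpNorm w (ENNReal.ofReal p) := by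
  refine eLpNorm_mollify_sub_le_of_translate hp
    (hu.locallyIntegrable (by simpa using hp)) ρ fun t ht => ?_
  refine (h.eLpNorm_translate_sub_le hp hu hw t).trans ?_
  gcongr
  rw [← ofReal_norm]
  exact ENNReal.ofReal_le_ofReal ht.le

end Mollification

/-! ### L^p norms as real integrals. -/

section LpReal

variable {α F : Type*} [MeasurableSpace α] {ν : Measure α} [NormedAddCommGroup F] {p : ℝ}

theorem integrable_norm_rpow_iff_memLp (hp : 0 < p) {f : α → F} (hf : AEStronglyMeasurable f ν) :
    Integrable (fun x => ‖f x‖ ^ p) ν ↔ MemLp f (ENNReal.ofReal p) ν := by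
  have := integrable_norm_rpow_iff hf (p := ENNReal.ofReal p) (by simpa using hp)
    ENNReal.ofReal_ne_top
  rwa [ENNReal.toReal_ofReal hp.le] at this

theorem MemLp.integrable_rpow (hp : 0 < p) {f : α → F} (hf : MemLp f (ENNReal.ofReal p) ν) :
    Integrable (fun x => ‖f x‖ ^ p) ν :=
  (integrable_norm_rpow_iff_memLp hp hf.1).2 hf

theorem eLpNorm_eq_ofReal_integral (hp : 0 < p) {f : α → F} (hf : MemLp f (ENNReal.ofReal p) ν) :
    eLpNorm f (ENNReal.ofReal p) ν = ENNReal.ofReal ((∫ x, ‖f x‖ ^ p ∂ν) ^ (1 / p)) := by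
  rw [hf.eLpNorm_eq_integral_rpow_norm (by simpa using hp) ENNReal.ofReal_ne_top,
    ENNReal.toReal_ofReal hp.le, one_div]

theorem tendsto_rpow_zero_iff {ι : Type*} {l : Filter ι} (hp : 0 < p) {a : ι → ℝ}
    (ha : ∀ n, 0 ≤ a n) :
    Tendsto (fun n => a n ^ p) l (𝓝 0) ↔ Tendsto a l (𝓝 0) := by
  have key : ∀ {r : ℝ}, 0 < r → ∀ {b : ι → ℝ}, Tendsto b l (𝓝 0) →
      Tendsto (fun n => b n ^ r) l (𝓝 0) := fun {r} hr b hb => by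
    have := hb.rpow_const (p := r) (Or.inr hr.le)
    rwa [Real.zero_rpow hr.ne'] at this
  refine ⟨fun h => ?_, key hp⟩
  have := key (inv_pos.2 hp) h
  refine this.congr fun n => ?_
  rw [← Real.rpow_mul (ha n), mul_inv_cancel₀ hp.ne', Real.rpow_one]

theorem tendsto_eLpNorm_zero_iff {ι : Type*} {l : Filter ι} (hp : 0 < p) {f : ι → α → F}
    (hf : ∀ n, MemLp (f n) (ENNReal.ofReal p) ν) :
    Tendsto (fun n => eLpNorm (f n) (ENNReal.ofReal p) ν) l (𝓝 0) ↔
      Tendsto (fun n => ∫ x, ‖f n x‖ ^ p ∂ν) l (𝓝 0) := by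
  have h0 : ∀ n, 0 ≤ ∫ x, ‖f n x‖ ^ p ∂ν := fun n =>
    integral_nonneg fun x => Real.rpow_nonneg (norm_nonneg _) _
  rw [← tendsto_rpow_zero_iff (p := 1 / p) (by positivity) h0]
  simp_rw [eLpNorm_eq_ofReal_integral hp (hf _)]
  constructor
  · intro h
    have := (ENNReal.tendsto_toReal ENNReal.zero_ne_top).comp h
    simp only [Function.comp_def, ENNReal.toReal_zero] at this
    exact this.congr fun n => ENNReal.toReal_ofReal (Real.rpow_nonneg (h0 n) _)
  · intro h
    simpa using ENNReal.tendsto_ofReal h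

theorem tendsto_eLpNorm_zero_of_dominated (hp : 0 < p) {G : Type*} [NormedAddCommGroup G]
    {f : ℕ → α → F} {g : α → G} (hf : ∀ n, AEStronglyMeasurable (f n) ν)
    (hg : MemLp g (ENNReal.ofReal p) ν) {C : ℝ} (hb : ∀ n, ∀ᵐ x ∂ν, ‖f n x‖ ≤ C * ‖g x‖)
    (hlim : ∀ᵐ x ∂ν, Tendsto (fun n => f n x) atTop (𝓝 0)) :
    Tendsto (fun n => eLpNorm (f n) (ENNReal.ofReal p) ν) atTop (𝓝 0) := by
  have hm : ∀ n, MemLp (f n) (ENNReal.ofReal p) ν := fun n => hg.of_le_mul (hf n) (hb n)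
  rw [tendsto_eLpNorm_zero_iff hp hm]
  have : Tendsto (fun n => ∫ x, ‖f n x‖ ^ p ∂ν) atTop (𝓝 (∫ _, 0 ∂ν)) := by
    refine tendsto_integral_of_dominated_convergence (fun x => |C| ^ p * ‖g x‖ ^ p)
      (fun n => (MemLp.integrable_rpow hp (hm n)).1)
      ((MemLp.integrable_rpow hp hg).const_mul _) (fun n => ?_) ?_
    · filter_upwards [hb n] with x hx
      rw [Real.norm_of_nonneg (Real.rpow_nonneg (norm_nonneg _) _),
        ← Real.mul_rpow (abs_nonneg _) (norm_nonneg _)]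
      gcongr
      exact hx.trans (by gcongr; exact le_abs_self C)
    · filter_upwards [hlim] with x hx
      exact (tendsto_rpow_zero_iff hp fun n => norm_nonneg _).2 (by simpa using hx.norm)
  simpa using this

end LpReal

/-! ### Chain rule, cut-offs and the space W_0^{1,p} through smooth approximation. -/

section SmoothApproximation

variable {N : ℕ} {p : ℝ} {Ω : Set (RN N)}

/-- The smooth functions `φ n` converge to `u` in `L^p` and almost everywhere, and their gradients
converge to `w` in `L^p`. -/
structure SmoothApprox (p : ℝ) (u : RN N → ℝ) (w : RN N → RN N) (φ : ℕ → RN N → ℝ) : Prop where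
  memLp : MemLp u (ENNReal.ofReal p)
  memLp_grad : MemLp w (ENNReal.ofReal p)
  smooth : ∀ n, ContDiff ℝ ∞ (φ n)
  tendsto : Tendsto (fun n => eLpNorm (φ n - u) (ENNReal.ofReal p)) atTop (𝓝 0)
  tendsto_grad : Tendsto (fun n => eLpNorm (gradient (φ n) - w) (ENNReal.ofReal p)) atTop (𝓝 0)
  ae : ∀ᵐ x, Tendsto (fun n => φ n x) atTop (𝓝 (u x))

/-- Tolerances 1/(n+1) followed by an almost everywhere convergent subsequence. The predicate `Q`
carries along extra information on the approximants, such as their support. -/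
theorem SmoothApprox.exists_of_forall (hp : 1 ≤ p) {u : RN N → ℝ} {w : RN N → RN N}
    (hu : MemLp u (ENNReal.ofReal p)) (hw : MemLp w (ENNReal.ofReal p))
    {Q : (RN N → ℝ) → Prop}
    (h : ∀ ε : ENNReal, 0 < ε → ∃ φ : RN N → ℝ, Q φ ∧ ContDiff ℝ ∞ φ ∧
      eLpNorm (φ - u) (ENNReal.ofReal p) ≤ ε ∧ eLpNorm (gradient φ - w) (ENNReal.ofReal p) ≤ ε) :
    ∃ φ : ℕ → RN N → ℝ, (∀ n, Q (φ n)) ∧ SmoothApprox p u w φ := by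
  have h' := fun n : ℕ => h ((n : ENNReal) + 1)⁻¹ (by simp)
  choose φ hQ hs h1 h2 using h'
  have hz : Tendsto (fun n : ℕ => ((n : ENNReal) + 1)⁻¹) atTop (𝓝 0) := by
    have := (ENNReal.tendsto_inv_nat_nhds_zero).comp (tendsto_add_atTop_nat 1)
    simpa [Function.comp_def] using this
  have t1 : Tendsto (fun n => eLpNorm (φ n - u) (ENNReal.ofReal p)) atTop (𝓝 0) :=
    tendsto_of_tendsto_of_tendsto_of_le_of_le tendsto_const_nhds hz (fun _ => zero_le) h1
  have t2 : Tendsto (fun n => eLpNorm (gradient (φ n) - w) (ENNReal.ofReal p)) atTop (𝓝 0) :=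
    tendsto_of_tendsto_of_tendsto_of_le_of_le tendsto_const_nhds hz (fun _ => zero_le) h2
  obtain ⟨ns, hns, hae⟩ := (tendstoInMeasure_of_tendsto_eLpNorm (by simp; linarith)
    (fun n => (hs n).continuous.aestronglyMeasurable) hu.1 t1).exists_seq_tendsto_ae
  exact ⟨fun n => φ (ns n), fun n => hQ _, hu, hw, fun n => hs _, t1.comp hns.tendsto_atTop,
    t2.comp hns.tendsto_atTop, hae⟩

theorem SmoothApprox.of_isWeakGradient (hp : 1 ≤ p) {u : RN N → ℝ} {w : RN N → RN N}
    (hu : MemLp u (ENNReal.ofReal p)) (hw : MemLp w (ENNReal.ofReal p))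
    (h : IsWeakGradient univ u w) : ∃ φ, SmoothApprox p u w φ := by
  obtain ⟨φ, -, hφ⟩ := SmoothApprox.exists_of_forall (Q := fun _ => True) hp hu hw fun ε hε => by
    obtain ⟨φ, h0, h1, h2⟩ := exists_smooth_approx hp hu hw h hε
    exact ⟨φ, trivial, h0, h1, h2⟩
  exact ⟨φ, hφ⟩

theorem contDiff_continuous_gradient {φ : RN N → ℝ} (h : ContDiff ℝ ∞ φ) :
    Continuous (gradient φ) :=
  continuous_gradient (h.continuous_fderiv (by simp))

theorem gradient_mul_comp {η φ : RN N → ℝ} {F : ℝ → ℝ} {x : RN N} (hη : DifferentiableAt ℝ η x)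
    (hφ : DifferentiableAt ℝ φ x) (hF : DifferentiableAt ℝ F (φ x)) :
    gradient (fun y => η y * F (φ y)) x
      = F (φ x) • gradient η x + (η x * deriv F (φ x)) • gradient φ x := by
  refine ext_inner_right ℝ fun e => ?_
  rw [inner_gradient]
  have h1 : HasFDerivAt (fun y => F (φ y)) (deriv F (φ x) • fderiv ℝ φ x) x :=
    hF.hasDerivAt.comp_hasFDerivAt x hφ.hasFDerivAt
  have h2 := hη.hasFDerivAt.mul h1
  have h3 : fderiv ℝ (fun y => η y * F (φ y)) x = _ := h2.fderiv
  rw [h3, inner_add_left, inner_smul_left, inner_smul_left, inner_gradient, inner_gradient]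
  simp
  ring

/-- Composition with a smooth Lipschitz function and multiplication by a smooth cut-off function. -/
theorem SmoothApprox.mul_comp (hp : 1 ≤ p) {u : RN N → ℝ} {w : RN N → RN N}
    {φ : ℕ → RN N → ℝ} (h : SmoothApprox p u w φ) {η : RN N → ℝ} (hη : ContDiff ℝ ∞ η)
    {C : ℝ} (hηC : ∀ x, |η x| ≤ C) (hηC' : ∀ x, ‖gradient η x‖ ≤ C)
    {F : ℝ → ℝ} (hF : ContDiff ℝ ∞ F) (hF0 : F 0 = 0) {L : ℝ} (hL : ∀ t, |deriv F t| ≤ L) :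
    SmoothApprox p (fun x => η x * F (u x))
      (fun x => F (u x) • gradient η x + (η x * deriv F (u x)) • w x)
      (fun n x => η x * F (φ n x)) := by
  have hp0 : 0 < p := by linarith
  have hP : 1 ≤ ENNReal.ofReal p := by simpa using hp
  have hC : 0 ≤ C := (abs_nonneg _).trans (hηC 0)
  have hL0 : 0 ≤ L := (abs_nonneg _).trans (hL 0)
  have hFd : Differentiable ℝ F := hF.differentiable (by simp)
  have hF'c : Continuous (deriv F) := hF.continuous_deriv (by simp)
  have hlip : ∀ a b, |F a - F b| ≤ L * |a - b| := by
    intro a b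
    have := (convex_univ (𝕜 := ℝ)).norm_image_sub_le_of_norm_deriv_le (f := F) (C := L)
      (fun x _ => hFd x) (fun x _ => hL x) (mem_univ b) (mem_univ a)
    simpa using this
  have hFu : ∀ t, |F t| ≤ L * |t| := fun t => by simpa [hF0] using hlip t 0
  have mη : AEStronglyMeasurable η (volume : Measure (RN N)) := hη.continuous.aestronglyMeasurable
  have mgη : AEStronglyMeasurable (gradient η) (volume : Measure (RN N)) :=
    (contDiff_continuous_gradient hη).aestronglyMeasurable
  have mFu : AEStronglyMeasurable (fun x => F (u x)) volume :=
    hF.continuous.comp_aestronglyMeasurable h.memLp.1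
  have mF'u : AEStronglyMeasurable (fun x => deriv F (u x)) volume :=
    hF'c.comp_aestronglyMeasurable h.memLp.1
  have mφ : ∀ n, AEStronglyMeasurable (φ n) volume := fun n =>
    (h.smooth n).continuous.aestronglyMeasurable
  have mgφ : ∀ n, AEStronglyMeasurable (gradient (φ n)) volume := fun n =>
    (contDiff_continuous_gradient (h.smooth n)).aestronglyMeasurable
  have mFφ : ∀ n, AEStronglyMeasurable (fun x => F (φ n x)) volume := fun n =>
    hF.continuous.comp_aestronglyMeasurable (mφ n)
  have mF'φ : ∀ n, AEStronglyMeasurable (fun x => deriv F (φ n x)) volume := fun n =>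
    hF'c.comp_aestronglyMeasurable (mφ n)
  have z1 : ∀ (c : ENNReal), c ≠ ⊤ → Tendsto
      (fun n => c * eLpNorm (φ n - u) (ENNReal.ofReal p)) atTop (𝓝 0) := fun c hc => by
    simpa using ENNReal.Tendsto.const_mul h.tendsto (Or.inr hc)
  refine ⟨?_, ?_, fun n => hη.mul (hF.comp (h.smooth n)), ?_, ?_, ?_⟩
  · refine h.memLp.of_le_mul (c := C * L) (mη.mul mFu) (ae_of_all _ fun x => ?_)
    rw [norm_mul, mul_assoc]
    exact mul_le_mul (hηC x) (hFu _) (abs_nonneg _) hC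
  · refine MemLp.add ?_ ?_
    · refine h.memLp.of_le_mul (c := C * L) (mFu.smul mgη) (ae_of_all _ fun x => ?_)
      rw [norm_smul, mul_assoc, mul_comm]
      exact mul_le_mul (hηC' x) (hFu _) (abs_nonneg _) hC
    · refine h.memLp_grad.of_le_mul (c := C * L) ((mη.mul mF'u).smul h.memLp_grad.1)
        (ae_of_all _ fun x => ?_)
      rw [norm_smul, norm_mul]
      gcongr
      exacts [hηC x, hL _]
  · refine tendsto_of_tendsto_of_tendsto_of_le_of_le tendsto_const_nhds
      (z1 (ENNReal.ofReal (C * L)) ENNReal.ofReal_ne_top) (fun _ => zero_le) fun n => ?_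
    refine eLpNorm_le_mul_eLpNorm_of_ae_le_mul (ae_of_all _ fun x => ?_) _
    simp only [Pi.sub_apply]
    rw [← mul_sub, norm_mul, mul_assoc]
    exact mul_le_mul (hηC x) (hlip _ _) (abs_nonneg _) hC
  -- The gradient error splits into `a` (values of F differ), `b` (gradients differ, bounded
  -- coefficient) and `c` (coefficients differ, fixed gradient w). Only `c` needs almost everywhere
  -- convergence, through dominated convergence.
  · set a : ℕ → RN N → RN N := fun n x => (F (φ n x) - F (u x)) • gradient η x
    set b : ℕ → RN N → RN N := fun n x => (η x * deriv F (φ n x)) • (gradient (φ n) x - w x)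
    set c : ℕ → RN N → RN N := fun n x => (η x * (deriv F (φ n x) - deriv F (u x))) • w x
    have ma : ∀ n, AEStronglyMeasurable (a n) volume := fun n => ((mFφ n).sub mFu).smul mgη
    have mb : ∀ n, AEStronglyMeasurable (b n) volume := fun n =>
      (mη.mul (mF'φ n)).smul ((mgφ n).sub h.memLp_grad.1)
    have mc : ∀ n, AEStronglyMeasurable (c n) volume := fun n =>
      (mη.mul ((mF'φ n).sub mF'u)).smul h.memLp_grad.1
    have e : ∀ n, (gradient fun x => η x * F (φ n x)) -
        (fun x => F (u x) • gradient η x + (η x * deriv F (u x)) • w x) = a n + b n + c n := by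
      intro n
      ext1 x
      simp only [Pi.sub_apply, Pi.add_apply, a, b, c]
      rw [gradient_mul_comp (hη.differentiable (by simp) x)
        ((h.smooth n).differentiable (by simp) x) (hFd _)]
      module
    have la : Tendsto (fun n => eLpNorm (a n) (ENNReal.ofReal p)) atTop (𝓝 0) := by
      refine tendsto_of_tendsto_of_tendsto_of_le_of_le tendsto_const_nhds
        (z1 (ENNReal.ofReal (C * L)) ENNReal.ofReal_ne_top) (fun _ => zero_le) fun n => ?_
      refine eLpNorm_le_mul_eLpNorm_of_ae_le_mul (ae_of_all _ fun x => ?_) _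
      rw [norm_smul, mul_assoc, mul_comm]
      exact mul_le_mul (hηC' x) (hlip _ _) (abs_nonneg _) hC
    have lb : Tendsto (fun n => eLpNorm (b n) (ENNReal.ofReal p)) atTop (𝓝 0) := by
      have z2 := ENNReal.Tendsto.const_mul h.tendsto_grad
        (Or.inr (ENNReal.ofReal_ne_top (r := C * L)))
      rw [mul_zero] at z2
      refine tendsto_of_tendsto_of_tendsto_of_le_of_le tendsto_const_nhds z2
        (fun _ => zero_le) fun n => ?_
      refine eLpNorm_le_mul_eLpNorm_of_ae_le_mul (ae_of_all _ fun x => ?_) _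
      rw [norm_smul, norm_mul]
      simp only [Pi.sub_apply]
      gcongr
      exacts [hηC x, hL _]
    have lc : Tendsto (fun n => eLpNorm (c n) (ENNReal.ofReal p)) atTop (𝓝 0) := by
      refine tendsto_eLpNorm_zero_of_dominated hp0 mc h.memLp_grad (C := C * (L + L))
        (fun n => ae_of_all _ fun x => ?_) ?_
      · rw [norm_smul, norm_mul]
        gcongr
        exacts [hηC x, (norm_sub_le _ _).trans (add_le_add (hL _) (hL _))]
      · filter_upwards [h.ae] with x hx
        have l1 : Tendsto (fun n => deriv F (φ n x) - deriv F (u x)) atTop (𝓝 0) := by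
          simpa using ((hF'c.tendsto _).comp hx).sub_const (deriv F (u x))
        simpa using (l1.const_mul (η x)).smul_const (w x)
    have lsum := (la.add lb).add lc
    simp only [add_zero] at lsum
    refine tendsto_of_tendsto_of_tendsto_of_le_of_le tendsto_const_nhds lsum
      (fun _ => zero_le) fun n => ?_
    simp only [e]
    exact (eLpNorm_add_le ((ma n).add (mb n)) (mc n) hP).trans
      (by gcongr; exact eLpNorm_add_le (ma n) (mb n) hP)
  · filter_upwards [h.ae] with x hx
    exact ((hF.continuous.tendsto _).comp hx).const_mul (η x)

theorem SmoothApprox.isWeakGradient (hp : 1 ≤ p) {u : RN N → ℝ} {w : RN N → RN N}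
    {φ : ℕ → RN N → ℝ} (h : SmoothApprox p u w φ) : IsWeakGradient univ u w := by
  have hP : 1 ≤ ENNReal.ofReal p := by simpa using hp
  have ev : ∀ᶠ n in atTop, eLpNorm (φ n - u) (ENNReal.ofReal p) < 1 ∧
      eLpNorm (gradient (φ n) - w) (ENNReal.ofReal p) < 1 :=
    (h.tendsto.eventually (gt_mem_nhds one_pos)).and
      (h.tendsto_grad.eventually (gt_mem_nhds one_pos))
  -- An approximant is known to lie in L^p only once its distance to the limit is finite, so the
  -- first `n₀` terms are dropped.
  obtain ⟨n₀, hn₀⟩ := eventually_atTop.1 ev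
  have t := tendsto_add_atTop_nat n₀
  refine IsWeakGradient.of_tendsto hP (fun n => isWeakGradient_gradient (h.smooth (n + n₀)))
    (fun n => ?_) (fun n => ?_) h.memLp h.memLp_grad (h.tendsto.comp t) (h.tendsto_grad.comp t)
  · have : MemLp (φ (n + n₀) - u) (ENNReal.ofReal p) :=
      ⟨(h.smooth _).continuous.aestronglyMeasurable.sub h.memLp.1,
        (hn₀ _ (by lia)).1.trans ENNReal.one_lt_top⟩
    simpa using this.add h.memLp
  · have : MemLp (gradient (φ (n + n₀)) - w) (ENNReal.ofReal p) :=
      ⟨(contDiff_continuous_gradient (h.smooth _)).aestronglyMeasurable.sub h.memLp_grad.1,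
        (hn₀ _ (by lia)).2.trans ENNReal.one_lt_top⟩
    simpa using this.add h.memLp_grad

/-- `u`, extended by `0`, belongs to `W_0^{1,p}(Ω)`, with weak gradient `w` on `ℝ^N`. -/
def InW0 (Ω : Set (RN N)) (p : ℝ) (u : RN N → ℝ) (w : RN N → RN N) : Prop :=
  ∃ φ : ℕ → RN N → ℝ, (∀ n, IsTestFunction Ω (φ n)) ∧ SmoothApprox p u w φ

theorem InW0.isWeakGradient (hp : 1 ≤ p) {u : RN N → ℝ} {w : RN N → RN N} (h : InW0 Ω p u w) :
    IsWeakGradient univ u w :=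
  h.choose_spec.2.isWeakGradient hp

theorem InW0.memLp {u : RN N → ℝ} {w : RN N → RN N} (h : InW0 Ω p u w) :
    MemLp u (ENNReal.ofReal p) := h.choose_spec.2.memLp

theorem InW0.memLp_grad {u : RN N → ℝ} {w : RN N → RN N} (h : InW0 Ω p u w) :
    MemLp w (ENNReal.ofReal p) := h.choose_spec.2.memLp_grad

theorem gradient_const_fun (c : ℝ) (x : RN N) : gradient (fun _ : RN N => c) x = 0 := by
  simp [gradient]

/-- Since F(0) = 0, composing with F does not enlarge the supports of the approximating test
functions. -/
theorem InW0.comp (hp : 1 ≤ p) {u : RN N → ℝ} {w : RN N → RN N} (h : InW0 Ω p u w)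
    {F : ℝ → ℝ} (hF : ContDiff ℝ ∞ F) (hF0 : F 0 = 0) {L : ℝ} (hL : ∀ t, |deriv F t| ≤ L) :
    InW0 Ω p (fun x => F (u x)) (fun x => deriv F (u x) • w x) := by
  obtain ⟨φ, ht, ha⟩ := h
  have := ha.mul_comp hp (η := fun _ => 1) contDiff_const (C := 1) (by simp)
    (by simp [gradient_const_fun]) hF hF0 hL
  simp only [one_mul, gradient_const_fun, smul_zero, zero_add] at this
  refine ⟨_, fun n => ⟨this.smooth n, (ht n).2.1.comp_left hF0, ?_⟩, this⟩
  exact (closure_mono (Function.support_comp_subset hF0 (φ n))).trans (ht n).2.2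

/-- The cut-off alone puts the approximants in C_c^∞(Ω), so u itself need not vanish outside Ω. This
is what makes u_k - u_∞ usable in a test function on B_k. -/
theorem SmoothApprox.inW0_mul_comp (hp : 1 ≤ p) {u : RN N → ℝ} {w : RN N → RN N}
    {φ : ℕ → RN N → ℝ} (h : SmoothApprox p u w φ) {η : RN N → ℝ} (hη : IsTestFunction Ω η)
    {F : ℝ → ℝ} (hF : ContDiff ℝ ∞ F) (hF0 : F 0 = 0) {L : ℝ} (hL : ∀ t, |deriv F t| ≤ L) :
    InW0 Ω p (fun x => η x * F (u x))
      (fun x => F (u x) • gradient η x + (η x * deriv F (u x)) • w x) := by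
  obtain ⟨C₁, hC₁⟩ := hη.2.1.exists_bound_of_continuous hη.continuous
  obtain ⟨C₂, hC₂⟩ := (hη.2.1.fderiv ℝ).exists_bound_of_continuous hη.continuous_fderiv
  have := h.mul_comp hp hη.1 (C := max C₁ C₂) (fun x => (hC₁ x).trans (le_max_left _ _))
    (fun x => (norm_gradient_eq η x).trans_le ((hC₂ x).trans (le_max_right _ _))) hF hF0 hL
  refine ⟨_, fun n => ⟨this.smooth n, hη.2.1.mul_right, ?_⟩, this⟩
  exact (tsupport_mul_subset_left).trans hη.2.2

/-- Norms over Ω are dominated by norms over the whole space, and the chosen weak gradient on Ω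
agrees almost everywhere there with the whole-space one. -/
theorem InW0.memW0 (hΩ : IsOpen Ω) (hp : 1 ≤ p) {u : RN N → ℝ} {w : RN N → RN N}
    (h : InW0 Ω p u w) : MemW0 Ω p u := by
  have hp0 : 0 < p := by linarith
  have hw := h.isWeakGradient hp
  obtain ⟨φ, ht, ha⟩ := h
  refine ⟨⟨ha.memLp.restrict _, w, hw.restrict, ha.memLp_grad.restrict _⟩, fun ε hε => ?_⟩
  have hg : ∀ n, MemLp (gradient (φ n)) (ENNReal.ofReal p) := fun n => by
    refine (contDiff_continuous_gradient (ha.smooth n)).memLp_of_hasCompactSupport ?_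
    exact ((ht n).2.1.fderiv ℝ).comp_left (g := (InnerProductSpace.toDual ℝ (RN N)).symm) (map_zero _)
  have hφ : ∀ n, MemLp (φ n) (ENNReal.ofReal p) := fun n =>
    (ht n).continuous.memLp_of_hasCompactSupport (ht n).2.1
  have t1 := (tendsto_eLpNorm_zero_iff hp0 fun n => (hφ n).sub ha.memLp).1 ha.tendsto
  have t2 := (tendsto_eLpNorm_zero_iff hp0 fun n => (hg n).sub ha.memLp_grad).1 ha.tendsto_grad
  have t3 := t2.add t1
  rw [add_zero] at t3
  have hnn : ∀ n, 0 ≤ (∫ x, ‖(gradient (φ n) - w) x‖ ^ p) + ∫ x, ‖(φ n - u) x‖ ^ p := fun n =>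
    add_nonneg (integral_nonneg fun x => by positivity) (integral_nonneg fun x => by positivity)
  have t4 := (tendsto_rpow_zero_iff (p := 1 / p) (by positivity) hnn).2 t3
  obtain ⟨n, hn⟩ := (t4.eventually (gt_mem_nhds hε)).exists
  refine ⟨φ n, ht n, lt_of_le_of_lt ?_ hn⟩
  have hgr := weakGradient_ae_eq hΩ
    ((hw.restrict (Ω := Ω)).sub (isWeakGradient_gradient (ha.smooth n)))
  rw [normW]
  refine Real.rpow_le_rpow (add_nonneg (integral_nonneg fun x => by positivity)
    (integral_nonneg fun x => by positivity)) (add_le_add ?_ ?_) (by positivity)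
  · rw [integral_congr_ae (g := fun x => ‖(gradient (φ n) - w) x‖ ^ p)]
    · exact setIntegral_le_integral (MemLp.integrable_rpow hp0 ((hg n).sub ha.memLp_grad))
        (ae_of_all _ fun x => by simp only [Pi.zero_apply]; positivity)
    · filter_upwards [hgr] with x hx
      rw [hx, ← norm_neg]; simp
  · rw [integral_congr_ae (g := fun x => ‖(φ n - u) x‖ ^ p)]
    · exact setIntegral_le_integral (MemLp.integrable_rpow hp0 ((hφ n).sub ha.memLp))
        (ae_of_all _ fun x => by simp only [Pi.zero_apply]; positivity)
    · refine ae_of_all _ fun x => ?_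
      simp [abs_sub_comm]

theorem InW0.memXOn (hΩ : IsOpen Ω) (hp : 1 ≤ p) {V : RN N → ℝ} {u : RN N → ℝ} {w : RN N → RN N}
    (h : InW0 Ω p u w) (hV : IntegrableOn (fun x => V x * |u x| ^ p) Ω)
    {C : ℝ} (hC : ∀ᵐ x, |u x| ≤ C) (h0 : ∀ᵐ x, x ∉ Ω → u x = 0) : MemXOn Ω V p u :=
  ⟨h.memW0 hΩ hp, hV, (memLp_top_of_bound h.memLp.1 C hC).restrict _, h0⟩

/-- Test functions on Ω and their gradients vanish off Ω, so approximation in the norm over Ω is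
approximation over ℝ^N of the extension by zero; the gradient of that extension is w extended by
zero. -/
theorem MemXOn.exists_inW0 (hΩ : IsOpen Ω) (hp : 1 ≤ p) {V : RN N → ℝ} {u : RN N → ℝ}
    (h : MemXOn Ω V p u) : ∃ w, InW0 Ω p u w := by
  have hp0 : 0 < p := by linarith
  obtain ⟨⟨⟨hu, w, hw, hwp⟩, happ⟩, -, -, h0⟩ := h
  have eu : Ω.indicator u =ᵐ[volume] u := by
    filter_upwards [h0] with x hx
    by_cases hxΩ : x ∈ Ω
    · simp [hxΩ]
    · simp [hxΩ, hx hxΩ]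
  have hu' : MemLp u (ENNReal.ofReal p) :=
    ((memLp_indicator_iff_restrict hΩ.measurableSet).2 hu).ae_eq eu
  have hw' : MemLp (Ω.indicator w) (ENNReal.ofReal p) :=
    (memLp_indicator_iff_restrict hΩ.measurableSet).2 hwp
  refine ⟨Ω.indicator w, SmoothApprox.exists_of_forall (Q := fun φ => IsTestFunction Ω φ)
    hp hu' hw' fun ε hε => ?_⟩
  obtain ⟨r, hr0, hrε⟩ : ∃ r : ℝ, 0 < r ∧ ENNReal.ofReal r ≤ ε := by
    rcases eq_or_ne ε ⊤ with rfl | hε'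
    · exact ⟨1, one_pos, le_top⟩
    · exact ⟨ε.toReal, ENNReal.toReal_pos hε.ne' hε', by rw [ENNReal.ofReal_toReal hε']⟩
  obtain ⟨φ, ht, hn⟩ := happ r hr0
  have hφ : MemLp φ (ENNReal.ofReal p) := ht.continuous.memLp_of_hasCompactSupport ht.2.1
  have hg : MemLp (gradient φ) (ENNReal.ofReal p) := by
    refine (contDiff_continuous_gradient ht.1).memLp_of_hasCompactSupport ?_
    exact (ht.2.1.fderiv ℝ).comp_left (g := (InnerProductSpace.toDual ℝ (RN N)).symm) (map_zero _)
  have hgr := weakGradient_ae_eq hΩ (hw.sub (isWeakGradient_gradient ht.1))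
  have i1 : ∫ x, ‖(gradient φ - Ω.indicator w) x‖ ^ p
      = ∫ x in Ω, ‖weakGradient Ω (u - φ) x‖ ^ p := by
    rw [← setIntegral_eq_integral_of_forall_compl_eq_zero (s := Ω)]
    · refine integral_congr_ae ?_
      filter_upwards [hgr, ae_restrict_mem hΩ.measurableSet] with x hx hxΩ
      rw [hx, ← norm_neg]; simp [hxΩ]
    · intro x hx
      have : gradient φ x = 0 := by
        simp [gradient, ht.fderiv_eq_zero_of_notMem hx]
      simp [hx, this, hp0.ne']
  have i2 : ∫ x, ‖(φ - u) x‖ ^ p = ∫ x in Ω, |(u - φ) x| ^ p := by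
    rw [← setIntegral_eq_integral_of_ae_compl_eq_zero (s := Ω)]
    · refine integral_congr_ae (ae_of_all _ fun x => ?_)
      simp [abs_sub_comm]
    · filter_upwards [h0] with x hx hxΩ
      simp [hx hxΩ, ht.eq_zero_of_notMem hxΩ, hp0.ne']
  have n1 : 0 ≤ ∫ x in Ω, ‖weakGradient Ω (u - φ) x‖ ^ p :=
    integral_nonneg fun x => by positivity
  have n2 : 0 ≤ ∫ x in Ω, |(u - φ) x| ^ p := integral_nonneg fun x => by positivity
  refine ⟨φ, ht, ht.1, ?_, ?_⟩
  · rw [eLpNorm_eq_ofReal_integral hp0 (hφ.sub hu'), i2]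
    refine (ENNReal.ofReal_le_ofReal (le_trans ?_ hn.le)).trans hrε
    exact Real.rpow_le_rpow n2 (by linarith) (by positivity)
  · rw [eLpNorm_eq_ofReal_integral hp0 (hg.sub hw'), i1]
    refine (ENNReal.ofReal_le_ofReal (le_trans ?_ hn.le)).trans hrε
    exact Real.rpow_le_rpow n1 (by linarith) (by positivity)

end SmoothApproximation

/-! ### Weak convergence and Rellich's theorem. -/

section Compactness

variable {N : ℕ} {p : ℝ}

/-- Hölder's inequality combined with Cauchy–Schwarz, in real form. -/
theorem memLp_one_inner {α G : Type*} [MeasurableSpace α] {ν : Measure α} [NormedAddCommGroup G]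
    [InnerProductSpace ℝ G] {P Q : ENNReal} [ENNReal.HolderConjugate Q P] {f g : α → G}
    (hf : MemLp f Q ν) (hg : MemLp g P ν) :
    Integrable (fun x => (inner ℝ (f x) (g x) : ℝ)) ν ∧
      |∫ x, (inner ℝ (f x) (g x) : ℝ) ∂ν| ≤ (eLpNorm f Q ν).toReal * (eLpNorm g P ν).toReal := by
  have h := eLpNorm_le_eLpNorm_mul_eLpNorm_of_nnnorm (p := Q) (q := P) (r := 1) hf.1 hg.1
    (fun a b => (inner ℝ a b : ℝ)) 1 (ae_of_all _ fun x => by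
      simpa using nnnorm_inner_le_nnnorm (𝕜 := ℝ) (f x) (g x))
  rw [ENNReal.coe_one, one_mul] at h
  have hfin : eLpNorm f Q ν * eLpNorm g P ν ≠ ⊤ := ENNReal.mul_ne_top hf.2.ne hg.2.ne
  have hi : Integrable (fun x => (inner ℝ (f x) (g x) : ℝ)) ν :=
    memLp_one_iff_integrable.1 ⟨hf.1.inner hg.1, h.trans_lt hfin.lt_top⟩
  refine ⟨hi, ?_⟩
  rw [← ENNReal.toReal_mul]
  have h2 := enorm_integral_le_lintegral_enorm (μ := ν) fun x => (inner ℝ (f x) (g x) : ℝ)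
  rw [← eLpNorm_one_eq_lintegral_enorm] at h2
  have h3 := ENNReal.toReal_mono hfin (h2.trans h)
  simpa using h3

theorem MemWV.exists_grad {V u : RN N → ℝ} (h : MemWV univ V p u) :
    MemLp u (ENNReal.ofReal p) ∧ IsWeakGradient univ u (weakGradient univ u) ∧
      MemLp (weakGradient univ u) (ENNReal.ofReal p) := by
  obtain ⟨⟨h1, w, hw, hwp⟩, -⟩ := h
  simp only [Measure.restrict_univ] at h1 hwp
  exact ⟨h1, weakGradient_spec hw, hwp.ae_eq (weakGradient_univ_ae_eq hw).symm⟩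

theorem MemWV.integrable {V u : RN N → ℝ} (h : MemWV univ V p u) :
    Integrable fun x => V x * |u x| ^ p := integrableOn_univ.1 h.2

/-- Each of the two summands of the weighted norm is nonnegative, and V ≥ c compares the second with
the plain L^p norm. -/
theorem norm_le_normV (hp : 1 ≤ p) {V : RN N → ℝ} {c : ℝ} (hc : 0 < c) (hV : ∀ᵐ x, c ≤ V x)
    {u : RN N → ℝ} (h : MemWV univ V p u) :
    (eLpNorm (weakGradient univ u) (ENNReal.ofReal p)).toReal ≤ normV univ V p u ∧
      (eLpNorm u (ENNReal.ofReal p)).toReal ≤ (1 / c) ^ (1 / p) * normV univ V p u := by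
  have hp0 : 0 < p := by linarith
  obtain ⟨h1, h2, h3⟩ := h.exists_grad
  have n1 : 0 ≤ ∫ x, ‖weakGradient univ u x‖ ^ p := integral_nonneg fun x => by positivity
  have n2 : 0 ≤ ∫ x, ‖u x‖ ^ p := integral_nonneg fun x => by positivity
  have hcV : c * ∫ x, ‖u x‖ ^ p ≤ ∫ x, V x * |u x| ^ p := by
    rw [← integral_const_mul]
    refine integral_mono_ae ((MemLp.integrable_rpow hp0 h1).const_mul c) h.integrable ?_
    filter_upwards [hV] with x hx
    exact mul_le_mul_of_nonneg_right hx (by positivity)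
  have n3 : 0 ≤ ∫ x, V x * |u x| ^ p := le_trans (by positivity) hcV
  rw [normV, setIntegral_univ, setIntegral_univ, eLpNorm_eq_ofReal_integral hp0 h1,
    eLpNorm_eq_ofReal_integral hp0 h3, ENNReal.toReal_ofReal (by positivity),
    ENNReal.toReal_ofReal (by positivity)]
  constructor
  · exact Real.rpow_le_rpow n1 (by linarith) (by positivity)
  · rw [← Real.mul_rpow (by positivity) (by positivity)]
    refine Real.rpow_le_rpow n2 ?_ (by positivity)
    rw [one_div, inv_mul_eq_div, le_div_iff₀ hc]
    linarith

/-- Supplies the functionals through which weak convergence in W_V^{1,p} yields weak L^p convergence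
of gradients. -/
theorem isDualWV_integral_inner_grad (hp : 1 ≤ p) {V : RN N → ℝ} {c : ℝ} (hc : 0 < c)
    (hV : ∀ᵐ x, c ≤ V x) {Q : ENNReal} [ENNReal.HolderConjugate Q (ENNReal.ofReal p)]
    {f : RN N → RN N} (hf : MemLp f Q) :
    IsDualWV univ V p fun v => ∫ x, (inner ℝ (f x) (weakGradient univ v x) : ℝ) := by
  refine ⟨fun v w hv hw a b => ?_, (eLpNorm f Q).toReal, fun w hw => ?_⟩
  · obtain ⟨-, hv2, hv3⟩ := hv.exists_grad
    obtain ⟨-, hw2, hw3⟩ := hw.exists_grad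
    have e := weakGradient_univ_ae_eq (hv2.linear hw2 a b)
    rw [← integral_const_mul, ← integral_const_mul,
      ← integral_add ((memLp_one_inner hf hv3).1.const_mul a)
        ((memLp_one_inner hf hw3).1.const_mul b)]
    refine integral_congr_ae ?_
    filter_upwards [e] with x hx
    rw [hx]
    simp [inner_add_right, inner_smul_right]
  · obtain ⟨-, -, hw3⟩ := hw.exists_grad
    refine (memLp_one_inner hf hw3).2.trans ?_
    gcongr
    exact (norm_le_normV hp hc hV hw).1

/-- The analogue for the functions themselves; it is applied to mollifier kernels to get pointwise
convergence of mollifications. -/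
theorem isDualWV_integral_mul (hp : 1 ≤ p) {V : RN N → ℝ} {c : ℝ} (hc : 0 < c)
    (hV : ∀ᵐ x, c ≤ V x) {Q : ENNReal} [ENNReal.HolderConjugate Q (ENNReal.ofReal p)]
    {f : RN N → ℝ} (hf : MemLp f Q) :
    IsDualWV univ V p fun v => ∫ x, (inner ℝ (f x) (v x) : ℝ) := by
  refine ⟨fun v w hv hw a b => ?_, (eLpNorm f Q).toReal * (1 / c) ^ (1 / p), fun w hw => ?_⟩
  · obtain ⟨hv1, -, -⟩ := hv.exists_grad
    obtain ⟨hw1, -, -⟩ := hw.exists_grad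
    rw [← integral_const_mul, ← integral_const_mul,
      ← integral_add ((memLp_one_inner hf hv1).1.const_mul a)
        ((memLp_one_inner hf hw1).1.const_mul b)]
    refine integral_congr_ae (ae_of_all _ fun x => ?_)
    simp
    ring
  · obtain ⟨hw1, -, -⟩ := hw.exists_grad
    refine (memLp_one_inner hf hw1).2.trans ?_
    rw [mul_assoc]
    gcongr
    exact (norm_le_normV hp hc hV hw).2

theorem mollify_eq_integral_inner (ρ : RN N → ℝ) (f : RN N → ℝ) (x : RN N) :
    mollify ρ f x = ∫ y, (inner ℝ (ρ (x - y)) (f y) : ℝ) := by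
  simp only [mollify, smul_eq_mul]
  refine integral_congr_ae (ae_of_all _ fun y => ?_)
  simp [mul_comm]

theorem memLp_bump_sub (ρ : ContDiffBump (0 : RN N)) (x : RN N) (Q : ENNReal) :
    MemLp (fun y => ρ.normed volume (x - y)) Q :=
  (isTestFunction_bump_sub ρ x).continuous.memLp_of_hasCompactSupport (isTestFunction_bump_sub ρ x).2.1

/-- The density (1 + |x|)^{-(N+1)} is integrable, positive and at most 1. Such a measure has the
same null sets as Lebesgue measure but allows constants as dominating functions, which avoids
exhausting ℝ^N by balls. -/
theorem exists_finiteMeasure_le_volume (N : ℕ) : ∃ ν : Measure (RN N),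
    IsFiniteMeasure ν ∧ ν ≤ volume ∧ volume ≪ ν := by
  have hint : Integrable (fun x : RN N => (1 + ‖x‖) ^ (-((N : ℝ) + 1))) :=
    integrable_one_add_norm (by simp)
  have hm : Measurable fun x : RN N => ENNReal.ofReal ((1 + ‖x‖) ^ (-((N : ℝ) + 1))) := by fun_prop
  refine ⟨volume.withDensity fun x => ENNReal.ofReal ((1 + ‖x‖) ^ (-((N : ℝ) + 1))),
    isFiniteMeasure_withDensity_ofReal hint.2, ?_, ?_⟩
  · conv_rhs => rw [← withDensity_one (μ := (volume : Measure (RN N)))]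
    refine withDensity_mono (ae_of_all _ fun x => ?_)
    simp only [Pi.one_apply]
    refine ENNReal.ofReal_le_one.2 ?_
    exact Real.rpow_le_one_of_one_le_of_nonpos (by linarith [norm_nonneg x])
      (by have : (0 : ℝ) ≤ N := N.cast_nonneg
          linarith)
  · refine withDensity_absolutelyContinuous' hm.aemeasurable (ae_of_all _ fun x => ?_)
    have : 0 < (1 + ‖x‖) ^ (-((N : ℝ) + 1)) := by positivity
    simpa using this

/-- Rellich's theorem: a bounded weakly convergent sequence has an almost everywhere convergent
subsequence. -/
theorem WeaklyConvergesWV.exists_subseq_tendsto_ae (hp : 1 < p) {V : RN N → ℝ} {c : ℝ}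
    (hc : 0 < c) (hV : ∀ᵐ x, c ≤ V x) {u : ℕ → RN N → ℝ} {u₀ : RN N → ℝ}
    (h : WeaklyConvergesWV univ V p u u₀) {K : ENNReal} (hK : K ≠ ⊤)
    (hKu : ∀ n, eLpNorm (u n) (ENNReal.ofReal p) ≤ K)
    (hKw : ∀ n, eLpNorm (weakGradient univ (u n)) (ENNReal.ofReal p) ≤ K) :
    ∃ ns : ℕ → ℕ, StrictMono ns ∧ ∀ᵐ x, Tendsto (fun n => u (ns n) x) atTop (𝓝 (u₀ x)) := by
  obtain ⟨hu, hu₀, hlim⟩ := h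
  have hp0 : 0 < p := by linarith
  have hP : 1 ≤ ENNReal.ofReal p := by simpa using hp.le
  have hPQ : (ENNReal.ofReal p).HolderConjugate (ENNReal.conjExponent (ENNReal.ofReal p)) :=
    .conjExponent hP
  have hQP : (ENNReal.conjExponent (ENNReal.ofReal p)).HolderConjugate (ENNReal.ofReal p) :=
    hPQ.symm
  obtain ⟨h01, h02, h03⟩ := hu₀.exists_grad
  obtain ⟨ν, hν, hνle, hνac⟩ := exists_finiteMeasure_le_volume N
  set K' : ENNReal := K + (eLpNorm u₀ (ENNReal.ofReal p) +
    eLpNorm (weakGradient univ u₀) (ENNReal.ofReal p)) with hK'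
  have hK't : K' ≠ ⊤ := by
    have := h01.2.ne; have := h03.2.ne
    simp only [hK']; finiteness
  have hz1 : ∀ n, MemLp (u n - u₀) (ENNReal.ofReal p) := fun n => (hu n).exists_grad.1.sub h01
  have hz2 : ∀ n, MemLp (weakGradient univ (u n) - weakGradient univ u₀) (ENNReal.ofReal p) :=
    fun n => (hu n).exists_grad.2.2.sub h03
  have hz3 : ∀ n, IsWeakGradient univ (u n - u₀) (weakGradient univ (u n) - weakGradient univ u₀) :=
    fun n => (hu n).exists_grad.2.1.sub h02
  have hb1 : ∀ n, eLpNorm (u n - u₀) (ENNReal.ofReal p) ≤ K' := fun n =>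
    (eLpNorm_sub_le (hu n).exists_grad.1.1 h01.1 hP).trans
      (add_le_add (hKu n) le_self_add)
  have hb2 : ∀ n, eLpNorm (weakGradient univ (u n) - weakGradient univ u₀) (ENNReal.ofReal p) ≤ K' :=
    fun n => (eLpNorm_sub_le (hu n).exists_grad.2.2.1 h03.1 hP).trans
      (add_le_add (hKw n) le_add_self)
  have hconv : Tendsto (fun n => eLpNorm (u n - u₀) (ENNReal.ofReal p) ν) atTop (𝓝 0) := by
    rw [ENNReal.tendsto_nhds_zero]
    intro ε hε
    -- Mollifying at scale δ moves every u_n - u₀ by at most δ K' in L^p, hence by at most ε/2,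
    -- uniformly in n.
    obtain ⟨δ, hδ, hδε⟩ : ∃ δ : ℝ, 0 < δ ∧ ENNReal.ofReal δ * K' ≤ ε / 2 := by
      have ht : Tendsto (fun δ : ℝ => ENNReal.ofReal δ * K') (𝓝[>] 0) (𝓝 0) := by
        have := ENNReal.Tendsto.mul_const
          (ENNReal.tendsto_ofReal (tendsto_id (α := ℝ) (x := 𝓝 0))) (Or.inr hK't)
        simp only [id, ENNReal.ofReal_zero, zero_mul] at this
        exact this.mono_left nhdsWithin_le_nhds
      have h2 := (ht.eventually (gt_mem_nhds (ENNReal.half_pos hε.ne'))).and self_mem_nhdsWithin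
      obtain ⟨δ, h3, h4⟩ := h2.exists
      exact ⟨δ, h4, h3.le⟩
    let ρ := bumpOfRadius N δ hδ
    -- At fixed x, mollification is the pairing with one fixed kernel, so weak convergence applies.
    have hpt : ∀ x, Tendsto (fun n => mollify (ρ.normed volume) (u n - u₀) x) atTop (𝓝 0) := by
      intro x
      have := hlim _ (isDualWV_integral_mul hp.le hc hV
        (memLp_bump_sub ρ x (ENNReal.conjExponent (ENNReal.ofReal p))))
      rw [← tendsto_sub_nhds_zero_iff] at this
      refine this.congr fun n => ?_
      rw [mollify_eq_integral_inner, ← integral_sub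
        (memLp_one_inner (memLp_bump_sub ρ x (ENNReal.conjExponent (ENNReal.ofReal p)))
          (hu n).exists_grad.1).1
        (memLp_one_inner (memLp_bump_sub ρ x (ENNReal.conjExponent (ENNReal.ofReal p))) h01).1]
      refine integral_congr_ae (ae_of_all _ fun y => ?_)
      simp only [Pi.sub_apply, inner_sub_right]
    -- Hölder bounds the mollifications by a constant independent of n and x, which is in L^p(ν)
    -- because ν is finite.
    have hbd : ∀ n x, ‖mollify (ρ.normed volume) (u n - u₀) x‖
        ≤ (eLpNorm (ρ.normed volume) (ENNReal.conjExponent (ENNReal.ofReal p))).toReal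
          * K'.toReal * ‖(1 : ℝ)‖ := by
      intro n x
      rw [mollify_eq_integral_inner, norm_one, mul_one]
      refine (memLp_one_inner (memLp_bump_sub ρ x (ENNReal.conjExponent (ENNReal.ofReal p)))
        (hz1 n)).2.trans ?_
      have e := eLpNorm_comp_measurePreserving (p := ENNReal.conjExponent (ENNReal.ofReal p))
        (ρ.continuous_normed (μ := volume)).aestronglyMeasurable
        (Measure.measurePreserving_sub_left volume x)
      simp only [Function.comp_def] at e
      rw [e]
      gcongr
      exact hb1 n
    have hmc : ∀ n, Continuous (mollify (ρ.normed volume) (u n - u₀)) := fun n =>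
      (contDiff_mollify ((hz1 n).locallyIntegrable hP) ρ).continuous
    have hdc := tendsto_eLpNorm_zero_of_dominated (ν := ν) hp0
      (fun n => (hmc n).aestronglyMeasurable) (memLp_const (1 : ℝ))
      (fun n => ae_of_all _ (hbd n)) (ae_of_all _ hpt)
    have hev := (ENNReal.tendsto_nhds_zero.1 hdc) (ε / 2) (ENNReal.half_pos hε.ne')
    filter_upwards [hev] with n hn
    have m1 : AEStronglyMeasurable (u n - u₀) ν := (hz1 n).1.mono_ac hνle.absolutelyContinuous
    have m2 : AEStronglyMeasurable (mollify (ρ.normed volume) (u n - u₀)) ν :=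
      (hmc n).aestronglyMeasurable
    have e : u n - u₀ = mollify (ρ.normed volume) (u n - u₀)
        - (mollify (ρ.normed volume) (u n - u₀) - (u n - u₀)) := by simp
    calc eLpNorm (u n - u₀) (ENNReal.ofReal p) ν
        ≤ eLpNorm (mollify (ρ.normed volume) (u n - u₀)) (ENNReal.ofReal p) ν
          + eLpNorm (mollify (ρ.normed volume) (u n - u₀) - (u n - u₀)) (ENNReal.ofReal p) ν := by
          conv_lhs => rw [e]
          exact eLpNorm_sub_le m2 (m2.sub m1) hP
      _ ≤ ε / 2 + ε / 2 := by
          refine add_le_add hn ?_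
          refine (eLpNorm_mono_measure _ hνle).trans ?_
          refine ((hz3 n).eLpNorm_mollify_sub_le hp.le (hz1 n) (hz2 n) ρ).trans (le_trans ?_ hδε)
          gcongr
          · exact le_rfl
          · exact hb2 n
      _ = ε := ENNReal.add_halves ε
  obtain ⟨ns, hns, hae⟩ := (tendstoInMeasure_of_tendsto_eLpNorm (by simpa using hp0)
    (fun n => (hu n).exists_grad.1.1.mono_ac hνle.absolutelyContinuous)
    (h01.1.mono_ac hνle.absolutelyContinuous) hconv).exists_seq_tendsto_ae
  exact ⟨ns, hns, hνac hae⟩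

end Compactness

/-! ### Measurability of Carathéodory compositions. -/

section Caratheodory

variable {N : ℕ}

/-- The exceptional null set of h(·, t) depends on t. Using rational t only gives a single null set,
off which continuity in t determines the rest; setting h to zero on it yields a jointly measurable
version. -/
theorem exists_measurable_uncurry_of_caratheodory {h : RN N → ℝ → ℝ}
    (hm : ∀ t : ℝ, AEMeasurable (fun x => h x t) volume) (hc : ∀ᵐ x : RN N, Continuous (h x)) :
    ∃ k : RN N → ℝ → ℝ, Measurable (Function.uncurry fun t x => k x t) ∧ ∀ᵐ x : RN N, h x = k x := by
  classical
  have hq : ∀ᵐ x : RN N, ∀ q : ℚ, h x q = (hm q).mk _ x := ae_all_iff.2 fun q => (hm q).ae_eq_mk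
  set S : Set (RN N) := {x | ¬ ((∀ q : ℚ, h x q = (hm q).mk _ x) ∧ Continuous (h x))}
  have hS : volume S = 0 := by
    have : ∀ᵐ x : RN N, (∀ q : ℚ, h x q = (hm q).mk _ x) ∧ Continuous (h x) := hq.and hc
    exact this
  -- S need not be measurable, so a measurable null hull is removed instead.
  set T := (toMeasurable volume S)ᶜ
  have hT : MeasurableSet T := (measurableSet_toMeasurable _ _).compl
  have hTg : ∀ x ∈ T, (∀ q : ℚ, h x q = (hm q).mk _ x) ∧ Continuous (h x) := by
    intro x hx
    by_contra hcon
    exact hx (subset_toMeasurable _ _ hcon)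
  have hTae : ∀ᵐ x : RN N, x ∈ T := by
    have : volume (toMeasurable volume S) = 0 := by rw [measure_toMeasurable, hS]
    exact measure_eq_zero_iff_ae_notMem.1 this
  let k : RN N → ℝ → ℝ := fun x t => if x ∈ T then h x t else 0
  have hkc : ∀ x, Continuous fun t => k x t := by
    intro x
    by_cases hx : x ∈ T
    · simpa [k, hx] using (hTg x hx).2
    · simpa [k, hx] using continuous_const
  have hkq : ∀ q : ℚ, Measurable fun x => k x q := by
    intro q
    have : (fun x => k x q) = T.indicator ((hm q).mk _) := by
      ext x
      by_cases hx : x ∈ T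
      · simp [k, hx, (hTg x hx).1 q]
      · simp [k, hx]
    rw [this]
    exact (hm q).measurable_mk.indicator hT
  have hkt : ∀ t : ℝ, Measurable fun x => k x t := by
    intro t
    obtain ⟨s, hs⟩ : ∃ s : ℕ → ℚ, Tendsto (fun n => (s n : ℝ)) atTop (𝓝 t) := by
      obtain ⟨s, hs, hs'⟩ := mem_closure_iff_seq_limit.1 (Rat.denseRange_cast (𝕜 := ℝ) t)
      choose r hr using hs
      exact ⟨r, by simpa [hr] using hs'⟩
    refine measurable_of_tendsto_metrizable (fun n => hkq (s n)) (tendsto_pi_nhds.2 fun x => ?_)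
    exact ((hkc x).tendsto t).comp hs
  refine ⟨k, measurable_uncurry_of_continuous_of_measurable (u := fun t x => k x t) hkc hkt, ?_⟩
  filter_upwards [hTae] with x hx
  ext t
  simp [k, hx]

theorem aemeasurable_comp_of_caratheodory {h : RN N → ℝ → ℝ}
    (hm : ∀ t : ℝ, AEMeasurable (fun x => h x t) volume) (hc : ∀ᵐ x : RN N, Continuous (h x))
    {u : RN N → ℝ} (hu : AEMeasurable u volume) : AEMeasurable (fun x => h x (u x)) volume := by
  obtain ⟨k, hk, he⟩ := exists_measurable_uncurry_of_caratheodory hm hc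
  have : AEMeasurable (fun x => Function.uncurry (fun t x => k x t) (u x, x)) volume :=
    hk.comp_aemeasurable (hu.prodMk aemeasurable_id)
  refine this.congr ?_
  filter_upwards [he] with x hx
  simp [hx]

theorem IsCaratheodory.continuous_ae {k : ℕ} {h : RN N → ℝ → ℝ} (hh : IsCaratheodory k h) :
    ∀ᵐ x : RN N, Continuous (h x) := hh.2.mono fun _ hx => hx.continuous

theorem IsCaratheodory.aemeasurable_comp {k : ℕ} {h : RN N → ℝ → ℝ} (hh : IsCaratheodory k h)
    {u : RN N → ℝ} (hu : AEMeasurable u volume) : AEMeasurable (fun x => h x (u x)) volume :=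
  aemeasurable_comp_of_caratheodory hh.1 hh.continuous_ae hu

theorem IsCaratheodory.continuous_deriv_ae {h : RN N → ℝ → ℝ} (hh : IsCaratheodory 1 h) :
    ∀ᵐ x : RN N, Continuous (deriv (h x)) :=
  hh.2.mono fun _ hx => hx.continuous_deriv (by simp)

/-- A_t is itself a Carathéodory function, its slices being limits of difference quotients with step
1/(n+1). -/
theorem IsCaratheodory.aemeasurable_deriv_comp {h : RN N → ℝ → ℝ} (hh : IsCaratheodory 1 h)
    {u : RN N → ℝ} (hu : AEMeasurable u volume) :
    AEMeasurable (fun x => deriv (h x) (u x)) volume := by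
  refine aemeasurable_comp_of_caratheodory (h := fun x => deriv (h x)) (fun t => ?_)
    hh.continuous_deriv_ae hu
  refine aemeasurable_of_tendsto_metrizable_ae atTop
    (f := fun (n : ℕ) x => ((1 : ℝ) / (n + 1))⁻¹ • (h x (t + 1 / (n + 1)) - h x t)) (fun n => ?_) ?_
  · simp only [smul_eq_mul]
    exact ((hh.1 _).sub (hh.1 t)).const_mul _
  · filter_upwards [hh.2] with x hx
    have hd : HasDerivAt (h x) (deriv (h x) t) t :=
      (hx.differentiable (by simp) t).hasDerivAt
    have hz : Tendsto (fun n : ℕ => (1 : ℝ) / (n + 1)) atTop (𝓝[≠] 0) := by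
      refine tendsto_nhdsWithin_iff.2 ⟨tendsto_one_div_add_atTop_nhds_zero_nat,
        Eventually.of_forall fun n => ?_⟩
      have : (0 : ℝ) < 1 / (n + 1) := by positivity
      exact this.ne'
    exact hd.tendsto_slope_zero.comp hz

end Caratheodory

/-! ### The field |a|^{p-2}a and its monotonicity. -/

section PLaplace

variable {E : Type*} [NormedAddCommGroup E] [InnerProductSpace ℝ E] {p : ℝ}

/-- The vector field `a ↦ |a|^{p-2} a`. -/
noncomputable def pField (p : ℝ) (a : E) : E := ‖a‖ ^ (p - 2) • a

/-- At s = 0 both sides vanish whatever value 0^{p-2} takes, so no case p < 2 has to be separated.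
-/
theorem rpow_sub_two_mul_self (hp : 1 < p) {s : ℝ} (hs : 0 ≤ s) : s ^ (p - 2) * s = s ^ (p - 1) := by
  rcases hs.eq_or_lt with rfl | h
  · rw [mul_zero, Real.zero_rpow (by linarith)]
  · rw [← Real.rpow_add_one h.ne']; ring_nf

theorem rpow_sub_one_mul_self (hp : 1 < p) {s : ℝ} (hs : 0 ≤ s) : s ^ (p - 1) * s = s ^ p := by
  rcases hs.eq_or_lt with rfl | h
  · rw [mul_zero, Real.zero_rpow (by linarith)]
  · rw [← Real.rpow_add_one h.ne']; ring_nf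

theorem norm_pField (hp : 1 < p) (a : E) : ‖pField p a‖ = ‖a‖ ^ (p - 1) := by
  rw [pField, norm_smul, Real.norm_of_nonneg (by positivity), rpow_sub_two_mul_self hp (norm_nonneg _)]

theorem inner_pField_self (hp : 1 < p) (a : E) : (inner ℝ (pField p a) a : ℝ) = ‖a‖ ^ p := by
  rw [pField, inner_smul_left, real_inner_self_eq_norm_sq, ← rpow_sub_one_mul_self hp (norm_nonneg _),
    ← rpow_sub_two_mul_self hp (norm_nonneg _)]
  simp; ring

/-- Away from 0 the power is continuous; at 0 the norm of the field is |a|^{p-1}, which tends to 0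
as p > 1. -/
theorem continuous_pField (hp : 1 < p) : Continuous (pField p : E → E) := by
  refine continuous_iff_continuousAt.2 fun a => ?_
  rcases eq_or_ne a 0 with rfl | h
  · have h0 : pField p (0 : E) = 0 := by simp [pField]
    rw [ContinuousAt, h0, tendsto_zero_iff_norm_tendsto_zero]
    simp only [norm_pField hp]
    have := (continuous_norm (E := E)).tendsto 0
    rw [norm_zero] at this
    exact (tendsto_rpow_zero_iff (by linarith) fun a => norm_nonneg a).2 this
  · exact (continuousAt_id.norm.rpow_const (Or.inl (norm_ne_zero_iff.2 h))).smul continuousAt_id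

/-- The monotonicity gap of the vector field `a ↦ |a|^{p-2} a`. -/
noncomputable def pGap (p : ℝ) (a b : E) : ℝ := inner ℝ (pField p a - pField p b) (a - b)

/-- Separates a radial part from an angular part, the Cauchy–Schwarz defect. Both are nonnegative,
and their simultaneous vanishing forces equal norms and then a = b. -/
theorem pGap_eq (hp : 1 < p) (a b : E) :
    pGap p a b = (‖a‖ ^ (p - 1) - ‖b‖ ^ (p - 1)) * (‖a‖ - ‖b‖)
      + (‖a‖ ^ (p - 2) + ‖b‖ ^ (p - 2)) * (‖a‖ * ‖b‖ - inner ℝ a b) := by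
  rw [pGap, inner_sub_left, inner_sub_right, inner_sub_right, inner_pField_self hp,
    inner_pField_self hp, pField, pField, inner_smul_left, inner_smul_left,
    ← rpow_sub_one_mul_self hp (norm_nonneg a), ← rpow_sub_one_mul_self hp (norm_nonneg b),
    ← rpow_sub_two_mul_self hp (norm_nonneg a), ← rpow_sub_two_mul_self hp (norm_nonneg b),
    real_inner_comm b a]
  simp only [conj_trivial]
  ring

theorem rpow_gap_nonneg (hp : 1 < p) {s t : ℝ} (hs : 0 ≤ s) (ht : 0 ≤ t) :
    0 ≤ (s ^ (p - 1) - t ^ (p - 1)) * (s - t) := by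
  rcases le_total s t with h | h
  · exact mul_nonneg_of_nonpos_of_nonpos
      (sub_nonpos.2 (Real.rpow_le_rpow hs h (by linarith))) (sub_nonpos.2 h)
  · exact mul_nonneg (sub_nonneg.2 (Real.rpow_le_rpow ht h (by linarith))) (sub_nonneg.2 h)

theorem pGap_nonneg (hp : 1 < p) (a b : E) : 0 ≤ pGap p a b := by
  rw [pGap_eq hp]
  have := rpow_gap_nonneg hp (norm_nonneg a) (norm_nonneg b)
  have h2 := real_inner_le_norm a b
  have h3 : 0 ≤ (‖a‖ ^ (p - 2) + ‖b‖ ^ (p - 2)) * (‖a‖ * ‖b‖ - inner ℝ a b) :=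
    mul_nonneg (by positivity) (by linarith)
  linarith

theorem eq_of_pGap_eq_zero (hp : 1 < p) {a b : E} (h : pGap p a b = 0) : a = b := by
  rw [pGap_eq hp] at h
  have h1 := rpow_gap_nonneg hp (norm_nonneg a) (norm_nonneg b)
  have h2 := real_inner_le_norm a b
  have h3 : 0 ≤ (‖a‖ ^ (p - 2) + ‖b‖ ^ (p - 2)) * (‖a‖ * ‖b‖ - inner ℝ a b) :=
    mul_nonneg (by positivity) (by linarith)
  have h4 : (‖a‖ ^ (p - 1) - ‖b‖ ^ (p - 1)) * (‖a‖ - ‖b‖) = 0 := by linarith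
  have h5 : (‖a‖ ^ (p - 2) + ‖b‖ ^ (p - 2)) * (‖a‖ * ‖b‖ - inner ℝ a b) = 0 := by linarith
  have hn : ‖a‖ = ‖b‖ := by
    rcases mul_eq_zero.1 h4 with h6 | h6
    · exact (Real.rpow_left_inj (norm_nonneg _) (norm_nonneg _) (by linarith)).1 (sub_eq_zero.1 h6)
    · exact sub_eq_zero.1 h6
  rcases (norm_nonneg a).eq_or_lt with h0 | h0
  · have ha : a = 0 := norm_eq_zero.1 h0.symm
    have hb : b = 0 := norm_eq_zero.1 (hn.symm.trans h0.symm)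
    rw [ha, hb]
  · have hpos : 0 < ‖a‖ ^ (p - 2) + ‖b‖ ^ (p - 2) := by positivity
    have h7 := (mul_eq_zero.1 h5).resolve_left hpos.ne'
    have h8 : ‖a - b‖ ^ 2 = 0 := by
      rw [norm_sub_sq_real, ← hn]
      rw [← hn] at h7
      linarith [sq ‖a‖]
    exact sub_eq_zero.1 (norm_eq_zero.1 (pow_eq_zero_iff two_ne_zero |>.1 h8))

theorem pField_smul {r : ℝ} (hr : 0 < r) (a : E) : pField p (r • a) = r ^ (p - 1) • pField p a := by
  rw [pField, pField, norm_smul, Real.norm_of_nonneg hr.le,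
    Real.mul_rpow hr.le (norm_nonneg _), smul_smul, smul_smul]
  congr 1
  have : r ^ (p - 1) = r ^ (p - 2) * r := by
    rw [← Real.rpow_add_one hr.ne']; ring_nf
  rw [this]; ring

theorem pGap_smul {r : ℝ} (hr : 0 < r) (a b : E) :
    pGap p (r • a) (r • b) = r ^ p * pGap p a b := by
  rw [pGap, pGap, pField_smul hr, pField_smul hr, ← smul_sub, ← smul_sub, inner_smul_left,
    inner_smul_right]
  have : r ^ p = r ^ (p - 1) * r := by
    rw [← Real.rpow_add_one hr.ne']; ring_nf
  rw [this]; simp; ring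

/-- Quantitative strict monotonicity of `a ↦ |a|^{p-2} a`, uniformly in `p > 1`. -/
theorem exists_norm_sub_rpow_le [FiniteDimensional ℝ E] (hp : 1 < p) {ε : ℝ} (hε : 0 < ε) :
    ∃ C : ℝ, 0 ≤ C ∧ ∀ a b : E, ‖a - b‖ ^ p ≤ ε * (‖a‖ ^ p + ‖b‖ ^ p) + C * pGap p a b := by
  have hp0 : 0 < p := by linarith
  have : ProperSpace E := FiniteDimensional.proper ℝ E
  -- On this compact set of normalised pairs at distance bounded below, the continuous gap has a
  -- positive minimum. Homogeneity of degree p then covers all pairs, singular (p < 2) and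
  -- degenerate (p > 2) cases alike.
  set S : Set (E × E) := {z | ‖z.1‖ ^ p + ‖z.2‖ ^ p = 1 ∧ ε ≤ ‖z.1 - z.2‖ ^ p}
  have cn : ∀ {f : E × E → E}, Continuous f → Continuous fun z => ‖f z‖ ^ p := fun hf =>
    hf.norm.rpow_const fun _ => Or.inr hp0.le
  have hb : ∀ z : E × E, ‖z.1‖ ^ p + ‖z.2‖ ^ p = 1 → ‖z.1‖ ≤ 1 ∧ ‖z.2‖ ≤ 1 := by
    intro z hz
    have h1 : 0 ≤ ‖z.1‖ ^ p := by positivity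
    have h2 : 0 ≤ ‖z.2‖ ^ p := by positivity
    constructor
    · by_contra! hcon
      have := Real.one_lt_rpow hcon hp0
      linarith
    · by_contra! hcon
      have := Real.one_lt_rpow hcon hp0
      linarith
  have hS : IsCompact S := by
    refine Metric.isCompact_of_isClosed_isBounded ?_ ?_
    · exact (isClosed_eq ((cn continuous_fst).add (cn continuous_snd)) continuous_const).inter
        (isClosed_le continuous_const (cn (continuous_fst.sub continuous_snd)))
    · refine (Metric.isBounded_closedBall (x := (0 : E × E)) (r := 1)).subset fun z hz => ?_
      have := hb z hz.1
      simpa [Prod.norm_def] using this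
  have cg : Continuous fun z : E × E => pGap p z.1 z.2 := by
    have := continuous_pField (E := E) hp
    unfold pGap
    fun_prop
  obtain ⟨C, hC, hn⟩ : ∃ C : ℝ, 0 ≤ C ∧ ∀ a b : E, ‖a‖ ^ p + ‖b‖ ^ p = 1 →
      ‖a - b‖ ^ p ≤ ε + C * pGap p a b := by
    rcases S.eq_empty_or_nonempty with hem | hne
    · refine ⟨0, le_rfl, fun a b hab => ?_⟩
      by_contra! hcon
      have : ((a, b) : E × E) ∈ S := ⟨hab, by simpa using hcon.le⟩
      rw [hem] at this
      exact this
    · obtain ⟨z, hz, hmin⟩ := hS.exists_isMinOn hne cg.continuousOn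
      have hpos : 0 < pGap p z.1 z.2 := by
        refine lt_of_le_of_ne (pGap_nonneg hp _ _) fun h0 => ?_
        have := eq_of_pGap_eq_zero hp h0.symm
        have h2 := hz.2
        rw [this, sub_self, norm_zero, Real.zero_rpow hp0.ne'] at h2
        linarith
      -- Normalised vectors have norm at most 1, so |a - b|^p ≤ 2^p; dividing by the minimal gap
      -- gives the constant.
      refine ⟨2 ^ p / pGap p z.1 z.2, by positivity, fun a b hab => ?_⟩
      rcases lt_or_ge (‖a - b‖ ^ p) ε with h | h
      · have := pGap_nonneg hp a b
        have : 0 ≤ 2 ^ p / pGap p z.1 z.2 * pGap p a b := by positivity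
        linarith
      · have hab' : ((a, b) : E × E) ∈ S := ⟨hab, h⟩
        have h1 : pGap p z.1 z.2 ≤ pGap p a b := hmin hab'
        have h2 : ‖a - b‖ ^ p ≤ 2 ^ p := by
          refine Real.rpow_le_rpow (norm_nonneg _) ?_ hp0.le
          have := hb (a, b) hab
          simp only at this
          linarith [norm_sub_le a b]
        have h3 : 2 ^ p ≤ 2 ^ p / pGap p z.1 z.2 * pGap p a b := by
          rw [div_mul_eq_mul_div, le_div_iff₀ hpos]
          exact mul_le_mul_of_nonneg_left h1 (by positivity)
        linarith
  refine ⟨C, hC, fun a b => ?_⟩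
  have hs0 : 0 ≤ ‖a‖ ^ p + ‖b‖ ^ p := by positivity
  rcases hs0.eq_or_lt with hz | hs
  · have h1 : ‖a‖ ^ p = 0 := le_antisymm (by linarith [Real.rpow_nonneg (norm_nonneg b) p]) (by positivity)
    have h2 : ‖b‖ ^ p = 0 := by linarith
    have ha : a = 0 := by simpa [Real.rpow_eq_zero (norm_nonneg a) hp0.ne'] using h1
    have hb : b = 0 := by simpa [Real.rpow_eq_zero (norm_nonneg b) hp0.ne'] using h2
    subst ha hb
    simp [pGap, hp0.ne']
  · set s := ‖a‖ ^ p + ‖b‖ ^ p with hsdef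
    set r := s ^ (1 / p) with hr
    have hr0 : 0 < r := by positivity
    have hrp : r ^ p = s := by
      rw [hr, ← Real.rpow_mul hs.le, one_div, inv_mul_cancel₀ hp0.ne', Real.rpow_one]
    have hsm : ∀ c : E, ‖r⁻¹ • c‖ ^ p = s⁻¹ * ‖c‖ ^ p := by
      intro c
      rw [norm_smul, Real.norm_of_nonneg (by positivity), Real.mul_rpow (by positivity) (norm_nonneg _),
        Real.inv_rpow hr0.le, hrp]
    have key := hn (r⁻¹ • a) (r⁻¹ • b) (by
      rw [hsm, hsm, ← mul_add, ← hsdef, inv_mul_cancel₀ hs.ne'])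
    rw [← smul_sub, hsm, pGap_smul (by positivity), Real.inv_rpow hr0.le, hrp] at key
    have := mul_le_mul_of_nonneg_left key hs.le
    calc ‖a - b‖ ^ p = s * (s⁻¹ * ‖a - b‖ ^ p) := by field_simp
      _ ≤ s * (ε + C * (s⁻¹ * pGap p a b)) := this
      _ = ε * s + C * pGap p a b := by field_simp

end PLaplace

/-! ### The Sobolev inequality on W_0^{1,p} and the choice of exponents. -/

section Sobolev

variable {N : ℕ} {p : ℝ} {Ω : Set (RN N)}

/-- The Sobolev inequality on `W_0^{1,p}(Ω)`, for exponents `s ≤ p`; the constant does not depend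
on the bounded set `Ω`. -/
theorem exists_sobolev_const (hN : 2 ≤ N) {s r : ℝ} (hs : 1 ≤ s) (hr : 0 < r)
    (hsr : 1 / r = 1 / s - 1 / N) : ∃ S : ENNReal, S ≠ ⊤ ∧ ∀ (p : ℝ), s ≤ p →
      ∀ (Ω : Set (RN N)), volume Ω ≠ ⊤ → ∀ (u : RN N → ℝ) (w : RN N → RN N), InW0 Ω p u w →
        eLpNorm u (ENNReal.ofReal r) ≤ S * eLpNorm w (ENNReal.ofReal s) := by
  refine ⟨ENNReal.ofNNReal
    (SNormLESNormFDerivOfEqConst ℝ (volume : Measure (RN N)) (s.toNNReal : ℝ)), ENNReal.coe_ne_top, fun p hsp Ω hΩ u w h => ?_⟩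
  set S : ENNReal :=
    ENNReal.ofNNReal (SNormLESNormFDerivOfEqConst ℝ (volume : Measure (RN N)) (s.toNNReal : ℝ))
  obtain ⟨φ, ht, ha⟩ := h
  have hs1 : 1 ≤ ENNReal.ofReal s := by simpa using hs
  have hsob : ∀ n, eLpNorm (φ n) (ENNReal.ofReal r) ≤ S * eLpNorm (gradient (φ n)) (ENNReal.ofReal s) := by
    intro n
    have := eLpNorm_le_eLpNorm_fderiv_of_eq (μ := (volume : Measure (RN N)))
      ((ht n).1.of_le (by simp)) (ht n).2.1 (p := s.toNNReal) (p' := r.toNNReal)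
      (by simpa using hs) (by simp; lia) (by
        rw [Real.coe_toNNReal _ hr.le, NNReal.coe_inv, Real.coe_toNNReal _ (by linarith)]
        simpa using hsr)
    refine this.trans (le_of_eq ?_)
    congr 1
    exact (eLpNorm_congr_norm_ae (ae_of_all _ fun x => norm_gradient_eq _ _)).symm
  -- The factor of the embedding L^p ⊂ L^s on Ω. It multiplies only an error tending to 0, so the
  -- final constant does not involve Ω.
  set c : ENNReal := volume Ω ^ (1 / s - 1 / p)
  have hc : c ≠ ⊤ := ENNReal.rpow_ne_top_of_nonneg
    (sub_nonneg.2 (one_div_le_one_div_of_le (by linarith) hsp)) hΩ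
  have hg : ∀ n, eLpNorm (gradient (φ n)) (ENNReal.ofReal s)
      ≤ eLpNorm (gradient (φ n) - w) (ENNReal.ofReal p) * c + eLpNorm w (ENNReal.ofReal s) := by
    intro n
    have m1 : AEStronglyMeasurable (gradient (φ n)) (volume : Measure (RN N)) :=
      (contDiff_continuous_gradient (ht n).1).aestronglyMeasurable
    have m2 := (m1.sub ha.memLp_grad.1).restrict (s := Ω)
    have e1 : eLpNorm (gradient (φ n)) (ENNReal.ofReal s)
        = eLpNorm (gradient (φ n)) (ENNReal.ofReal s) (volume.restrict Ω) := by
      symm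
      refine eLpNorm_restrict_eq_of_support_subset fun x hx => ?_
      by_contra hxΩ
      exact hx (by simp [gradient, (ht n).fderiv_eq_zero_of_notMem hxΩ])
    have e2 : gradient (φ n) = (gradient (φ n) - w) + w := by simp
    rw [e1]
    conv_lhs => rw [e2]
    refine (eLpNorm_add_le m2 ha.memLp_grad.1.restrict hs1).trans (add_le_add ?_ ?_)
    · refine (eLpNorm_le_eLpNorm_mul_rpow_measure_univ (ENNReal.ofReal_le_ofReal hsp) m2).trans ?_
      rw [Measure.restrict_apply_univ, ENNReal.toReal_ofReal (by linarith),
        ENNReal.toReal_ofReal (by linarith)]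
      gcongr
      exact Measure.restrict_le_self
    · exact eLpNorm_mono_measure _ Measure.restrict_le_self
  have hlim : Tendsto (fun n => S * (eLpNorm (gradient (φ n) - w) (ENNReal.ofReal p) * c
      + eLpNorm w (ENNReal.ofReal s))) atTop (𝓝 (S * eLpNorm w (ENNReal.ofReal s))) := by
    have h1 := ENNReal.Tendsto.mul_const ha.tendsto_grad (Or.inr hc)
    rw [zero_mul] at h1
    have h2 := h1.add_const (eLpNorm w (ENNReal.ofReal s))
    rw [zero_add] at h2
    exact ENNReal.Tendsto.const_mul h2 (Or.inr ENNReal.coe_ne_top)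
  have hbd : ∀ n, eLpNorm (φ n) (ENNReal.ofReal r) ≤ S * (eLpNorm (gradient (φ n) - w)
      (ENNReal.ofReal p) * c + eLpNorm w (ENNReal.ofReal s)) := fun n =>
    (hsob n).trans (mul_le_mul_right (hg n) S)
  -- Fatou's lemma along the almost everywhere convergent test functions.
  have hfat := Lp.eLpNorm_lim_le_liminf_eLpNorm (p := ENNReal.ofReal r)
    (fun n => (ht n).continuous.aestronglyMeasurable) u ha.ae
  have hlim' := hlim.liminf_eq
  rw [← hlim']
  exact hfat.trans (liminf_le_liminf (Eventually.of_forall hbd))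

/-- For p < N take s = p and r = p^*. For p ≥ N take r = q + 1 and solve the Sobolev relation for s,
which gives 1 ≤ s < N ≤ p. In both cases q < r strictly. -/
theorem exists_sobolev_exponents (hN : 2 ≤ N) (hp : 1 < p) {q : ℝ} (hpq : p ≤ q)
    (hq : (q : EReal) < criticalExponent N p) :
    ∃ s r : ℝ, 1 ≤ s ∧ s ≤ p ∧ q < r ∧ 1 / r = 1 / s - 1 / N := by
  have hN' : (2 : ℝ) ≤ N := by exact_mod_cast hN
  unfold criticalExponent at hq
  split_ifs at hq with h
  · refine ⟨p, N * p / (N - p), hp.le, le_rfl, by exact_mod_cast hq, ?_⟩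
    have : (N : ℝ) - p ≠ 0 := by linarith
    field_simp
  · have hr : (0 : ℝ) < q + 1 := by linarith
    refine ⟨(q + 1) * N / (q + 1 + N), q + 1, ?_, ?_, by linarith, ?_⟩
    · rw [le_div_iff₀ (by positivity)]; nlinarith
    · rw [div_le_iff₀ (by positivity)]
      nlinarith [not_lt.1 h]
    · field_simp; ring

end Sobolev

/-! ### Smooth level truncations. -/

section LevelTruncation

/-- A smooth even step, equal to `0` on `[-h,h]` and to `1` off `(-m,m)`. -/
noncomputable def levelStep (h m t : ℝ) : ℝ := Real.smoothTransition ((t ^ 2 - h ^ 2) / (m ^ 2 - h ^ 2))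

/-- The smooth truncation with derivative `levelStep h m`. -/
noncomputable def levelTrunc (h m t : ℝ) : ℝ := ∫ s in (0 : ℝ)..t, levelStep h m s

variable {h m : ℝ}

theorem contDiff_levelStep (h m : ℝ) : ContDiff ℝ ∞ (levelStep h m) := by
  unfold levelStep
  exact Real.smoothTransition.contDiff.comp (by fun_prop)

theorem continuous_levelStep (h m : ℝ) : Continuous (levelStep h m) :=
  (contDiff_levelStep h m).continuous

theorem levelStep_nonneg (h m t : ℝ) : 0 ≤ levelStep h m t := Real.smoothTransition.nonneg _

theorem levelStep_le_one (h m t : ℝ) : levelStep h m t ≤ 1 := Real.smoothTransition.le_one _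

theorem levelStep_eq_zero (h0 : 0 ≤ h) (hm : h < m) {t : ℝ} (ht : |t| ≤ h) : levelStep h m t = 0 := by
  refine Real.smoothTransition.zero_of_nonpos (div_nonpos_of_nonpos_of_nonneg ?_ ?_)
  · nlinarith [sq_abs t, abs_nonneg t]
  · nlinarith

theorem levelStep_eq_one (h0 : 0 ≤ h) (hm : h < m) {t : ℝ} (ht : m ≤ |t|) : levelStep h m t = 1 := by
  refine Real.smoothTransition.one_of_one_le ?_
  rw [one_le_div (by nlinarith)]
  nlinarith [sq_abs t, abs_nonneg t]

theorem levelStep_mono (h0 : 0 ≤ h) (hm : h < m) {s t : ℝ} (hs : 0 ≤ s) (hst : s ≤ t) :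
    levelStep h m s ≤ levelStep h m t := by
  refine Real.smoothTransition.monotone ?_
  have : 0 < m ^ 2 - h ^ 2 := by nlinarith
  gcongr

theorem levelStep_neg (h m t : ℝ) : levelStep h m (-t) = levelStep h m t := by
  simp [levelStep]

theorem levelTrunc_neg (h m t : ℝ) : levelTrunc h m (-t) = -levelTrunc h m t := by
  unfold levelTrunc
  have := intervalIntegral.integral_comp_neg (a := 0) (b := t) (levelStep h m)
  simp only [levelStep_neg, neg_zero] at this
  rw [intervalIntegral.integral_symm, ← this]

theorem levelTrunc_zero (h m : ℝ) : levelTrunc h m 0 = 0 := by simp [levelTrunc]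

theorem hasDerivAt_levelTrunc (h m t : ℝ) : HasDerivAt (levelTrunc h m) (levelStep h m t) t :=
  intervalIntegral.integral_hasDerivAt_right ((continuous_levelStep h m).intervalIntegrable _ _)
    ((continuous_levelStep h m).stronglyMeasurableAtFilter _ _) (continuous_levelStep h m).continuousAt

theorem deriv_levelTrunc (h m : ℝ) : deriv (levelTrunc h m) = levelStep h m :=
  funext fun t => (hasDerivAt_levelTrunc h m t).deriv

theorem contDiff_levelTrunc (h m : ℝ) : ContDiff ℝ ∞ (levelTrunc h m) := by
  rw [contDiff_infty_iff_deriv, deriv_levelTrunc]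
  exact ⟨fun t => (hasDerivAt_levelTrunc h m t).differentiableAt, contDiff_levelStep h m⟩

theorem levelTrunc_nonneg {t : ℝ} (ht : 0 ≤ t) : 0 ≤ levelTrunc h m t :=
  intervalIntegral.integral_nonneg ht fun s _ => levelStep_nonneg h m s

theorem abs_levelTrunc_abs (h m t : ℝ) : |levelTrunc h m t| = levelTrunc h m |t| := by
  rcases abs_cases t with ⟨e, h0⟩ | ⟨e, h0⟩ <;> rw [e]
  · exact abs_of_nonneg (levelTrunc_nonneg h0)
  · rw [← abs_of_nonneg (levelTrunc_nonneg (h := h) (m := m) (t := -t) (by linarith)),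
      levelTrunc_neg, abs_neg]

theorem levelTrunc_mul_self_nonneg (t : ℝ) : 0 ≤ levelTrunc h m t * t := by
  rcases le_total 0 t with ht | ht
  · exact mul_nonneg (levelTrunc_nonneg ht) ht
  · have := levelTrunc_nonneg (h := h) (m := m) (t := -t) (by linarith)
    rw [levelTrunc_neg] at this
    nlinarith

/-- The integrand grows with |s|, so the integral is at most its end value times the length. Thus
T(t)/t ≤ T'(t), which `coeff_lower_bound` requires. -/
theorem abs_levelTrunc_le (h0 : 0 ≤ h) (hm : h < m) (t : ℝ) :
    |levelTrunc h m t| ≤ levelStep h m t * |t| := by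
  have key : ∀ {t : ℝ}, 0 ≤ t → levelTrunc h m t ≤ levelStep h m t * t := by
    intro t ht
    have := intervalIntegral.integral_mono_on (μ := volume) (g := fun _ => levelStep h m t) ht
      ((continuous_levelStep h m).intervalIntegrable _ _) intervalIntegrable_const
      fun s hs => levelStep_mono h0 hm hs.1 hs.2
    simpa [levelTrunc, mul_comm] using this
  have e : levelStep h m t = levelStep h m |t| := by
    rcases abs_cases t with ⟨e, -⟩ | ⟨e, -⟩ <;> rw [e]
    rw [levelStep_neg]
  rw [abs_levelTrunc_abs, e]
  exact key (abs_nonneg t)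

theorem sub_le_abs_levelTrunc (h0 : 0 ≤ h) (hm : h < m) {t : ℝ} (ht : m ≤ |t|) :
    |t| - m ≤ |levelTrunc h m t| := by
  rw [abs_levelTrunc_abs]
  have hi : ∀ a b, IntervalIntegrable (levelStep h m) volume a b := fun a b =>
    (continuous_levelStep h m).intervalIntegrable a b
  have e : levelTrunc h m |t| = levelTrunc h m m + ∫ s in m..|t|, levelStep h m s :=
    (intervalIntegral.integral_add_adjacent_intervals (hi 0 m) (hi m |t|)).symm
  have e2 : ∫ s in m..|t|, levelStep h m s = |t| - m := by
    rw [intervalIntegral.integral_congr (g := fun _ => (1 : ℝ))]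
    · simp
    · intro s hs
      rw [uIcc_of_le ht] at hs
      exact levelStep_eq_one h0 hm (hs.1.trans (le_abs_self s))
  rw [e, e2]
  have := levelTrunc_nonneg (h := h) (m := m) (t := m) (by linarith)
  linarith

/-- With m = (h+k)/2 the truncation is at least |t| - m, and |t| / (|t| - m) decreases on |t| > k
from its value 2k/(k-h) at k. -/
theorem abs_le_mul_abs_levelTrunc (h0 : 0 ≤ h) {k : ℝ} (hk : h < k) {t : ℝ} (ht : k < |t|) :
    |t| ≤ 2 * k / (k - h) * |levelTrunc h ((h + k) / 2) t| := by
  have h1 := sub_le_abs_levelTrunc h0 (m := (h + k) / 2) (by linarith) (t := t) (by linarith)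
  have hkh : 0 < k - h := by linarith
  have h2 : |t| ≤ 2 * k / (k - h) * (|t| - (h + k) / 2) := by
    rw [div_mul_eq_mul_div, le_div_iff₀ hkh]
    nlinarith
  exact h2.trans (mul_le_mul_of_nonneg_left h1 (div_nonneg (by linarith) hkh.le))

end LevelTruncation

/-! ### One step of De Giorgi's iteration. -/

section DeGiorgi

variable {N : ℕ} {p : ℝ} {Ω : Set (RN N)}

/-- The function `t^q` on `t > h`, extended by `0`. -/
noncomputable def powAbove (h q t : ℝ) : ℝ := (Ioi h).indicator (fun t => t ^ q) t

theorem powAbove_of_lt {h q t : ℝ} (ht : h < t) : powAbove h q t = t ^ q := by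
  simp [powAbove, ht]

theorem powAbove_of_le {h q t : ℝ} (ht : t ≤ h) : powAbove h q t = 0 := by
  simp [powAbove, ht]

theorem measurable_powAbove (h q : ℝ) : Measurable (powAbove h q) :=
  (by fun_prop : Measurable fun t : ℝ => t ^ q).indicator measurableSet_Ioi

/-- The excess integral `∫_{|u|>h} |u|^q`. -/
noncomputable def excess (u : RN N → ℝ) (q h : ℝ) : ENNReal :=
  ∫⁻ x, ENNReal.ofReal (powAbove h q |u x|)

/-- Chebyshev: as h ≥ 1 and q ≥ 0, the integrand is at least 1 on the superlevel set. -/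
theorem measure_superlevel_le_excess {u : RN N → ℝ} (hu : AEMeasurable u volume) {h q : ℝ}
    (hh : 1 ≤ h) (hq : 0 ≤ q) : volume {x | h < |u x|} ≤ excess u q h := by
  have hm : AEMeasurable (fun x => ENNReal.ofReal (powAbove h q |u x|)) volume :=
    ((measurable_powAbove h q).comp_aemeasurable (hu.norm)).ennreal_ofReal
  have := mul_meas_ge_le_lintegral₀ hm 1
  rw [one_mul] at this
  refine (measure_mono fun x hx => ?_).trans this
  simp only [mem_ofPred_eq] at hx ⊢
  rw [powAbove_of_lt hx, ENNReal.one_le_ofReal]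
  exact Real.one_le_rpow (by linarith) hq

/-- Hölder's inequality for a function vanishing off `A`. -/
theorem eLpNorm_le_eLpNorm_mul_measure_rpow {F : Type*} [NormedAddCommGroup F] {f : RN N → F}
    {A : Set (RN N)} (hf : AEStronglyMeasurable f volume) (hA : ∀ x, x ∉ A → f x = 0) {s r : ℝ}
    (hs : 0 < s) (hsr : s ≤ r) :
    eLpNorm f (ENNReal.ofReal s) ≤ eLpNorm f (ENNReal.ofReal r) * volume A ^ (1 / s - 1 / r) := by
  have hsub : Function.support f ⊆ A := fun x hx => by
    by_contra h; exact hx (hA x h)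
  have e := eLpNorm_restrict_eq_of_support_subset (μ := volume) (p := ENNReal.ofReal s) hsub
  rw [← e]
  refine (eLpNorm_le_eLpNorm_mul_rpow_measure_univ (ENNReal.ofReal_le_ofReal hsr)
    hf.restrict).trans ?_
  rw [Measure.restrict_apply_univ, ENNReal.toReal_ofReal (by linarith),
    ENNReal.toReal_ofReal (by linarith)]
  gcongr
  exact Measure.restrict_le_self

theorem lintegral_rpow_enorm_eq {F : Type*} [NormedAddCommGroup F] {f : RN N → F} {s : ℝ}
    (hs : 0 < s) : ∫⁻ x, ‖f x‖ₑ ^ s = eLpNorm f (ENNReal.ofReal s) ^ s := by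
  rw [eLpNorm_eq_lintegral_rpow_enorm_toReal (by simpa using hs) ENNReal.ofReal_ne_top,
    ENNReal.toReal_ofReal hs.le, ← ENNReal.rpow_mul, one_div, inv_mul_cancel₀ hs.ne',
    ENNReal.rpow_one]

/-- The Sobolev inequality for the level truncations of `u`. -/
theorem eLpNorm_levelTrunc_le (hp : 1 ≤ p) {s r : ℝ} (hs : 1 ≤ s) (hsp : s ≤ p) {S : ENNReal}
    {u : RN N → ℝ} {w : RN N → RN N} (hu : InW0 Ω p u w)
    (hS : ∀ (u : RN N → ℝ) (w : RN N → RN N), InW0 Ω p u w →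
      eLpNorm u (ENNReal.ofReal r) ≤ S * eLpNorm w (ENNReal.ofReal s))
    {h m : ℝ} (h0 : 0 ≤ h) (hm : h < m) :
    eLpNorm (fun x => levelTrunc h m (u x)) (ENNReal.ofReal r)
      ≤ S * (eLpNorm (fun x => levelStep h m (u x) • w x) (ENNReal.ofReal p)
        * volume {x | h < |u x|} ^ (1 / s - 1 / p)) := by
  have hc := hu.comp hp (contDiff_levelTrunc h m) (levelTrunc_zero h m) (L := 1) fun t => by
    rw [deriv_levelTrunc, abs_of_nonneg (levelStep_nonneg h m t)]
    exact levelStep_le_one h m t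
  rw [deriv_levelTrunc] at hc
  refine (hS _ _ hc).trans ?_
  gcongr
  -- The gradient of the truncation lives on {|u| > h}, so Hölder from s to p gains a power of its
  -- measure.
  refine eLpNorm_le_eLpNorm_mul_measure_rpow hc.memLp_grad.1 (fun x hx => ?_) (by linarith) hsp
  rw [levelStep_eq_zero h0 hm (not_lt.1 hx), zero_smul]

/-- Above k the function is comparable to its truncation at the lower level h, and Hölder from q to
r on {|u| > k} brings in the Sobolev exponent. -/
theorem excess_le_of_levelTrunc {u : RN N → ℝ} (hu : AEMeasurable u volume) {q r : ℝ} (hq : 0 < q)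
    (hqr : q ≤ r) {h k : ℝ} (h0 : 0 ≤ h) (hk : h < k) :
    excess u q k ≤ ENNReal.ofReal ((2 * k / (k - h)) ^ q) *
      (eLpNorm (fun x => levelTrunc h ((h + k) / 2) (u x)) (ENNReal.ofReal r)
        * volume {x | k < |u x|} ^ (1 / q - 1 / r)) ^ q := by
  -- As u is only almost everywhere measurable, its superlevel set is replaced by a measurable hull
  -- of the same measure.
  set A : Set (RN N) := toMeasurable volume {x | k < |u x|}
  have hA : MeasurableSet A := measurableSet_toMeasurable _ _
  have hvA : volume A = volume {x | k < |u x|} := measure_toMeasurable _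
  set f : RN N → ℝ := A.indicator fun x => levelTrunc h ((h + k) / 2) (u x)
  have hf0 : AEStronglyMeasurable (fun x => levelTrunc h ((h + k) / 2) (u x)) volume :=
    (contDiff_levelTrunc h _).continuous.comp_aestronglyMeasurable hu.aestronglyMeasurable
  have hf : AEStronglyMeasurable f volume := hf0.indicator hA
  have hc : 0 ≤ 2 * k / (k - h) := div_nonneg (by linarith) (by linarith)
  have h1 : excess u q k ≤ ENNReal.ofReal ((2 * k / (k - h)) ^ q) * ∫⁻ x, ‖f x‖ₑ ^ q := by
    rw [excess, ← lintegral_const_mul' _ _ ENNReal.ofReal_ne_top]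
    refine lintegral_mono fun x => ?_
    simp only
    rcases lt_or_ge k |u x| with hx | hx
    · have hxA : x ∈ A := subset_toMeasurable _ _ hx
      rw [powAbove_of_lt hx]
      simp only [f, indicator_of_mem hxA]
      rw [Real.enorm_eq_ofReal_abs, ENNReal.ofReal_rpow_of_nonneg (abs_nonneg _) hq.le,
        ← ENNReal.ofReal_mul (by positivity), ← Real.mul_rpow hc (abs_nonneg _)]
      exact ENNReal.ofReal_le_ofReal (Real.rpow_le_rpow (abs_nonneg _)
        (abs_le_mul_abs_levelTrunc h0 hk hx) hq.le)
    · rw [powAbove_of_le hx]; simp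
  refine h1.trans ?_
  rw [lintegral_rpow_enorm_eq hq]
  gcongr
  refine (eLpNorm_le_eLpNorm_mul_measure_rpow hf (A := A)
    (fun x hx => by simp [f, hx]) hq hqr).trans ?_
  rw [hvA]
  gcongr
  refine eLpNorm_mono fun x => ?_
  simp only [f]
  exact norm_indicator_le_norm_self _ _

/-- The decay estimate of De Giorgi's iteration. -/
theorem excess_decay (hN : 2 ≤ N) (hp : 1 ≤ p) {s r q : ℝ} (hs : 1 ≤ s) (hsp : s ≤ p) (hq : 0 < q)
    (hqr : q ≤ r) (hsr : 1 / r = 1 / s - 1 / N) {S : ENNReal}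
    {u : RN N → ℝ} {w : RN N → RN N} (hu : InW0 Ω p u w)
    (hS : ∀ (u : RN N → ℝ) (w : RN N → RN N), InW0 Ω p u w →
      eLpNorm u (ENNReal.ofReal r) ≤ S * eLpNorm w (ENNReal.ofReal s))
    {C : ENNReal} {h k : ℝ} (h1 : 1 ≤ h) (hk : h < k)
    (hE : eLpNorm (fun x => levelStep h ((h + k) / 2) (u x) • w x) (ENNReal.ofReal p)
      ≤ (C * excess u q h) ^ (1 / p)) :
    excess u q k ≤ ENNReal.ofReal ((2 * k / (k - h)) ^ q) * (S * C ^ (1 / p)) ^ q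
      * excess u q h ^ (1 + q / N) := by
  have hum : AEMeasurable u volume := hu.memLp.1.aemeasurable
  set Y := excess u q h
  have hv : volume {x | h < |u x|} ≤ Y := measure_superlevel_le_excess hum h1 hq.le
  have hv' : volume {x | k < |u x|} ≤ Y := (measure_mono fun x hx => hk.trans hx).trans hv
  have e1 : 0 ≤ 1 / s - 1 / p := sub_nonneg.2 (one_div_le_one_div_of_le (by linarith) hsp)
  have e2 : 0 ≤ 1 / q - 1 / r := sub_nonneg.2 (one_div_le_one_div_of_le hq hqr)
  have e3 : 0 ≤ 1 / p := by positivity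
  -- The three exponents come from the energy inequality and the two uses of Hölder. The Sobolev
  -- relation makes the total power of the excess exceed 1, which drives the iteration.
  have e4 : (1 / p + (1 / s - 1 / p) + (1 / q - 1 / r)) * q = 1 + q / N := by
    have : (N : ℝ) ≠ 0 := by positivity
    rw [hsr]; field_simp; ring
  have b1 := excess_le_of_levelTrunc hum hq hqr (by linarith) hk
  have b2 := eLpNorm_levelTrunc_le hp hs hsp hu hS (h := h) (m := (h + k) / 2) (by linarith)
    (by linarith)
  have b3 : eLpNorm (fun x => levelTrunc h ((h + k) / 2) (u x)) (ENNReal.ofReal r)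
      ≤ S * ((C * Y) ^ (1 / p) * Y ^ (1 / s - 1 / p)) := b2.trans (by gcongr)
  have b4 : (S * ((C * Y) ^ (1 / p) * Y ^ (1 / s - 1 / p)) * Y ^ (1 / q - 1 / r)) ^ q
      = (S * C ^ (1 / p)) ^ q * Y ^ (1 + q / N) := by
    rw [← e4, ENNReal.rpow_mul, ENNReal.rpow_add_of_nonneg _ _ (add_nonneg e3 e1) e2,
      ENNReal.rpow_add_of_nonneg _ _ e3 e1, ENNReal.mul_rpow_of_nonneg _ _ e3,
      ← ENNReal.mul_rpow_of_nonneg _ _ hq.le]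
    congr 1
    ring
  rw [mul_assoc, ← b4]
  refine b1.trans ?_
  gcongr

end DeGiorgi

/-! ### The iteration and the resulting sup bound. -/

section DeGiorgiIteration

/-- Fast geometric convergence. -/
theorem exists_fast_geometric_convergence {D b δ : ℝ} (hD : 0 < D) (hb : 1 < b) (hδ : 0 < δ) :
    ∃ ε : ℝ, 0 < ε ∧ ∀ Y : ℕ → ENNReal, Y 0 ≤ ENNReal.ofReal ε →
      (∀ j, Y (j + 1) ≤ ENNReal.ofReal (D * b ^ j) * Y j ^ (1 + δ)) → Tendsto Y atTop (𝓝 0) := by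
  have hb0 : 0 < b := by linarith
  -- With b τ^δ = 1 and D ε^δ = τ, the bound Y_j ≤ ε τ^j reproduces itself: D b^j (ε τ^j)^{1+δ} = ε
  -- τ^{j+1}.
  set τ : ℝ := b ^ (-(1 / δ)) with hτ
  have hτ0 : 0 < τ := by positivity
  have hτ1 : τ < 1 := Real.rpow_lt_one_of_one_lt_of_neg hb (by simpa using hδ)
  have hbτ : b * τ ^ δ = 1 := by
    rw [hτ, ← Real.rpow_mul hb0.le]
    have : -(1 / δ) * δ = -1 := by field_simp
    rw [this, Real.rpow_neg_one, mul_inv_cancel₀ hb0.ne']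
  set ε : ℝ := (τ / D) ^ (1 / δ) with hε
  have hε0 : 0 < ε := by positivity
  have hεδ : ε ^ δ = τ / D := by
    rw [hε, ← Real.rpow_mul (by positivity), one_div, inv_mul_cancel₀ hδ.ne', Real.rpow_one]
  refine ⟨ε, hε0, fun Y h0 hY => ?_⟩
  have key : ∀ j, Y j ≤ ENNReal.ofReal (ε * τ ^ j) := by
    intro j
    induction j with
    | zero => simpa using h0
    | succ j ih =>
      refine (hY j).trans ?_
      have h1 : Y j ^ (1 + δ) ≤ ENNReal.ofReal ((ε * τ ^ j) ^ (1 + δ)) := by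
        rw [← ENNReal.ofReal_rpow_of_nonneg (by positivity) (by positivity)]
        gcongr
      refine (mul_le_mul_right h1 _).trans ?_
      rw [← ENNReal.ofReal_mul (by positivity)]
      refine ENNReal.ofReal_le_ofReal (le_of_eq ?_)
      have h2 : (τ ^ j) ^ δ = (τ ^ δ) ^ j := by
        rw [← Real.rpow_natCast, ← Real.rpow_natCast, ← Real.rpow_mul hτ0.le,
          ← Real.rpow_mul hτ0.le, mul_comm]
      have h3 : b ^ j * (τ ^ δ) ^ j = 1 := by rw [← mul_pow, hbτ, one_pow]
      rw [Real.rpow_add (by positivity), Real.rpow_one, Real.mul_rpow hε0.le (by positivity), h2,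
        hεδ]
      calc D * b ^ j * (ε * τ ^ j * (τ / D * (τ ^ δ) ^ j))
          = (b ^ j * (τ ^ δ) ^ j) * (D * (τ / D)) * (ε * τ ^ j) := by ring
        _ = ε * τ ^ (j + 1) := by
          rw [h3, mul_div_cancel₀ _ hD.ne']; ring
  have hlim : Tendsto (fun j : ℕ => ENNReal.ofReal (ε * τ ^ j)) atTop (𝓝 0) := by
    have := (tendsto_pow_atTop_nhds_zero_of_lt_one hτ0.le hτ1).const_mul ε
    rw [mul_zero] at this
    simpa using ENNReal.tendsto_ofReal this
  exact tendsto_of_tendsto_of_tendsto_of_le_of_le tendsto_const_nhds hlim (fun _ => zero_le) key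

variable {N : ℕ} {p : ℝ}

theorem powAbove_nonneg (h q : ℝ) {t : ℝ} (ht : 0 ≤ t) : 0 ≤ powAbove h q t := by
  rcases lt_or_ge h t with hx | hx
  · rw [powAbove_of_lt hx]; positivity
  · rw [powAbove_of_le hx]

theorem excess_antitone (u : RN N → ℝ) (q : ℝ) {h k : ℝ} (hk : h ≤ k) :
    excess u q k ≤ excess u q h := by
  refine lintegral_mono fun x => ENNReal.ofReal_le_ofReal ?_
  rcases lt_or_ge k |u x| with hx | hx
  · rw [powAbove_of_lt hx, powAbove_of_lt (hk.trans_lt hx)]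
  · rw [powAbove_of_le hx]
    exact powAbove_nonneg _ _ (abs_nonneg _)

theorem excess_le_eLpNorm (hp : 0 < p) (u : RN N → ℝ) (h : ℝ) :
    excess u p h ≤ eLpNorm u (ENNReal.ofReal p) ^ p := by
  rw [← lintegral_rpow_enorm_eq hp]
  refine lintegral_mono fun x => ?_
  rw [Real.enorm_eq_ofReal_abs, ENNReal.ofReal_rpow_of_nonneg (abs_nonneg _) hp.le]
  refine ENNReal.ofReal_le_ofReal ?_
  rcases lt_or_ge h |u x| with hx | hx
  · rw [powAbove_of_lt hx]
  · rw [powAbove_of_le hx]; positivity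

theorem excess_le_rpow_mul_excess (u : RN N → ℝ) {q r h k : ℝ} (hqr : q ≤ r) (h0 : 0 < k)
    (hk : h ≤ k) : excess u q k ≤ ENNReal.ofReal (k ^ (q - r)) * excess u r h := by
  rw [excess, excess, ← lintegral_const_mul' _ _ ENNReal.ofReal_ne_top]
  refine lintegral_mono fun x => ?_
  rw [← ENNReal.ofReal_mul (by positivity)]
  refine ENNReal.ofReal_le_ofReal ?_
  rcases lt_or_ge k |u x| with hx | hx
  · rw [powAbove_of_lt hx, powAbove_of_lt (hk.trans_lt hx)]
    have hu0 : 0 < |u x| := h0.trans hx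
    have h1 : |u x| ^ q = |u x| ^ (q - r) * |u x| ^ r := by
      rw [← Real.rpow_add hu0]; ring_nf
    rw [h1]
    refine mul_le_mul_of_nonneg_right ?_ (by positivity)
    exact Real.rpow_le_rpow_of_nonpos h0 hx.le (by linarith)
  · rw [powAbove_of_le hx]
    exact mul_nonneg (by positivity) (powAbove_nonneg _ _ (abs_nonneg _))

/-- De Giorgi's `L^∞` bound: a function whose level truncations satisfy the energy inequality is
bounded by a constant depending only on the data. -/
theorem exists_bound_of_energy_inequality (hN : 2 ≤ N) (hp : 1 < p) {q : ℝ} (hpq : p ≤ q)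
    (hq : (q : EReal) < criticalExponent N p) {C B : ENNReal} (hC : C ≠ ⊤) (hB : B ≠ ⊤) :
    ∃ M : ℝ, 0 < M ∧ ∀ (Ω : Set (RN N)), volume Ω ≠ ⊤ → ∀ (u : RN N → ℝ) (w : RN N → RN N),
      InW0 Ω p u w → eLpNorm u (ENNReal.ofReal p) ≤ B → eLpNorm w (ENNReal.ofReal p) ≤ B →
      (∀ h k : ℝ, 1 ≤ h → h < k →
        eLpNorm (fun x => levelStep h ((h + k) / 2) (u x) • w x) (ENNReal.ofReal p)
          ≤ (C * excess u q h) ^ (1 / p)) →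
      ∀ᵐ x, |u x| ≤ M := by
  obtain ⟨s, r, hs, hsp, hqr, hsr⟩ := exists_sobolev_exponents hN hp hpq hq
  have hq0 : 0 < q := by linarith
  have hp0 : 0 < p := by linarith
  have hN0 : (0 : ℝ) < N := by positivity
  obtain ⟨S, hS, hsob⟩ := exists_sobolev_const hN hs (hq0.trans hqr) hsr
  have e1 : 0 ≤ 1 / s - 1 / p := sub_nonneg.2 (one_div_le_one_div_of_le (by linarith) hsp)
  set T : ENNReal := (S * C ^ (1 / p)) ^ q
  have hT : T ≠ ⊤ := ENNReal.rpow_ne_top_of_nonneg hq0.le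
    (ENNReal.mul_ne_top hS (ENNReal.rpow_ne_top_of_nonneg (by positivity) hC))
  -- The factor 8^q comes from the ratio of consecutive levels; adding 1 keeps D positive if T = 0.
  set D : ℝ := 8 ^ q * (T.toReal + 1)
  have hD : 0 < D := by positivity
  have hb : (1 : ℝ) < 2 ^ q := Real.one_lt_rpow (by norm_num) hq0
  obtain ⟨ε, hε, hfast⟩ := exists_fast_geometric_convergence hD hb (div_pos hq0 hN0)
  -- A bound for the excess of order r above level 2, from Sobolev for the truncation between levels
  -- 1 and 2 and the norm bound B.
  set E : ENNReal := ENNReal.ofReal ((2 * 2 / (2 - 1)) ^ r) *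
    (S * (B * (B ^ p) ^ (1 / s - 1 / p))) ^ r
  have hE : E ≠ ⊤ := by
    refine ENNReal.mul_ne_top ENNReal.ofReal_ne_top (ENNReal.rpow_ne_top_of_nonneg (by linarith) ?_)
    refine ENNReal.mul_ne_top hS (ENNReal.mul_ne_top hB ?_)
    exact ENNReal.rpow_ne_top_of_nonneg e1 (ENNReal.rpow_ne_top_of_nonneg hp0.le hB)
  -- Since q < r, the excess of order q above K is at most K^{q-r} E. A large K therefore starts the
  -- iteration below its threshold, uniformly over all u.
  obtain ⟨K, hK2, hKε⟩ : ∃ K : ℝ, 2 ≤ K ∧ ENNReal.ofReal (K ^ (q - r)) * E ≤ ENNReal.ofReal ε := by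
    have h1 : Tendsto (fun K : ℝ => K ^ (-(r - q))) atTop (𝓝 0) :=
      tendsto_rpow_neg_atTop (by linarith)
    have h2 := ENNReal.Tendsto.mul_const (ENNReal.tendsto_ofReal h1) (Or.inr hE)
    rw [ENNReal.ofReal_zero, zero_mul] at h2
    obtain ⟨K, h3, h4⟩ := ((h2.eventually
      (gt_mem_nhds (ENNReal.ofReal_pos.2 hε))).and (eventually_ge_atTop (2 : ℝ))).exists
    exact ⟨K, h4, by rw [neg_sub] at h3; exact h3.le⟩
  refine ⟨2 * K, by linarith, fun Ω hΩ u w hu hBu hBw hen => ?_⟩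
  have hum : AEMeasurable u volume := hu.memLp.1.aemeasurable
  have hS' := hsob p hsp Ω hΩ
  have hstart : excess u q K ≤ ENNReal.ofReal ε := by
    refine (excess_le_rpow_mul_excess u hqr.le (by linarith) hK2).trans
      (le_trans (mul_le_mul_right ?_ _) hKε)
    refine (excess_le_of_levelTrunc (q := r) (r := r) (h := 1) (k := 2) hum (by linarith)
      le_rfl zero_le_one (by norm_num)).trans ?_
    rw [sub_self, ENNReal.rpow_zero, mul_one]
    refine mul_le_mul_right (ENNReal.rpow_le_rpow ?_ (by linarith)) _
    refine (eLpNorm_levelTrunc_le hp.le hs hsp hu hS' (h := 1) (m := (1 + 2) / 2) zero_le_one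
      (by norm_num)).trans ?_
    refine mul_le_mul_right (mul_le_mul' ?_ (ENNReal.rpow_le_rpow ?_ e1)) _
    · refine (eLpNorm_mono fun x => ?_).trans hBw
      rw [norm_smul, Real.norm_of_nonneg (levelStep_nonneg _ _ _)]
      exact mul_le_of_le_one_left (norm_nonneg _) (levelStep_le_one _ _ _)
    · refine (measure_superlevel_le_excess hum le_rfl hp0.le).trans
        ((excess_le_eLpNorm hp0 u 1).trans (ENNReal.rpow_le_rpow hBu hp0.le))
  -- Levels increasing from K to 2K with gaps K/2^{j+1}. Hence 2κ_{j+1}/(κ_{j+1} - κ_j) ≤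
  -- 4K/(K/2^{j+1}) = 8·2^j.
  set κ : ℕ → ℝ := fun j => 2 * K - K / 2 ^ j
  have hlim := hfast (fun j => excess u q (κ j)) (by
      have : κ 0 = K := by simp [κ]; ring
      simpa [this] using hstart) fun j => by
    have hj : (1 : ℝ) ≤ 2 ^ j := one_le_pow₀ (by norm_num)
    have hKj : K / 2 ^ j ≤ K := div_le_self (by linarith) hj
    have hKj0 : 0 < K / 2 ^ j := by positivity
    have hsucc : K / 2 ^ (j + 1) = K / 2 ^ j / 2 := by rw [pow_succ]; field_simp
    have hlt : κ j < κ (j + 1) := by simp only [κ]; rw [hsucc]; linarith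
    have h1j : 1 ≤ κ j := by simp only [κ]; linarith
    refine (excess_decay hN hp.le hs hsp hq0 hqr.le hsr hu hS' h1j hlt (hen _ _ h1j hlt)).trans ?_
    refine mul_le_mul_left ?_ _
    have hratio : 2 * κ (j + 1) / (κ (j + 1) - κ j) ≤ 8 * 2 ^ j := by
      have hd : κ (j + 1) - κ j = K / 2 ^ j / 2 := by simp only [κ]; rw [hsucc]; ring
      rw [hd, div_le_iff₀ (by positivity)]
      have : 8 * (2 : ℝ) ^ j * (K / 2 ^ j / 2) = 4 * K := by field_simp; norm_num
      rw [this]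
      simp only [κ]
      rw [hsucc]; linarith
    have hnn : 0 ≤ 2 * κ (j + 1) / (κ (j + 1) - κ j) :=
      div_nonneg (by linarith) (by linarith)
    have hpw : (2 * κ (j + 1) / (κ (j + 1) - κ j)) ^ q ≤ 8 ^ q * (2 ^ q) ^ j := by
      refine (Real.rpow_le_rpow hnn hratio hq0.le).trans (le_of_eq ?_)
      rw [Real.mul_rpow (by norm_num) (by positivity)]
      congr 1
      rw [← Real.rpow_natCast, ← Real.rpow_natCast, ← Real.rpow_mul (by norm_num),
        ← Real.rpow_mul (by norm_num), mul_comm]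
    have hT' : T ≤ ENNReal.ofReal (T.toReal + 1) := by
      rw [← ENNReal.ofReal_toReal hT]
      refine ENNReal.ofReal_le_ofReal ?_
      rw [ENNReal.ofReal_toReal hT]; linarith
    calc ENNReal.ofReal ((2 * κ (j + 1) / (κ (j + 1) - κ j)) ^ q) * T
        ≤ ENNReal.ofReal (8 ^ q * (2 ^ q) ^ j) * ENNReal.ofReal (T.toReal + 1) :=
          mul_le_mul' (ENNReal.ofReal_le_ofReal hpw) hT'
      _ = ENNReal.ofReal (D * (2 ^ q) ^ j) := by
          rw [← ENNReal.ofReal_mul (by positivity)]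
          congr 1
          simp only [D]; ring
  have hzero : excess u q (2 * K) = 0 := by
    refine le_antisymm (ge_of_tendsto' hlim fun j => excess_antitone u q ?_) zero_le
    simp only [κ]
    have : 0 < K / 2 ^ j := by positivity
    linarith
  have hmeas := measure_superlevel_le_excess hum (h := 2 * K) (by linarith) hq0.le
  rw [hzero, nonpos_iff_eq_zero] at hmeas
  have := measure_eq_zero_iff_ae_notMem.1 hmeas
  filter_upwards [this] with x hx
  exact not_lt.1 hx

end DeGiorgiIteration

/-! ### Energy and level estimates for critical points. -/

section CriticalPoints

variable {N : ℕ}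

/-- The structure conditions on the potential and the nonlinear terms. -/
structure StructureConditions (N : ℕ) (p : ℝ) (V : RN N → ℝ) (A g : RN N → ℝ → ℝ)
    (α₀ μ q c α₁ α₂ a₁ a₂ : ℝ) : Prop where
  one_lt_p : 1 < p
  aemeasurable_V : AEMeasurable V volume
  c_pos : 0 < c
  le_V : ∀ᵐ x : RN N, c ≤ V x
  caratheodory_A : IsCaratheodory 1 A
  bound_A : ∀ ρ : ℝ, 0 < ρ → ∃ C : ℝ, ∀ᵐ x : RN N, ∀ t : ℝ, |t| ≤ ρ →
      |A x t| ≤ C ∧ |deriv (A x) t| ≤ C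
  α₀_pos : 0 < α₀
  le_A : ∀ᵐ x : RN N, ∀ t : ℝ, α₀ ≤ A x t
  p_lt_μ : p < μ
  α₁_pos : 0 < α₁
  growth_A : ∀ᵐ x : RN N, ∀ t : ℝ, α₁ * A x t ≤ (μ - p) * A x t - deriv (A x) t * t
  α₂_pos : 0 < α₂
  lower_A : ∀ᵐ x : RN N, ∀ t : ℝ, α₂ * A x t ≤ p * A x t + deriv (A x) t * t
  caratheodory_g : IsCaratheodory 0 g
  p_le_q : p ≤ q
  a₁_pos : 0 < a₁
  a₂_pos : 0 < a₂
  bound_g : ∀ᵐ x : RN N, ∀ t : ℝ, |g x t| ≤ a₁ * |t| ^ (p - 1) + a₂ * |t| ^ (q - 1)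
  ambrosetti_rabinowitz : ∀ᵐ x : RN N, ∀ t : ℝ, t ≠ 0 →
      0 < μ * (∫ s in (0 : ℝ)..t, g x s) ∧ μ * (∫ s in (0 : ℝ)..t, g x s) ≤ g x t * t

/-- `u` is a bounded critical point, with weak gradient `w`, on the space `X_Ω`. -/
structure IsCriticalOn (Ω : Set (RN N)) (p : ℝ) (V : RN N → ℝ) (A g : RN N → ℝ → ℝ)
    (u : RN N → ℝ) (w : RN N → RN N) (m : ℝ) : Prop where
  isOpen : IsOpen Ω
  mem : MemXOn Ω V p u
  inW0 : InW0 Ω p u w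
  bound : ∀ᵐ x, |u x| ≤ m
  critical : ∀ v, MemXOn Ω V p v → energyDifferential p V A g u v = 0

/-- A crude Young inequality, by comparing s and t; it serves only for integrability. -/
theorem rpow_sub_one_mul_le {p s t : ℝ} (hp : 1 < p) (hs : 0 ≤ s) (ht : 0 ≤ t) :
    s ^ (p - 1) * t ≤ s ^ p + t ^ p := by
  rcases le_total s t with h | h
  · have h1 : s ^ (p - 1) * t ≤ t ^ (p - 1) * t := by gcongr
    rw [rpow_sub_one_mul_self hp ht] at h1
    have : 0 ≤ s ^ p := by positivity
    linarith
  · have h1 : s ^ (p - 1) * t ≤ s ^ (p - 1) * s := by gcongr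
    rw [rpow_sub_one_mul_self hp hs] at h1
    have : 0 ≤ t ^ p := by positivity
    linarith

theorem MemXOn.integrable_potential {Ω : Set (RN N)} (hΩ : MeasurableSet Ω) {p : ℝ} (hp : 0 < p)
    {V v : RN N → ℝ} (h : MemXOn Ω V p v) : Integrable fun x => V x * |v x| ^ p := by
  have h1 := (integrable_indicator_iff hΩ).2 h.2.1
  refine h1.congr ?_
  filter_upwards [h.2.2.2] with x hx
  by_cases hxΩ : x ∈ Ω
  · simp [hxΩ]
  · simp [hxΩ, hx hxΩ, hp.ne']

theorem MemXOn.exists_bound {Ω : Set (RN N)} (hΩ : MeasurableSet Ω) {p : ℝ}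
    {V v : RN N → ℝ} (h : MemXOn Ω V p v) : ∃ m : ℝ, 0 < m ∧ ∀ᵐ x, |v x| ≤ m := by
  have h1 := h.2.2.1
  have h2 := (ae_restrict_iff' hΩ).1 (ae_le_eLpNormEssSup (f := v) (μ := volume.restrict Ω))
  have hfin : eLpNormEssSup v (volume.restrict Ω) ≠ ⊤ := by
    have := h1.2.ne
    rwa [eLpNorm_exponent_top] at this
  refine ⟨(eLpNormEssSup v (volume.restrict Ω)).toReal + 1, by positivity, ?_⟩
  filter_upwards [h2, h.2.2.2] with x hx hx0
  by_cases hxΩ : x ∈ Ω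
  · have := ENNReal.toReal_mono hfin (hx hxΩ)
    simp only [toReal_enorm, Real.norm_eq_abs] at this
    linarith
  · rw [hx0 hxΩ, abs_zero]; positivity

variable {p : ℝ} {V : RN N → ℝ} {A g : RN N → ℝ → ℝ} {α₀ μ q c α₁ α₂ a₁ a₂ : ℝ}
  {Ω : Set (RN N)} {u : RN N → ℝ} {w : RN N → RN N} {m : ℝ}

theorem IsCriticalOn.aemeasurable (hu : IsCriticalOn Ω p V A g u w m) : AEMeasurable u volume :=
  hu.inW0.memLp.1.aemeasurable

theorem IsCriticalOn.weakGradient_ae_eq (hp : 1 ≤ p) (hu : IsCriticalOn Ω p V A g u w m) :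
    weakGradient univ u =ᵐ[volume] w :=
  weakGradient_univ_ae_eq (hu.inW0.isWeakGradient hp)

theorem StructureConditions.exists_coeff_bound
    (D : StructureConditions N p V A g α₀ μ q c α₁ α₂ a₁ a₂) {m : ℝ} :
    ∃ C : ℝ, 0 ≤ C ∧ ∀ᵐ x : RN N, ∀ t : ℝ, |t| ≤ m → |A x t| ≤ C ∧ |deriv (A x) t| ≤ C := by
  obtain ⟨C, hC⟩ := D.bound_A (max m 1) (by positivity)
  refine ⟨|C|, abs_nonneg _, ?_⟩
  filter_upwards [hC] with x hx t ht
  have := hx t (ht.trans (le_max_left _ _))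
  exact ⟨this.1.trans (le_abs_self C), this.2.trans (le_abs_self C)⟩

theorem integrable_coeff_mul_inner_pField (hp : 1 < p) {a : RN N → ℝ} {C : ℝ}
    (ha : AEMeasurable a volume) (hC : ∀ᵐ x, |a x| ≤ C) {w v : RN N → RN N}
    (hw : MemLp w (ENNReal.ofReal p)) (hv : MemLp v (ENNReal.ofReal p)) :
    Integrable fun x => a x * (inner ℝ (pField p (w x)) (v x) : ℝ) := by
  have hp0 : 0 < p := by linarith
  have i1 := ((MemLp.integrable_rpow hp0 hw).add (MemLp.integrable_rpow hp0 hv)).const_mul C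
  refine i1.mono' ?_ ?_
  · exact ha.aestronglyMeasurable.mul
      (((continuous_pField hp).comp_aestronglyMeasurable hw.1).inner hv.1)
  · filter_upwards [hC] with x hx
    rw [norm_mul]
    refine mul_le_mul hx ?_ (norm_nonneg _) ((abs_nonneg _).trans hx)
    refine (norm_inner_le_norm _ _).trans ?_
    rw [norm_pField hp]
    exact rpow_sub_one_mul_le hp (norm_nonneg _) (norm_nonneg _)

theorem integrable_coeff_mul_rpow (hp : 1 < p) {a : RN N → ℝ} {C : ℝ}
    (ha : AEMeasurable a volume) (hC : ∀ᵐ x, |a x| ≤ C) {w : RN N → RN N}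
    (hw : MemLp w (ENNReal.ofReal p)) : Integrable fun x => a x * ‖w x‖ ^ p := by
  have hp0 : 0 < p := by linarith
  refine ((MemLp.integrable_rpow hp0 hw).const_mul C).mono'
    (ha.aestronglyMeasurable.mul (MemLp.integrable_rpow hp0 hw).1) ?_
  filter_upwards [hC] with x hx
  rw [norm_mul, Real.norm_of_nonneg (Real.rpow_nonneg (norm_nonneg _) _)]
  exact mul_le_mul_of_nonneg_right hx (by positivity)

theorem StructureConditions.integrable_potential_term
    (D : StructureConditions N p V A g α₀ μ q c α₁ α₂ a₁ a₂) {u v : RN N → ℝ}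
    (hum : AEMeasurable u volume) (hvm : AEMeasurable v volume)
    (hu : Integrable fun x => V x * |u x| ^ p) (hv : Integrable fun x => V x * |v x| ^ p) :
    Integrable fun x => V x * |u x| ^ (p - 2) * u x * v x := by
  have hp := D.one_lt_p
  refine (hu.add hv).mono' ?_ ?_
  · exact (((D.aemeasurable_V.mul (hum.norm.pow_const _)).mul hum).mul hvm).aestronglyMeasurable
  · filter_upwards [D.le_V] with x hx
    have hV : 0 ≤ V x := D.c_pos.le.trans hx
    rw [norm_mul, norm_mul, norm_mul, Real.norm_of_nonneg hV,
      Real.norm_of_nonneg (by positivity : 0 ≤ |u x| ^ (p - 2)), Real.norm_eq_abs, Real.norm_eq_abs,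
      mul_assoc (V x), rpow_sub_two_mul_self hp (abs_nonneg _), mul_assoc, Pi.add_apply, ← mul_add]
    exact mul_le_mul_of_nonneg_left (rpow_sub_one_mul_le hp (abs_nonneg _) (abs_nonneg _)) hV

/-- On |t| ≤ m the surplus power |t|^{q-p} is at most m^{q-p}, so for bounded functions the
nonlinearity has p-growth. -/
theorem StructureConditions.abs_g_le
    (D : StructureConditions N p V A g α₀ μ q c α₁ α₂ a₁ a₂) {m : ℝ} :
    ∀ᵐ x : RN N, ∀ t, |t| ≤ m → |g x t| ≤ (a₁ + a₂ * m ^ (q - p)) * |t| ^ (p - 1) := by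
  filter_upwards [D.bound_g] with x hx t ht
  have hp := D.one_lt_p
  have hpq := D.p_le_q
  refine (hx t).trans ?_
  rw [add_mul, mul_assoc]
  have ha := D.a₂_pos.le
  gcongr
  rcases (abs_nonneg t).eq_or_lt with h0 | h0
  · rw [← h0, Real.zero_rpow (by linarith), Real.zero_rpow (by linarith), mul_zero]
  · have e : q - 1 = (q - p) + (p - 1) := by ring
    rw [e, Real.rpow_add h0]
    gcongr

theorem StructureConditions.integrable_g_term
    (D : StructureConditions N p V A g α₀ μ q c α₁ α₂ a₁ a₂) {u v : RN N → ℝ} {m : ℝ}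
    (hu : MemLp u (ENNReal.ofReal p)) (hv : MemLp v (ENNReal.ofReal p)) (hm : ∀ᵐ x, |u x| ≤ m) :
    Integrable fun x => g x (u x) * v x := by
  have hp := D.one_lt_p
  have hp0 : 0 < p := by linarith
  refine (((MemLp.integrable_rpow hp0 hu).add (MemLp.integrable_rpow hp0 hv)).const_mul
    (a₁ + a₂ * m ^ (q - p))).mono' ?_ ?_
  · exact ((D.caratheodory_g.aemeasurable_comp hu.1.aemeasurable).mul
      hv.1.aemeasurable).aestronglyMeasurable
  · filter_upwards [hm, D.abs_g_le (m := m)] with x h1 h2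
    have hm0 : 0 ≤ m := (abs_nonneg _).trans h1
    have h3 := h2 _ h1
    rw [norm_mul, Real.norm_eq_abs, Real.norm_eq_abs, Pi.add_apply]
    refine (mul_le_mul_of_nonneg_right h3 (abs_nonneg _)).trans ?_
    rw [mul_assoc]
    refine mul_le_mul_of_nonneg_left
      (rpow_sub_one_mul_le hp (abs_nonneg _) (abs_nonneg _)) ?_
    have := D.a₁_pos; have := D.a₂_pos
    positivity

/-- The Euler–Lagrange equation of a critical point, with the integrability of its terms. -/
theorem IsCriticalOn.equation (D : StructureConditions N p V A g α₀ μ q c α₁ α₂ a₁ a₂)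
    (hu : IsCriticalOn Ω p V A g u w m) {v : RN N → ℝ} {wv : RN N → RN N}
    (hvw : InW0 Ω p v wv) (hv : MemXOn Ω V p v) :
    (Integrable fun x => A x (u x) * (inner ℝ (pField p (w x)) (wv x) : ℝ)) ∧
    (Integrable fun x => deriv (A x) (u x) * v x * ‖w x‖ ^ p) ∧
    (Integrable fun x => V x * |u x| ^ (p - 2) * u x * v x) ∧
    (Integrable fun x => g x (u x) * v x) ∧
    (∫ x, A x (u x) * (inner ℝ (pField p (w x)) (wv x) : ℝ))
      + (1 / p) * (∫ x, deriv (A x) (u x) * v x * ‖w x‖ ^ p)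
      + (∫ x, V x * |u x| ^ (p - 2) * u x * v x) - ∫ x, g x (u x) * v x = 0 := by
  have hp := D.one_lt_p
  have hp0 : 0 < p := by linarith
  obtain ⟨C, hC0, hC⟩ := D.exists_coeff_bound (m := m)
  obtain ⟨mv, hmv0, hmv⟩ := hv.exists_bound hu.isOpen.measurableSet
  have hum := hu.aemeasurable
  have hvm := hvw.memLp.1.aemeasurable
  have hA : ∀ᵐ x, |A x (u x)| ≤ C := by
    filter_upwards [hC, hu.bound] with x h1 h2 using (h1 _ h2).1
  have hAt : ∀ᵐ x, |deriv (A x) (u x) * v x| ≤ C * mv := by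
    filter_upwards [hC, hu.bound, hmv] with x h1 h2 h3
    rw [abs_mul]
    exact mul_le_mul (h1 _ h2).2 h3 (abs_nonneg _) hC0
  refine ⟨integrable_coeff_mul_inner_pField hp (D.caratheodory_A.aemeasurable_comp hum) hA
      hu.inW0.memLp_grad hvw.memLp_grad,
    integrable_coeff_mul_rpow hp ((D.caratheodory_A.aemeasurable_deriv_comp hum).mul hvm) hAt
      hu.inW0.memLp_grad,
    D.integrable_potential_term hum hvm
      (hu.mem.integrable_potential hu.isOpen.measurableSet hp0)
      (hv.integrable_potential hu.isOpen.measurableSet hp0),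
    D.integrable_g_term hu.inW0.memLp hvw.memLp hu.bound, ?_⟩
  have e1 := hu.weakGradient_ae_eq hp.le
  have e2 := weakGradient_univ_ae_eq (hvw.isWeakGradient hp.le)
  rw [← hu.critical v hv, energyDifferential]
  congr 3
  · refine integral_congr_ae ?_
    filter_upwards [e1, e2] with x h1 h2
    rw [h1, h2, pField, inner_smul_left, mul_assoc]
    simp
  · congr 1
    refine integral_congr_ae ?_
    filter_upwards [e1] with x h1
    rw [h1]

/-- The energy bound for critical points. -/
theorem IsCriticalOn.energy_bound (D : StructureConditions N p V A g α₀ μ q c α₁ α₂ a₁ a₂)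
    (hu : IsCriticalOn Ω p V A g u w m) :
    α₁ * α₀ / p * (∫ x, ‖w x‖ ^ p) + (μ - p) / p * (∫ x, V x * |u x| ^ p)
      ≤ μ * energy p V A g u := by
  have hp := D.one_lt_p
  have hp0 : 0 < p := by linarith
  obtain ⟨i1, i2, i3, i4, heq⟩ := hu.equation D hu.inW0 hu.mem
  have iV := hu.mem.integrable_potential hu.isOpen.measurableSet hp0
  have iw := MemLp.integrable_rpow hp0 hu.inW0.memLp_grad
  have f1 : ∀ x, A x (u x) * (inner ℝ (pField p (w x)) (w x) : ℝ) = A x (u x) * ‖w x‖ ^ p :=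
    fun x => by rw [inner_pField_self hp]
  have f3 : ∀ x, V x * |u x| ^ (p - 2) * u x * u x = V x * |u x| ^ p := by
    intro x
    have : |u x| ^ p = |u x| ^ (p - 2) * |u x| * |u x| := by
      rw [rpow_sub_two_mul_self hp (abs_nonneg _), rpow_sub_one_mul_self hp (abs_nonneg _)]
    rw [this, mul_assoc (V x * _), mul_assoc (|u x| ^ (p - 2)), abs_mul_abs_self]; ring
  simp only [f1] at i1 heq
  simp only [f3] at heq
  have e1 : ∫ x, A x (u x) * ‖weakGradient univ u x‖ ^ p = ∫ x, A x (u x) * ‖w x‖ ^ p := by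
    refine integral_congr_ae ?_
    filter_upwards [hu.weakGradient_ae_eq hp.le] with x hx
    rw [hx]
  have hμ0 : 0 < μ := hp0.trans D.p_lt_μ
  -- Monotonicity of the integral needs integrability of the majorant only, because the
  -- Ambrosetti–Rabinowitz condition makes the smaller side nonnegative.
  have hG : μ * (∫ x, ∫ s in (0 : ℝ)..(u x), g x s) ≤ ∫ x, g x (u x) * u x := by
    rw [← integral_const_mul]
    have hAR : ∀ᵐ x, 0 ≤ μ * (∫ s in (0 : ℝ)..(u x), g x s) ∧
        μ * (∫ s in (0 : ℝ)..(u x), g x s) ≤ g x (u x) * u x := by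
      filter_upwards [D.ambrosetti_rabinowitz] with x hx
      rcases eq_or_ne (u x) 0 with h0 | h0
      · simp [h0]
      · exact ⟨(hx _ h0).1.le, (hx _ h0).2⟩
    exact integral_mono_of_nonneg (hAR.mono fun x hx => hx.1) i4 (hAR.mono fun x hx => hx.2)
  have hmain : α₁ * α₀ / p * (∫ x, ‖w x‖ ^ p)
      ≤ (μ - p) / p * (∫ x, A x (u x) * ‖w x‖ ^ p)
        - 1 / p * ∫ x, deriv (A x) (u x) * u x * ‖w x‖ ^ p := by
    rw [← integral_const_mul, ← integral_const_mul, ← integral_const_mul,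
      ← integral_sub (i1.const_mul _) (i2.const_mul _)]
    refine integral_mono_ae (iw.const_mul _) ((i1.const_mul _).sub (i2.const_mul _)) ?_
    filter_upwards [D.growth_A, D.le_A] with x h1 h2
    have h3 : α₁ * α₀ ≤ (μ - p) * A x (u x) - deriv (A x) (u x) * u x :=
      (mul_le_mul_of_nonneg_left (h2 (u x)) D.α₁_pos.le).trans (h1 (u x))
    have h4 := mul_le_mul_of_nonneg_right h3 (by positivity : 0 ≤ ‖w x‖ ^ p / p)
    calc α₁ * α₀ / p * ‖w x‖ ^ p = α₁ * α₀ * (‖w x‖ ^ p / p) := by ring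
      _ ≤ _ := h4
      _ = _ := by ring
  -- The equation tested with u itself is subtracted from μ times the energy.
  have hfin : μ * energy p V A g u = (μ - p) / p * (∫ x, A x (u x) * ‖w x‖ ^ p)
      - 1 / p * (∫ x, deriv (A x) (u x) * u x * ‖w x‖ ^ p)
      + (μ - p) / p * (∫ x, V x * |u x| ^ p)
      + ((∫ x, g x (u x) * u x) - μ * ∫ x, ∫ s in (0 : ℝ)..(u x), g x s) := by
    have h1 : (∫ x, A x (u x) * ‖w x‖ ^ p) = -(1 / p * (∫ x, deriv (A x) (u x) * u x * ‖w x‖ ^ p))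
        - (∫ x, V x * |u x| ^ p) + ∫ x, g x (u x) * u x := by linarith
    rw [energy, e1]
    have h2 : (μ - p) / p * (∫ x, A x (u x) * ‖w x‖ ^ p) = μ / p * (∫ x, A x (u x) * ‖w x‖ ^ p)
        - ∫ x, A x (u x) * ‖w x‖ ^ p := by field_simp
    have h3 : (μ - p) / p * (∫ x, V x * |u x| ^ p) = μ / p * (∫ x, V x * |u x| ^ p)
        - ∫ x, V x * |u x| ^ p := by field_simp
    rw [h2, h3]
    linear_combination h1
  linarith

/-- Write F = θt with 0 ≤ θ ≤ χ. The right side is at least a(χ + θ(α₂/p - 1)), affine in θ, hence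
at least its smaller end value: aχ at θ = 0, aχα₂/p at θ = χ. Here a, d, F, χ stand for A, A_t, the
truncation and its derivative. -/
theorem coeff_lower_bound {p α₂ a d t χ F : ℝ} (hp : 0 < p) (ha : 0 ≤ a)
    (h : α₂ * a ≤ p * a + d * t) (hχ : 0 ≤ χ) (hF : 0 ≤ F * t) (hFχ : |F| ≤ χ * |t|) :
    min 1 (α₂ / p) * a * χ ≤ a * χ + 1 / p * (d * F) := by
  have hmin1 : min 1 (α₂ / p) ≤ 1 := min_le_left _ _
  have hmin2 : min 1 (α₂ / p) ≤ α₂ / p := min_le_right _ _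
  rcases eq_or_ne t 0 with rfl | ht
  · have hF0 : F = 0 := by simpa using hFχ
    subst hF0
    have := mul_nonneg ha hχ
    nlinarith
  · set θ := F / t with hθ
    have hFt : F = θ * t := by rw [hθ]; field_simp
    have htt : 0 < t * t := mul_self_pos.2 ht
    have hθ0 : 0 ≤ θ := by
      have : θ * (t * t) = F * t := by rw [hFt]; ring
      by_contra! hneg
      nlinarith
    have hθχ : θ ≤ χ := by
      rw [hFt, abs_mul, abs_of_nonneg hθ0] at hFχ
      exact le_of_mul_le_mul_right hFχ (abs_pos.2 ht)
    have h1 : 1 / p * (d * F) = θ * (1 / p * (d * t)) := by rw [hFt]; ring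
    have h2 : (α₂ / p - 1) * a ≤ 1 / p * (d * t) := by
      have : (α₂ / p - 1) * a = 1 / p * (α₂ * a - p * a) := by field_simp
      rw [this]
      exact mul_le_mul_of_nonneg_left (by linarith) (by positivity)
    rw [h1]
    have h3 := mul_le_mul_of_nonneg_left h2 hθ0
    have h4 : min 1 (α₂ / p) * χ ≤ χ + θ * (α₂ / p - 1) := by
      have h5 : θ * (min 1 (α₂ / p) - 1) ≤ θ * (α₂ / p - 1) :=
        mul_le_mul_of_nonneg_left (by linarith) hθ0
      nlinarith
    have h6 := mul_le_mul_of_nonneg_left h4 ha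
    nlinarith

/-- The energy inequality for the level truncations of a critical point. -/
theorem IsCriticalOn.level_energy (D : StructureConditions N p V A g α₀ μ q c α₁ α₂ a₁ a₂)
    (hu : IsCriticalOn Ω p V A g u w m) {h k : ℝ} (h1 : 1 ≤ h) (hk : h < k) :
    eLpNorm (fun x => levelStep h k (u x) • w x) (ENNReal.ofReal p)
      ≤ (ENNReal.ofReal ((a₁ + a₂) / (min 1 (α₂ / p) * α₀)) * excess u q h) ^ (1 / p) := by
  have hp := D.one_lt_p
  have hp0 : 0 < p := by linarith
  have hum := hu.aemeasurable
  have hle : ∀ t, |levelTrunc h k t| ≤ |t| := fun t =>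
    (abs_levelTrunc_le (by linarith) hk t).trans
      (mul_le_of_le_one_left (abs_nonneg _) (levelStep_le_one _ _ _))
  have hc := hu.inW0.comp hp.le (contDiff_levelTrunc h k) (levelTrunc_zero h k) (L := 1) fun t => by
    rw [deriv_levelTrunc, abs_of_nonneg (levelStep_nonneg h k t)]
    exact levelStep_le_one h k t
  rw [deriv_levelTrunc] at hc
  have iV := hu.mem.integrable_potential hu.isOpen.measurableSet hp0
  have hX : MemXOn Ω V p fun x => levelTrunc h k (u x) := by
    refine hc.memXOn hu.isOpen hp.le ?_ (C := m) ?_ ?_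
    · refine (iV.mono' ?_ ?_).integrableOn
      · exact (D.aemeasurable_V.mul (hc.memLp.1.aemeasurable.norm.pow_const p)).aestronglyMeasurable
      · filter_upwards [D.le_V] with x hx
        have hV : 0 ≤ V x := D.c_pos.le.trans hx
        rw [Real.norm_of_nonneg (by positivity)]
        have := hle (u x)
        gcongr
    · filter_upwards [hu.bound] with x hx using (hle _).trans hx
    · filter_upwards [hu.mem.2.2.2] with x hx hxΩ
      rw [hx hxΩ, levelTrunc_zero]
  obtain ⟨i1, i2, i3, i4, heq⟩ := hu.equation D hc hX
  have f1 : ∀ x, A x (u x) * (inner ℝ (pField p (w x)) (levelStep h k (u x) • w x) : ℝ)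
      = A x (u x) * levelStep h k (u x) * ‖w x‖ ^ p := fun x => by
    rw [inner_smul_right, inner_pField_self hp]; ring
  simp only [f1] at i1 heq
  set κ : ℝ := min 1 (α₂ / p) * α₀ with hκ
  have hκ0 : 0 < κ := mul_pos (lt_min one_pos (div_pos D.α₂_pos hp0)) D.α₀_pos
  have hmχ : AEMeasurable (fun x => levelStep h k (u x)) volume :=
    (continuous_levelStep h k).measurable.comp_aemeasurable hum
  have iχ : Integrable fun x => levelStep h k (u x) * ‖w x‖ ^ p :=
    integrable_coeff_mul_rpow hp hmχ (C := 1) (ae_of_all _ fun x => by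
      rw [abs_of_nonneg (levelStep_nonneg _ _ _)]; exact levelStep_le_one _ _ _) hu.inW0.memLp_grad
  have hbelow : κ * (∫ x, levelStep h k (u x) * ‖w x‖ ^ p)
      ≤ (∫ x, A x (u x) * levelStep h k (u x) * ‖w x‖ ^ p)
        + (1 / p) * ∫ x, deriv (A x) (u x) * levelTrunc h k (u x) * ‖w x‖ ^ p := by
    rw [← integral_const_mul, ← integral_const_mul, ← integral_add i1 (i2.const_mul _)]
    refine integral_mono_ae (iχ.const_mul _) (i1.add (i2.const_mul _)) ?_
    filter_upwards [D.lower_A, D.le_A] with x hx1 hx2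
    have hA0 : 0 ≤ A x (u x) := D.α₀_pos.le.trans (hx2 _)
    have hc := coeff_lower_bound hp0 hA0 (hx1 (u x)) (levelStep_nonneg h k (u x))
      (levelTrunc_mul_self_nonneg (u x)) (abs_levelTrunc_le (by linarith) hk (u x))
    have hmn : 0 ≤ min 1 (α₂ / p) := le_min zero_le_one (div_nonneg D.α₂_pos.le hp0.le)
    have h5 : κ * levelStep h k (u x) ≤ min 1 (α₂ / p) * A x (u x) * levelStep h k (u x) := by
      refine mul_le_mul_of_nonneg_right ?_ (levelStep_nonneg _ _ _)
      exact mul_le_mul_of_nonneg_left (hx2 _) hmn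
    have h6 := mul_le_mul_of_nonneg_right (h5.trans hc) (by positivity : 0 ≤ ‖w x‖ ^ p)
    linarith
  -- The truncation has the sign of u, so the potential term is nonnegative and can be dropped.
  have hVterm : 0 ≤ ∫ x, V x * |u x| ^ (p - 2) * u x * levelTrunc h k (u x) := by
    refine integral_nonneg_of_ae ?_
    filter_upwards [D.le_V] with x hx
    have hV : 0 ≤ V x := D.c_pos.le.trans hx
    have := levelTrunc_mul_self_nonneg (h := h) (m := k) (u x)
    rw [Pi.zero_apply, mul_assoc, mul_comm (u x)]
    positivity
  -- The bound m is used for integrability alone and does not enter the final constant.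
  have hpa : ∀ᵐ x, ‖powAbove h q |u x|‖ ≤ m ^ (q - p) * ‖u x‖ ^ p := by
    filter_upwards [hu.bound] with x hx
    have hm0 : 0 ≤ m := (abs_nonneg _).trans hx
    rw [Real.norm_of_nonneg (powAbove_nonneg _ _ (abs_nonneg _)), Real.norm_eq_abs]
    rcases lt_or_ge h |u x| with hh | hh
    · rw [powAbove_of_lt hh]
      have h0 : 0 < |u x| := by linarith
      have e : q = (q - p) + p := by ring
      conv_lhs => rw [e, Real.rpow_add h0]
      have := D.p_le_q
      gcongr
    · rw [powAbove_of_le hh]; positivity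
  have ipow : Integrable fun x => powAbove h q |u x| :=
    ((MemLp.integrable_rpow hp0 hu.inW0.memLp).const_mul (m ^ (q - p))).mono'
      ((measurable_powAbove h q).comp_aemeasurable hum.norm).aestronglyMeasurable hpa
  have hgterm : ∫ x, g x (u x) * levelTrunc h k (u x)
      ≤ (a₁ + a₂) * ∫ x, powAbove h q |u x| := by
    rw [← integral_const_mul]
    refine integral_mono_ae i4 (ipow.const_mul _) ?_
    filter_upwards [D.bound_g] with x hx
    rcases lt_or_ge h |u x| with hh | hh
    · rw [powAbove_of_lt hh]
      have h0 : 0 < |u x| := by linarith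
      have ha1 := D.a₁_pos
      have ha2 := D.a₂_pos
      have hpq := D.p_le_q
      have hq1 : 1 < q := by linarith
      -- Here |u| > h ≥ 1, so the larger exponent dominates and both growth terms merge.
      have h3 : |u x| ^ (p - 1) ≤ |u x| ^ (q - 1) :=
        Real.rpow_le_rpow_of_exponent_le (by linarith) (by linarith)
      calc g x (u x) * levelTrunc h k (u x) ≤ |g x (u x)| * |levelTrunc h k (u x)| := by
            rw [← abs_mul]; exact le_abs_self _
        _ ≤ ((a₁ + a₂) * |u x| ^ (q - 1)) * |u x| := by
            refine mul_le_mul ((hx _).trans ?_) (hle _) (abs_nonneg _) (by positivity)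
            rw [add_mul]
            gcongr
        _ = (a₁ + a₂) * |u x| ^ q := by
            rw [mul_assoc, rpow_sub_one_mul_self hq1 (abs_nonneg _)]
    · have : levelTrunc h k (u x) = 0 := by
        have := abs_levelTrunc_le (by linarith) hk (u x)
        rw [levelStep_eq_zero (by linarith) hk hh, zero_mul] at this
        exact abs_eq_zero.1 (le_antisymm this (abs_nonneg _))
      rw [this, powAbove_of_le hh]; simp
  have hreal : ∫ x, ‖levelStep h k (u x) • w x‖ ^ p
      ≤ (a₁ + a₂) / κ * ∫ x, powAbove h q |u x| := by
    -- The step takes values in [0,1], so its p-th power is at most itself.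
    have h2 : ∫ x, ‖levelStep h k (u x) • w x‖ ^ p ≤ ∫ x, levelStep h k (u x) * ‖w x‖ ^ p := by
      refine integral_mono_ae (MemLp.integrable_rpow hp0 hc.memLp_grad) iχ (ae_of_all _ fun x => ?_)
      simp only
      have hs0 := levelStep_nonneg h k (u x)
      rw [norm_smul, Real.norm_of_nonneg hs0, Real.mul_rpow hs0 (norm_nonneg _)]
      refine mul_le_mul_of_nonneg_right ?_ (by positivity)
      exact Real.rpow_le_self_of_le_one hs0 (levelStep_le_one _ _ _) hp.le
    refine h2.trans ?_
    rw [div_mul_eq_mul_div, le_div_iff₀ hκ0, mul_comm]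
    linarith
  rw [eLpNorm_eq_ofReal_integral hp0 hc.memLp_grad, excess,
    ← ofReal_integral_eq_lintegral_ofReal ipow
      (ae_of_all _ fun x => powAbove_nonneg _ _ (abs_nonneg _)), ← ENNReal.ofReal_mul
      (div_nonneg (by linarith [D.a₁_pos, D.a₂_pos]) hκ0.le),
    ENNReal.ofReal_rpow_of_nonneg _ (by positivity)]
  · exact ENNReal.ofReal_le_ofReal (Real.rpow_le_rpow
      (integral_nonneg fun x => by positivity) hreal (by positivity))
  · exact (integral_nonneg fun x => by positivity).trans hreal

end CriticalPoints

/-! ### Flux bounds, the exponential test function and cut-offs. -/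

section LocalCompactness

variable {N : ℕ}

theorem holderConjugate_ofReal {p : ℝ} (hp : 1 < p) :
    ENNReal.HolderConjugate (ENNReal.ofReal (p / (p - 1))) (ENNReal.ofReal p) :=
  (Real.HolderConjugate.conjExponent hp).symm.ennrealOfReal

/-- The conjugate exponent p' = p/(p-1) satisfies (p-1)p' = p, so L^p bounds on gradients bound the
fluxes |∇u|^{p-2}∇u in L^{p'}. -/
theorem eLpNorm_pField {α : Type*} [MeasurableSpace α] {ν : Measure α} {p : ℝ} (hp : 1 < p)
    (w : α → RN N) : eLpNorm (fun x => pField p (w x)) (ENNReal.ofReal (p / (p - 1))) ν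
      = eLpNorm w (ENNReal.ofReal p) ν ^ (p - 1) := by
  have hp1 : 0 < p - 1 := by linarith
  have h := eLpNorm_norm_rpow w (p := ENNReal.ofReal (p / (p - 1))) (μ := ν) hp1
  rw [← ENNReal.ofReal_mul (by positivity), div_mul_cancel₀ _ hp1.ne'] at h
  rw [← h]
  refine eLpNorm_congr_norm_ae (ae_of_all _ fun x => ?_)
  rw [norm_pField hp, Real.norm_of_nonneg (by positivity)]

theorem memLp_pField {α : Type*} [MeasurableSpace α] {ν : Measure α} {p : ℝ} (hp : 1 < p)
    {w : α → RN N} (hw : MemLp w (ENNReal.ofReal p) ν) :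
    MemLp (fun x => pField p (w x)) (ENNReal.ofReal (p / (p - 1))) ν := by
  refine ⟨(continuous_pField hp).comp_aestronglyMeasurable hw.1, ?_⟩
  rw [eLpNorm_pField hp]
  exact ENNReal.rpow_lt_top_of_nonneg (by linarith) hw.2.ne

theorem tendsto_integral_inner_zero {α G : Type*} [MeasurableSpace α] {ν : Measure α}
    [NormedAddCommGroup G] [InnerProductSpace ℝ G] {P Q : ENNReal} [ENNReal.HolderConjugate Q P]
    {f g : ℕ → α → G} {B : ENNReal} (hB : B ≠ ⊤) (hf : ∀ n, MemLp (f n) Q ν)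
    (hfB : ∀ n, eLpNorm (f n) Q ν ≤ B) (hg : ∀ n, MemLp (g n) P ν)
    (hlim : Tendsto (fun n => eLpNorm (g n) P ν) atTop (𝓝 0)) :
    Tendsto (fun n => ∫ x, (inner ℝ (f n x) (g n x) : ℝ) ∂ν) atTop (𝓝 0) := by
  have h1 : Tendsto (fun n => B.toReal * (eLpNorm (g n) P ν).toReal) atTop (𝓝 0) := by
    have := ((ENNReal.tendsto_toReal ENNReal.zero_ne_top).comp hlim).const_mul B.toReal
    simpa using this
  refine squeeze_zero_norm (fun n => ?_) h1
  refine (memLp_one_inner (hf n) (hg n)).2.trans ?_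
  exact mul_le_mul_of_nonneg_right (ENNReal.toReal_mono hB (hfB n)) ENNReal.toReal_nonneg

theorem memLp_bounded_smul {α G : Type*} [MeasurableSpace α] {ν : Measure α}
    [NormedAddCommGroup G] [NormedSpace ℝ G] {P : ENNReal} {a : α → ℝ} {h : α → G} {C : ℝ}
    (ha : AEMeasurable a ν) (hC : ∀ᵐ x ∂ν, |a x| ≤ C) (hh : MemLp h P ν) :
    MemLp (fun x => a x • h x) P ν := by
  refine hh.of_le_mul (c := C) (ha.aestronglyMeasurable.smul hh.1) ?_
  filter_upwards [hC] with x hx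
  rw [norm_smul]
  exact mul_le_mul_of_nonneg_right hx (norm_nonneg _)

theorem tendsto_eLpNorm_smul_zero {α G : Type*} [MeasurableSpace α] {ν : Measure α}
    [NormedAddCommGroup G] [NormedSpace ℝ G] {p : ℝ} (hp : 0 < p) {a : ℕ → α → ℝ} {h : α → G}
    {C : ℝ} (ha : ∀ n, AEMeasurable (a n) ν) (hC : ∀ n, ∀ᵐ x ∂ν, |a n x| ≤ C)
    (hh : MemLp h (ENNReal.ofReal p) ν)
    (hlim : ∀ᵐ x ∂ν, Tendsto (fun n => a n x) atTop (𝓝 0)) :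
    Tendsto (fun n => eLpNorm (fun x => a n x • h x) (ENNReal.ofReal p) ν) atTop (𝓝 0) := by
  refine tendsto_eLpNorm_zero_of_dominated hp (g := h) (C := C)
    (fun n => (ha n).aestronglyMeasurable.smul hh.1) hh (fun n => ?_) ?_
  · filter_upwards [hC n] with x hx
    rw [norm_smul]
    exact mul_le_mul_of_nonneg_right hx (norm_nonneg _)
  · filter_upwards [hlim] with x hx
    simpa using hx.smul_const (h x)

/-- A compactly supported function `F` with `F' - κ |F| ≥ 1` on `[-m, m]`. -/
theorem exists_exponential_test_function {κ m : ℝ} (hκ : 0 ≤ κ) (hm : 0 ≤ m) :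
    ∃ F : ℝ → ℝ, ContDiff ℝ ∞ F ∧ HasCompactSupport F ∧ F 0 = 0 ∧
      ∀ t, |t| ≤ m → 1 ≤ deriv F t - κ * |F t| := by
  -- The cut-off equals 1 on a neighbourhood of [-m, m], so derivatives there are those of sinh,
  -- while F and F' become globally bounded.
  let χ : ContDiffBump (0 : ℝ) := ⟨m + 1, m + 2, by linarith, by linarith⟩
  have hχ : ∀ t, |t| < m + 1 → χ t = 1 := fun t ht =>
    χ.one_of_mem_closedBall (by simpa using ht.le)
  -- With y = (κ+1)t, (κ+1) cosh y - κ|sinh y| ≥ cosh y ≥ 1.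
  refine ⟨fun t => χ t * Real.sinh ((κ + 1) * t), ?_, ?_, by simp, fun t ht => ?_⟩
  · exact χ.contDiff.mul (Real.contDiff_sinh.comp (contDiff_const.mul contDiff_id))
  · exact χ.hasCompactSupport.mul_right
  · have e : (fun t => χ t * Real.sinh ((κ + 1) * t)) =ᶠ[𝓝 t]
        fun t => Real.sinh ((κ + 1) * t) := by
      have : ∀ᶠ s in 𝓝 t, |s| < m + 1 :=
        continuous_abs.continuousAt.eventually (gt_mem_nhds (by linarith))
      filter_upwards [this] with s hs
      rw [hχ s hs, one_mul]
    have hd : HasDerivAt (fun t => Real.sinh ((κ + 1) * t))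
        (Real.cosh ((κ + 1) * t) * ((κ + 1) * 1)) t :=
      (Real.hasDerivAt_sinh _).comp t ((hasDerivAt_id t).const_mul (κ + 1))
    have e0 := e.eq_of_nhds
    rw [e.deriv_eq, hd.deriv]
    simp only [e0]
    set y := (κ + 1) * t
    have h1 := Real.one_le_cosh y
    have h2 : |Real.sinh y| ≤ Real.cosh y := by
      rw [Real.abs_sinh, ← Real.cosh_abs]
      exact (Real.sinh_lt_cosh _).le
    nlinarith [mul_le_mul_of_nonneg_left h2 hκ]

theorem exists_cutoff (R : ℝ) (hR : 0 < R) : ∃ η : RN N → ℝ,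
    (∀ r, R + 1 < r → IsTestFunction (ball 0 r) η) ∧ (∀ x, 0 ≤ η x) ∧ (∀ x, η x ≤ 1) ∧
    (∀ x ∈ ball (0 : RN N) R, η x = 1) ∧ ∀ x, R + 1 < ‖x‖ → η x = 0 := by
  let χ : ContDiffBump (0 : RN N) := ⟨R, R + 1, hR, by linarith⟩
  refine ⟨χ, fun r hr => ⟨χ.contDiff, χ.hasCompactSupport, ?_⟩, fun x => χ.nonneg,
    fun x => χ.le_one, fun x hx => χ.one_of_mem_closedBall (ball_subset_closedBall hx), fun x hx => ?_⟩
  · rw [χ.tsupport_eq]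
    exact closedBall_subset_ball hr
  · exact χ.zero_of_le_dist (by simpa using hx.le)

end LocalCompactness

/-! ### The monotonicity gap tends to zero on balls. -/

section LocalCompactness

/-- Split |w|^p as ⟨|w|^{p-2}w, w - w₀⟩ + ⟨|w|^{p-2}w, w₀⟩. The first part of the b-term lowers the
coefficient of the principal part from s' to s' - κ|s| ≥ 1; the second is left as an error. In the
application a = A, b = A_t, s = F, s' = F', t = η, e = ∇η. -/
theorem mul_pGap_le {E : Type*} [NormedAddCommGroup E] [InnerProductSpace ℝ E] {p : ℝ} (hp : 1 < p)
    {α a b κ s s' t : ℝ} {w w₀ e : E} (hα : 0 < α) (ha : α ≤ a) (hb : |b| ≤ p * κ * a)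
    (hs : 1 ≤ s' - κ * |s|) (ht : 0 ≤ t) :
    α * (t * pGap p w w₀) ≤
      a * inner ℝ (pField p w) (s • e + (t * s') • (w - w₀)) + 1 / p * (b * (t * s) * ‖w‖ ^ p)
      - inner ℝ (pField p w) ((a * s) • e) + inner ℝ (pField p w) ((t * a * |s| * κ) • w₀)
      - t * a * (s' - κ * |s|) * inner ℝ (pField p w₀) (w - w₀) := by
  have hp0 : 0 < p := by linarith
  have hg := pGap_nonneg hp w w₀
  have h1 : pGap p w w₀ = inner ℝ (pField p w) (w - w₀) - inner ℝ (pField p w₀) (w - w₀) := by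
    rw [pGap, inner_sub_left]
  have h2 : ‖w‖ ^ p = inner ℝ (pField p w) (w - w₀) + inner ℝ (pField p w) w₀ := by
    rw [← inner_add_right, sub_add_cancel, inner_pField_self hp]
  have h3 : -(t * a * |s| * κ * ‖w‖ ^ p) ≤ 1 / p * (b * (t * s) * ‖w‖ ^ p) := by
    have hbs : |b * s| ≤ p * κ * a * |s| := by
      rw [abs_mul]; exact mul_le_mul_of_nonneg_right hb (abs_nonneg _)
    have h4 : -(p * κ * a * |s|) ≤ b * s := (neg_le_neg hbs).trans (neg_abs_le _)
    have h5 : 0 ≤ 1 / p * (t * ‖w‖ ^ p) := by positivity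
    have h6 := mul_le_mul_of_nonneg_left h4 h5
    have e1 : 1 / p * (t * ‖w‖ ^ p) * -(p * κ * a * |s|) = -(t * a * |s| * κ * ‖w‖ ^ p) := by
      field_simp
    have e2 : 1 / p * (t * ‖w‖ ^ p) * (b * s) = 1 / p * (b * (t * s) * ‖w‖ ^ p) := by ring
    rwa [e1, e2] at h6
  have h7 : α * (t * pGap p w w₀) ≤ t * a * (s' - κ * |s|) * pGap p w w₀ := by
    have h8 : α * 1 ≤ a * (s' - κ * |s|) := mul_le_mul ha hs zero_le_one (by linarith)
    have h9 := mul_le_mul_of_nonneg_right h8 (mul_nonneg ht hg)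
    linarith
  have h10 : -(t * a * |s| * κ * (inner ℝ (pField p w) (w - w₀) + inner ℝ (pField p w) w₀))
      ≤ 1 / p * (b * (t * s) * ‖w‖ ^ p) := by rw [← h2]; exact h3
  rw [h1] at h7 ⊢
  simp only [inner_add_right, inner_smul_right] at h7 ⊢
  linarith

variable {N : ℕ} {p : ℝ} {V : RN N → ℝ} {A g : RN N → ℝ → ℝ} {α₀ μ q c α₁ α₂ a₁ a₂ : ℝ}

/-- The equation of u_n is tested with η F(u_n - u₀). Pointwise absorption bounds the gap by the
tested equation plus error terms, each of which tends to 0. -/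
theorem tendsto_integral_pGap (D : StructureConditions N p V A g α₀ μ q c α₁ α₂ a₁ a₂)
    {R : ℝ} (hR : 0 < R) {CV : ℝ} (hVloc : ∀ᵐ x : RN N, ‖x‖ ≤ R + 1 → V x ≤ CV) {M : ℝ}
    {r : ℕ → ℝ} (hr : ∀ n, R + 1 < r n) {U : ℕ → RN N → ℝ} {w : ℕ → RN N → RN N}
    (hu : ∀ n, IsCriticalOn (ball 0 (r n)) p V A g (U n) (w n) M) {B : ENNReal} (hB : B ≠ ⊤)
    (hwB : ∀ n, eLpNorm (w n) (ENNReal.ofReal p) ≤ B) {u₀ : RN N → ℝ}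
    (hweak : WeaklyConvergesWV univ V p U u₀)
    (hae : ∀ᵐ x, Tendsto (fun n => U n x) atTop (𝓝 (u₀ x))) :
    Tendsto (fun n => ∫ x in ball 0 R, pGap p (w n x) (weakGradient univ u₀ x)) atTop (𝓝 0) := by
  have hp := D.one_lt_p
  have hp0 : 0 < p := by linarith
  have hp1 : 0 < p - 1 := by linarith
  have hpq : 0 < p / (p - 1) := by positivity
  have hHC := holderConjugate_ofReal hp
  have hα := D.α₀_pos
  obtain ⟨hu0, hgw0, hw0⟩ := hweak.2.1.exists_grad
  set w₀ := weakGradient univ u₀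
  have hUb : ∀ᵐ x, ∀ n, |U n x| ≤ M := ae_all_iff.2 fun n => (hu n).bound
  have hu0b : ∀ᵐ x, |u₀ x| ≤ M := by
    filter_upwards [hUb, hae] with x h1 h2
    exact le_of_tendsto h2.abs (Eventually.of_forall h1)
  have hM0 : 0 ≤ M := by
    obtain ⟨x, hx⟩ := hu0b.exists
    exact (abs_nonneg _).trans hx
  obtain ⟨CA, hCA0, hCA⟩ := D.exists_coeff_bound (m := M)
  have hκ0 : 0 ≤ CA / (p * α₀) := by positivity
  -- The value κ = CA/(pα₀) gives |A_t| ≤ CA ≤ pκA, and 2M bounds |u_n - u₀|.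
  obtain ⟨F, hF, hFc, hF0, hFθ⟩ := exists_exponential_test_function hκ0
    (by linarith : 0 ≤ 2 * M)
  set κ := CA / (p * α₀)
  obtain ⟨L₁, hL₁⟩ := hFc.exists_bound_of_continuous hF.continuous
  obtain ⟨L₂, hL₂⟩ := hFc.deriv.exists_bound_of_continuous (hF.continuous_deriv (by simp))
  simp only [Real.norm_eq_abs] at hL₁ hL₂
  have hL₁0 : 0 ≤ L₁ := (abs_nonneg _).trans (hL₁ 0)
  have hL₂0 : 0 ≤ L₂ := (abs_nonneg _).trans (hL₂ 0)
  have cF := hF.continuous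
  have cF' : Continuous (deriv F) := hF.continuous_deriv (by simp)
  obtain ⟨η, hη, hη0, hη1, hηR, hηz⟩ := exists_cutoff (N := N) R hR
  have hηt := hη _ (hr 0)
  have hηm : AEMeasurable η volume := hηt.continuous.aemeasurable
  set z : ℕ → RN N → ℝ := fun n => U n - u₀ with hzdef
  have hzm : ∀ n, AEMeasurable (z n) volume := fun n =>
    (hu n).aemeasurable.sub hu0.1.aemeasurable
  have hzb : ∀ᵐ x, ∀ n, |z n x| ≤ 2 * M := by
    filter_upwards [hUb, hu0b] with x h1 h2 n
    have := abs_sub (U n x) (u₀ x)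
    simp only [hzdef, Pi.sub_apply]
    linarith [h1 n]
  have hzlim : ∀ᵐ x, Tendsto (fun n => z n x) atTop (𝓝 0) := by
    filter_upwards [hae] with x hx
    have := hx.sub_const (u₀ x)
    rwa [sub_self] at this
  have hd : ∀ n, MemLp (w n - w₀) (ENNReal.ofReal p) := fun n => (hu n).inW0.memLp_grad.sub hw0
  have hdB : ∀ n, eLpNorm (w n - w₀) (ENNReal.ofReal p) ≤ B + eLpNorm w₀ (ENNReal.ofReal p) :=
    fun n => (eLpNorm_sub_le (hu n).inW0.memLp_grad.1 hw0.1 (by simpa using hp.le)).trans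
      (add_le_add_left (hwB n) _)
  have hv : ∀ n, InW0 (ball 0 (r n)) p (fun x => η x * F (z n x))
      (fun x => F (z n x) • gradient η x + (η x * deriv F (z n x)) • (w n - w₀) x) := fun n => by
    obtain ⟨φ, hφ⟩ := SmoothApprox.of_isWeakGradient hp.le ((hu n).inW0.memLp.sub hu0) (hd n)
      (((hu n).inW0.isWeakGradient hp.le).sub hgw0)
    exact hφ.inW0_mul_comp hp.le (hη _ (hr n)) hF hF0 hL₂
  have hvb : ∀ n x, |η x * F (z n x)| ≤ L₁ := fun n x => by
    rw [abs_mul, abs_of_nonneg (hη0 x)]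
    exact (mul_le_of_le_one_left (abs_nonneg _) (hη1 x)).trans (hL₁ _)
  -- The weighted integral is finite because V is bounded where η does not vanish.
  have hvX : ∀ n, MemXOn (ball 0 (r n)) V p (fun x => η x * F (z n x)) := fun n => by
    refine (hv n).memXOn isOpen_ball hp.le ?_ (ae_of_all _ (hvb n)) (ae_of_all _ fun x hx => ?_)
    · refine Integrable.integrableOn ?_
      refine ((MemLp.integrable_rpow hp0 (hv n).memLp).const_mul CV).mono'
        (D.aemeasurable_V.mul ((hv n).memLp.1.aemeasurable.norm.pow_const _)).aestronglyMeasurable ?_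
      filter_upwards [hVloc, D.le_V] with x h1 h2
      rw [norm_mul, Real.norm_of_nonneg (D.c_pos.le.trans h2),
        Real.norm_of_nonneg (by positivity : 0 ≤ |η x * F (z n x)| ^ p), Real.norm_eq_abs]
      rcases le_or_gt ‖x‖ (R + 1) with hx | hx
      · exact mul_le_mul_of_nonneg_right (h1 hx) (by positivity)
      · simp [hηz x hx, hp0.ne']
    · rw [(hη _ (hr n)).eq_zero_of_notMem hx, zero_mul]
  have hAm : ∀ n, AEMeasurable (fun x => A x (U n x)) volume := fun n =>
    D.caratheodory_A.aemeasurable_comp (hu n).aemeasurable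
  have hAm0 : AEMeasurable (fun x => A x (u₀ x)) volume :=
    D.caratheodory_A.aemeasurable_comp hu0.1.aemeasurable
  have hAb : ∀ᵐ x, ∀ n, |A x (U n x)| ≤ CA := by
    filter_upwards [hCA, hUb] with x h1 h2 n using (h1 _ (h2 n)).1
  have hAb0 : ∀ᵐ x, |A x (u₀ x)| ≤ CA := by
    filter_upwards [hCA, hu0b] with x h1 h2 using (h1 _ h2).1
  -- the error terms
  have hpB : B ^ (p - 1) ≠ ⊤ := ENNReal.rpow_ne_top_of_nonneg hp1.le hB
  have hpf : ∀ n, MemLp (fun x => pField p (w n x)) (ENNReal.ofReal (p / (p - 1))) := fun n =>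
    memLp_pField hp (hu n).inW0.memLp_grad
  have hpfB : ∀ n, eLpNorm (fun x => pField p (w n x)) (ENNReal.ofReal (p / (p - 1)))
      ≤ B ^ (p - 1) := fun n => by
    rw [eLpNorm_pField hp]
    exact ENNReal.rpow_le_rpow (hwB n) hp1.le
  have hgη : MemLp (gradient η) (ENNReal.ofReal p) := by
    refine (contDiff_continuous_gradient hηt.1).memLp_of_hasCompactSupport ?_
    exact (hηt.2.1.fderiv ℝ).comp_left (g := (InnerProductSpace.toDual ℝ (RN N)).symm) (map_zero _)
  -- The coefficients of the errors: `b₁` comes from ∇η, `b₂` from the unabsorbed part of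
  -- A_t|∇u_n|^p, and `b₃` compares the coefficient of |∇u₀|^{p-2}∇u₀ with its limit. All are
  -- bounded and tend to 0 almost everywhere.
  set b₁ : ℕ → RN N → ℝ := fun n x => A x (U n x) * F (z n x) with hb₁
  set b₂ : ℕ → RN N → ℝ := fun n x => η x * A x (U n x) * |F (z n x)| * κ with hb₂
  set θ : ℝ → ℝ := fun t => deriv F t - κ * |F t| with hθ
  have cθ : Continuous θ := by fun_prop
  have hθb : ∀ t, |θ t| ≤ L₂ + κ * L₁ := fun t => by
    refine (abs_sub _ _).trans (add_le_add (hL₂ t) ?_)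
    rw [abs_mul, abs_abs, abs_of_nonneg hκ0]
    exact mul_le_mul_of_nonneg_left (hL₁ t) hκ0
  set b₃ : ℕ → RN N → ℝ := fun n x =>
    η x * A x (U n x) * θ (z n x) - η x * A x (u₀ x) * θ 0 with hb₃
  have hFm : ∀ n, AEMeasurable (fun x => F (z n x)) volume := fun n =>
    cF.measurable.comp_aemeasurable (hzm n)
  have mb₁ : ∀ n, AEMeasurable (b₁ n) volume := fun n => (hAm n).mul (hFm n)
  have mb₂ : ∀ n, AEMeasurable (b₂ n) volume := fun n =>
    ((hηm.mul (hAm n)).mul (hFm n).norm).mul_const κ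
  have mb₃ : ∀ n, AEMeasurable (b₃ n) volume := fun n =>
    ((hηm.mul (hAm n)).mul (cθ.measurable.comp_aemeasurable (hzm n))).sub
      ((hηm.mul hAm0).mul_const _)
  have bb₁ : ∀ n, ∀ᵐ x, |b₁ n x| ≤ CA * L₁ := fun n => by
    filter_upwards [hAb] with x h1
    rw [hb₁, abs_mul]
    exact mul_le_mul (h1 n) (hL₁ _) (abs_nonneg _) hCA0
  have bb₂ : ∀ n, ∀ᵐ x, |b₂ n x| ≤ 1 * CA * L₁ * κ := fun n => by
    filter_upwards [hAb] with x h1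
    rw [hb₂, abs_mul, abs_mul, abs_mul, abs_abs, abs_of_nonneg hκ0, abs_of_nonneg (hη0 x)]
    have := hη0 x; have := hη1 x; have := h1 n; have := hL₁ (z n x)
    gcongr
  have bηA : ∀ {a s : ℝ} {x : RN N}, |a| ≤ CA → |η x * a * θ s| ≤ 1 * CA * (L₂ + κ * L₁) :=
    fun {a s x} ha => by
      rw [abs_mul, abs_mul, abs_of_nonneg (hη0 x)]
      have := hη0 x; have := hη1 x; have := hθb s
      gcongr
  have bb₃ : ∀ n, ∀ᵐ x, |b₃ n x| ≤ 1 * CA * (L₂ + κ * L₁) + 1 * CA * (L₂ + κ * L₁) := fun n => by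
    filter_upwards [hAb, hAb0] with x h1 h2
    exact (abs_sub _ _).trans (add_le_add (bηA (h1 n)) (bηA h2))
  have hAlim : ∀ᵐ x, Tendsto (fun n => A x (U n x)) atTop (𝓝 (A x (u₀ x))) := by
    filter_upwards [D.caratheodory_A.continuous_ae, hae] with x h1 h2
    exact (h1.tendsto _).comp h2
  have hFlim : ∀ᵐ x, Tendsto (fun n => F (z n x)) atTop (𝓝 0) := by
    filter_upwards [hzlim] with x hx
    have := (cF.tendsto 0).comp hx
    rwa [hF0] at this
  have lb₁ : ∀ᵐ x, Tendsto (fun n => b₁ n x) atTop (𝓝 0) := by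
    filter_upwards [hAlim, hFlim] with x h1 h2
    simpa using h1.mul h2
  have lb₂ : ∀ᵐ x, Tendsto (fun n => b₂ n x) atTop (𝓝 0) := by
    filter_upwards [hAlim, hFlim] with x h1 h2
    simpa using ((h1.const_mul (η x)).mul h2.abs).mul_const κ
  have lb₃ : ∀ᵐ x, Tendsto (fun n => b₃ n x) atTop (𝓝 0) := by
    filter_upwards [hAlim, hzlim] with x h1 h2
    have := ((h1.const_mul (η x)).mul ((cθ.tendsto 0).comp h2)).sub_const
      (η x * A x (u₀ x) * θ 0)
    simpa using this
  have m₁ : ∀ n, MemLp (fun x => b₁ n x • gradient η x) (ENNReal.ofReal p) := fun n =>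
    memLp_bounded_smul (mb₁ n) (bb₁ n) hgη
  have m₂ : ∀ n, MemLp (fun x => b₂ n x • w₀ x) (ENNReal.ofReal p) := fun n =>
    memLp_bounded_smul (mb₂ n) (bb₂ n) hw0
  have hpf0 : MemLp (fun x => pField p (w₀ x)) (ENNReal.ofReal (p / (p - 1))) := memLp_pField hp hw0
  have m₃ : ∀ n, MemLp (fun x => b₃ n x • pField p (w₀ x)) (ENNReal.ofReal (p / (p - 1))) :=
    fun n => memLp_bounded_smul (mb₃ n) (bb₃ n) hpf0
  have m₄ : MemLp (fun x => (η x * A x (u₀ x) * θ 0) • pField p (w₀ x))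
      (ENNReal.ofReal (p / (p - 1))) :=
    memLp_bounded_smul ((hηm.mul hAm0).mul_const _) (hAb0.mono fun x hx => bηA hx) hpf0
  -- Fluxes bounded in L^{p'} are paired with fields tending strongly to 0 in L^p.
  have T₁ := tendsto_integral_inner_zero hpB hpf hpfB m₁
    (tendsto_eLpNorm_smul_zero hp0 mb₁ bb₁ hgη lb₁)
  have T₂ := tendsto_integral_inner_zero hpB hpf hpfB m₂
    (tendsto_eLpNorm_smul_zero hp0 mb₂ bb₂ hw0 lb₂)
  have T₃ : Tendsto (fun n => ∫ x, (inner ℝ (b₃ n x • pField p (w₀ x)) ((w n - w₀) x) : ℝ))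
      atTop (𝓝 0) := by
    have hs := hHC.symm
    have := tendsto_integral_inner_zero (ENNReal.add_ne_top.2 ⟨hB, hw0.2.ne⟩) hd hdB m₃
      (tendsto_eLpNorm_smul_zero hpq mb₃ bb₃ hpf0 lb₃)
    simpa only [real_inner_comm] using this
  -- The field paired with ∇u_n - ∇u₀ no longer depends on n, so weak convergence suffices.
  have T₄ : Tendsto (fun n => ∫ x, (inner ℝ ((η x * A x (u₀ x) * θ 0) • pField p (w₀ x))
      ((w n - w₀) x) : ℝ)) atTop (𝓝 0) := by
    have := (hweak.2.2 _ (isDualWV_integral_inner_grad hp.le D.c_pos D.le_V m₄)).sub_const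
      (∫ x, (inner ℝ ((η x * A x (u₀ x) * θ 0) • pField p (w₀ x)) (w₀ x) : ℝ))
    rw [sub_self] at this
    refine this.congr fun n => ?_
    have e : ∫ x, (inner ℝ ((η x * A x (u₀ x) * θ 0) • pField p (w₀ x))
        (weakGradient univ (U n) x) : ℝ)
        = ∫ x, (inner ℝ ((η x * A x (u₀ x) * θ 0) • pField p (w₀ x)) (w n x) : ℝ) := by
      refine integral_congr_ae ?_
      filter_upwards [(hu n).weakGradient_ae_eq hp.le] with x hx
      rw [hx]
    rw [e, ← integral_sub (memLp_one_inner m₄ (hu n).inW0.memLp_grad).1 (memLp_one_inner m₄ hw0).1]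
    refine integral_congr_ae (ae_of_all _ fun x => ?_)
    simp only [Pi.sub_apply, inner_sub_right]
  set e : ℕ → RN N → ℝ := fun n x => V x * |U n x| ^ (p - 2) * U n x * (η x * F (z n x))
    - g x (U n x) * (η x * F (z n x)) with hedef
  have heq := fun n => (hu n).equation D (hv n) (hvX n)
  have ie : ∀ n, Integrable (e n) := fun n => (heq n).2.2.1.sub (heq n).2.2.2.1
  -- The lower-order terms are bounded, supported where η is, and carry the factor F(u_n - u₀)
  -- tending to 0: dominated convergence.
  have T₅ : Tendsto (fun n => ∫ x, e n x) atTop (𝓝 0) := by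
    set Ce := |CV| * M ^ (p - 1) + (a₁ + a₂ * M ^ (q - p)) * M ^ (p - 1)
    have hCe : 0 ≤ Ce := by
      have := D.a₁_pos; have := D.a₂_pos
      positivity
    have hle : ∀ᵐ x, ∀ n, |e n x| ≤ Ce * (η x * |F (z n x)|) := by
      filter_upwards [hVloc, D.le_V, hUb, D.abs_g_le (m := M)] with x h1 h2 h3 h4 n
      have hV0 : 0 ≤ V x := D.c_pos.le.trans h2
      have ha1 := D.a₁_pos
      have ha2 := D.a₂_pos
      have e1 : e n x = (V x * (|U n x| ^ (p - 2) * U n x) - g x (U n x)) * (η x * F (z n x)) := by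
        simp only [hedef]; ring
      rw [e1, abs_mul, abs_mul (η x), abs_of_nonneg (hη0 x)]
      rcases le_or_gt ‖x‖ (R + 1) with hx | hx
      · refine mul_le_mul_of_nonneg_right ?_ (mul_nonneg (hη0 x) (abs_nonneg _))
        have hU1 : |U n x| ^ (p - 1) ≤ M ^ (p - 1) :=
          Real.rpow_le_rpow (abs_nonneg _) (h3 n) hp1.le
        refine (abs_sub _ _).trans (add_le_add ?_ ((h4 _ (h3 n)).trans ?_))
        · rw [abs_mul, abs_mul, abs_of_nonneg (by positivity : 0 ≤ |U n x| ^ (p - 2)),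
            rpow_sub_two_mul_self hp (abs_nonneg _), abs_of_nonneg hV0]
          exact mul_le_mul ((h1 hx).trans (le_abs_self _)) hU1 (by positivity) (abs_nonneg _)
        · exact mul_le_mul_of_nonneg_left hU1 (by positivity)
      · simp [hηz x hx]
    have iη : Integrable η := hηt.continuous.integrable_of_hasCompactSupport hηt.2.1
    have := tendsto_integral_of_dominated_convergence (F := e) (f := fun _ => 0)
      (fun x => Ce * L₁ * η x) (fun n => (ie n).1) (iη.const_mul _)
      (fun n => by
        filter_upwards [hle] with x hx
        refine (hx n).trans ?_
        rw [mul_assoc, mul_comm L₁]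
        exact mul_le_mul_of_nonneg_left (mul_le_mul_of_nonneg_left (hL₁ _) (hη0 x)) hCe)
      (by
        filter_upwards [hle, hFlim] with x h1 h2
        refine squeeze_zero_norm h1 ?_
        simpa using (h2.abs.const_mul (η x)).const_mul Ce)
    simpa using this
  -- conclusion
  have I₁ := fun n => (memLp_one_inner (hpf n) (m₁ n)).1
  have I₂ := fun n => (memLp_one_inner (hpf n) (m₂ n)).1
  have I₃ := fun n => (memLp_one_inner (m₃ n) (hd n)).1
  have I₄ := fun n => (memLp_one_inner m₄ (hd n)).1
  have hlim := ((((T₁.neg).add T₂).sub T₃).sub T₄).sub T₅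
  simp only [neg_zero, add_zero, sub_zero] at hlim
  have hlim' := hlim.const_mul (1 / α₀)
  rw [mul_zero] at hlim'
  have hgap0 : ∀ n x, 0 ≤ pGap p (w n x) (w₀ x) := fun n x => pGap_nonneg hp _ _
  refine squeeze_zero (fun n => integral_nonneg fun x => hgap0 n x) (fun n => ?_) hlim'
  obtain ⟨i1, i2, i3, i4, hz0⟩ := heq n
  have J := (((I₁ n).neg.add (I₂ n)).sub (I₃ n)).sub (I₄ n)
  -- By the equation, minus the integral of `e` equals the principal part plus the A_t term; this
  -- puts everything under one integral for the pointwise estimate.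
  have hsum : -(∫ x, (inner ℝ (pField p (w n x)) (b₁ n x • gradient η x) : ℝ))
      + (∫ x, (inner ℝ (pField p (w n x)) (b₂ n x • w₀ x) : ℝ))
      - (∫ x, (inner ℝ (b₃ n x • pField p (w₀ x)) ((w n - w₀) x) : ℝ))
      - (∫ x, (inner ℝ ((η x * A x (u₀ x) * θ 0) • pField p (w₀ x)) ((w n - w₀) x) : ℝ))
      - (∫ x, e n x)
      = ∫ x, ((A x (U n x) * inner ℝ (pField p (w n x))
          (F (z n x) • gradient η x + (η x * deriv F (z n x)) • (w n - w₀) x)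
        + 1 / p * (deriv (A x) (U n x) * (η x * F (z n x)) * ‖w n x‖ ^ p))
        + (-(inner ℝ (pField p (w n x)) (b₁ n x • gradient η x))
          + inner ℝ (pField p (w n x)) (b₂ n x • w₀ x)
          - inner ℝ (b₃ n x • pField p (w₀ x)) ((w n - w₀) x)
          - inner ℝ ((η x * A x (u₀ x) * θ 0) • pField p (w₀ x)) ((w n - w₀) x)) : ℝ) := by
    have e1 := integral_add (i1.add (i2.const_mul (1 / p))) J
    have e2 := integral_add i1 (i2.const_mul (1 / p))
    have e3 := integral_sub (((I₁ n).neg.add (I₂ n)).sub (I₃ n)) (I₄ n)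
    have e4 := integral_sub ((I₁ n).neg.add (I₂ n)) (I₃ n)
    have e5 := integral_add (I₁ n).neg (I₂ n)
    have e6 := integral_sub i3 i4
    simp only [Pi.add_apply, Pi.sub_apply, Pi.neg_apply] at e1 e2 e3 e4 e5 e6
    rw [integral_neg] at e5
    rw [integral_const_mul] at e2
    simp only [Pi.sub_apply]
    rw [e1, e2, e3, e4, e5]
    simp only [Pi.sub_apply] at hz0
    simp only [hedef]
    rw [e6]
    linarith
  rw [hsum, ← integral_indicator measurableSet_ball, ← integral_const_mul]
  refine integral_mono_of_nonneg (ae_of_all _ fun x => indicator_nonneg (fun x _ => hgap0 n x) x)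
    (((i1.add (i2.const_mul (1 / p))).add J).const_mul _) ?_
  filter_upwards [D.le_A, hCA, hUb, hzb] with x h1 h2 h3 h4
  have hb : |deriv (A x) (U n x)| ≤ p * κ * A x (U n x) := by
    have e1 : CA = p * κ * α₀ := by simp only [κ]; field_simp
    refine (h2 _ (h3 n)).2.trans ?_
    rw [e1]
    exact mul_le_mul_of_nonneg_left (h1 _) (by positivity)
  have key := mul_pGap_le hp (w := w n x) (w₀ := w₀ x) (e := gradient η x) hα (h1 (U n x)) hb
    (hFθ _ (h4 n)) (hη0 x)
  have hind : (ball (0 : RN N) R).indicator (fun x => pGap p (w n x) (w₀ x)) x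
      ≤ η x * pGap p (w n x) (w₀ x) := by
    by_cases hx : x ∈ ball (0 : RN N) R
    · rw [indicator_of_mem hx, hηR x hx, one_mul]
    · rw [indicator_of_notMem hx]; exact mul_nonneg (hη0 x) (hgap0 n x)
  refine hind.trans ?_
  rw [one_div_mul_eq_div, le_div_iff₀ hα, mul_comm _ α₀]
  refine key.trans (le_of_eq ?_)
  simp only [hb₁, hb₂, hb₃, hθ, Pi.sub_apply, inner_smul_left, inner_smul_right, RCLike.conj_to_real]
  ring

end LocalCompactness

/-! ### Strong convergence on balls and uniform bounds. -/

section StrongConvergence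

variable {N : ℕ} {p : ℝ} {V : RN N → ℝ} {A g : RN N → ℝ → ℝ} {α₀ μ q c α₁ α₂ a₁ a₂ : ℝ}

theorem integral_rpow_le_of_eLpNorm_le {α F : Type*} [MeasurableSpace α] {ν : Measure α}
    [NormedAddCommGroup F] (hp : 0 < p) {f : α → F} (hf : MemLp f (ENNReal.ofReal p) ν)
    {B : ENNReal} (hB : B ≠ ⊤) (h : eLpNorm f (ENNReal.ofReal p) ν ≤ B) :
    ∫ x, ‖f x‖ ^ p ∂ν ≤ B.toReal ^ p := by
  have h0 : 0 ≤ ∫ x, ‖f x‖ ^ p ∂ν := integral_nonneg fun x => by positivity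
  rw [eLpNorm_eq_ofReal_integral hp hf] at h
  have h1 := (ENNReal.ofReal_le_iff_le_toReal hB).1 h
  have h2 := Real.rpow_le_rpow (by positivity) h1 hp.le
  rwa [← Real.rpow_mul h0, one_div_mul_cancel hp.ne', Real.rpow_one] at h2

theorem integrable_pGap {α : Type*} [MeasurableSpace α] {ν : Measure α} (hp : 1 < p)
    {f g : α → RN N} (hf : MemLp f (ENNReal.ofReal p) ν) (hg : MemLp g (ENNReal.ofReal p) ν) :
    Integrable (fun x => pGap p (f x) (g x)) ν := by
  have hHC := holderConjugate_ofReal hp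
  exact (memLp_one_inner ((memLp_pField hp hf).sub (memLp_pField hp hg)) (hf.sub hg)).1

/-- By quantitative monotonicity the integral is at most a small multiple of the bounded total
energy plus a constant times the gap, which tends to 0. -/
theorem tendsto_integral_norm_sub_rpow_of_pGap {α : Type*} [MeasurableSpace α] {ν : Measure α}
    (hp : 1 < p) {f : ℕ → α → RN N} {f₀ : α → RN N} (hf : ∀ n, MemLp (f n) (ENNReal.ofReal p) ν)
    (hf₀ : MemLp f₀ (ENNReal.ofReal p) ν) {B : ENNReal} (hB : B ≠ ⊤)
    (hfB : ∀ n, eLpNorm (f n) (ENNReal.ofReal p) ν ≤ B)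
    (h : Tendsto (fun n => ∫ x, pGap p (f n x) (f₀ x) ∂ν) atTop (𝓝 0)) :
    Tendsto (fun n => ∫ x, ‖f n x - f₀ x‖ ^ p ∂ν) atTop (𝓝 0) := by
  have hp0 : 0 < p := by linarith
  set K := B.toReal ^ p + ∫ x, ‖f₀ x‖ ^ p ∂ν
  have hK : 0 ≤ K := add_nonneg (by positivity) (integral_nonneg fun x => by positivity)
  have h0 : ∀ n, 0 ≤ ∫ x, ‖f n x - f₀ x‖ ^ p ∂ν := fun n => integral_nonneg fun x => by positivity
  rw [Metric.tendsto_atTop]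
  intro ε hε
  -- The total energy is at most K, so this share leaves at most ε/2; K + 1 avoids dividing by zero.
  obtain ⟨C, hC0, hC⟩ := exists_norm_sub_rpow_le (E := RN N) hp
    (ε := ε / (2 * (K + 1))) (by positivity)
  have hle : ∀ n, ∫ x, ‖f n x - f₀ x‖ ^ p ∂ν
      ≤ ε / (2 * (K + 1)) * K + C * ∫ x, pGap p (f n x) (f₀ x) ∂ν := fun n => by
    have i1 := MemLp.integrable_rpow hp0 (hf n)
    have i2 := MemLp.integrable_rpow hp0 hf₀
    have i3 := integrable_pGap hp (hf n) hf₀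
    have i4 := MemLp.integrable_rpow hp0 ((hf n).sub hf₀)
    have h1 := integral_mono i4 (((i1.add i2).const_mul _).add (i3.const_mul C))
      (fun x => hC (f n x) (f₀ x))
    refine h1.trans ?_
    have e1 := integral_add ((i1.add i2).const_mul (ε / (2 * (K + 1)))) (i3.const_mul C)
    have e2 := integral_add i1 i2
    rw [integral_const_mul, integral_const_mul] at e1
    refine e1.trans_le (add_le_add_left (mul_le_mul_of_nonneg_left ?_ (by positivity)) _)
    refine e2.trans_le ?_
    exact add_le_add_left (integral_rpow_le_of_eLpNorm_le hp0 (hf n) hB (hfB n)) _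
  have hev : ∀ᶠ n in atTop, C * ∫ x, pGap p (f n x) (f₀ x) ∂ν < ε / 2 := by
    have := h.const_mul C
    rw [mul_zero] at this
    exact this.eventually (gt_mem_nhds (by positivity))
  obtain ⟨n₀, hn₀⟩ := eventually_atTop.1 hev
  refine ⟨n₀, fun n hn => ?_⟩
  rw [Real.dist_eq, sub_zero, abs_of_nonneg (h0 n)]
  have e1 : ε / (2 * (K + 1)) * K ≤ ε / 2 := by
    rw [div_mul_eq_mul_div, div_le_div_iff₀ (by positivity) (by positivity)]
    nlinarith
  linarith [hle n, hn₀ n hn]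

/-- On the ball the integrand is dominated by the constant CV (2M)^p, since V is bounded there and
the limit inherits the sup bound. -/
theorem tendsto_integral_potential (hp : 0 < p) (hV : AEMeasurable V volume)
    (hV0 : ∀ᵐ x, 0 ≤ V x) {R CV : ℝ} (hVloc : ∀ᵐ x : RN N, ‖x‖ ≤ R → V x ≤ CV)
    {M : ℝ} {U : ℕ → RN N → ℝ} {u₀ : RN N → ℝ} (hU : ∀ n, AEMeasurable (U n) volume)
    (hu₀ : AEMeasurable u₀ volume) (hUb : ∀ n, ∀ᵐ x, |U n x| ≤ M)
    (hae : ∀ᵐ x, Tendsto (fun n => U n x) atTop (𝓝 (u₀ x))) :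
    Tendsto (fun n => ∫ x in ball 0 R, V x * |U n x - u₀ x| ^ p) atTop (𝓝 0) := by
  have hu₀b : ∀ᵐ x, |u₀ x| ≤ M := by
    filter_upwards [ae_all_iff.2 hUb, hae] with x h1 h2
    exact le_of_tendsto h2.abs (Eventually.of_forall h1)
  have := tendsto_integral_of_dominated_convergence (μ := volume.restrict (ball (0 : RN N) R))
    (F := fun n x => V x * |U n x - u₀ x| ^ p) (f := fun _ => 0) (fun _ => CV * (2 * M) ^ p)
    (fun n => (hV.mul (((hU n).sub hu₀).norm.pow_const p)).aestronglyMeasurable.restrict)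
    (integrableOn_const measure_ball_lt_top.ne)
    (fun n => by
      rw [ae_restrict_iff' measurableSet_ball]
      filter_upwards [hV0, hVloc, hUb n, hu₀b] with x h1 h2 h3 h4 hx
      have hx' := h2 (by simpa using (mem_ball_zero_iff.1 hx).le)
      rw [norm_mul, Real.norm_of_nonneg h1, Real.norm_of_nonneg (by positivity)]
      have h5 : |U n x - u₀ x| ≤ 2 * M := by linarith [abs_sub (U n x) (u₀ x)]
      exact mul_le_mul hx' (Real.rpow_le_rpow (abs_nonneg _) h5 hp.le) (by positivity)
        (h1.trans hx'))
    (by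
      refine ae_restrict_of_ae ?_
      filter_upwards [hae] with x hx
      have h1 := (hx.sub_const (u₀ x)).abs.rpow_const (p := p) (Or.inr hp.le)
      simpa [hp.ne'] using h1.const_mul (V x))
  simpa using this

theorem MemWV.restrict {Ω : Set (RN N)} {u : RN N → ℝ} (h : MemWV univ V p u) : MemWV Ω V p u := by
  obtain ⟨h1, h2, h3⟩ := h.exists_grad
  exact ⟨⟨h1.restrict _, _, h2.restrict, h3.restrict _⟩, h.2.mono_set (subset_univ _)⟩

theorem WeaklyConvergesWV.comp {Ω : Set (RN N)} {U : ℕ → RN N → ℝ} {u₀ : RN N → ℝ}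
    (h : WeaklyConvergesWV Ω V p U u₀) {ns : ℕ → ℕ} (hns : Tendsto ns atTop atTop) :
    WeaklyConvergesWV Ω V p (fun n => U (ns n)) u₀ :=
  ⟨fun _ => h.1 _, h.2.1, fun ℓ hℓ => (h.2.2 ℓ hℓ).comp hns⟩

theorem tendsto_normV_ball (D : StructureConditions N p V A g α₀ μ q c α₁ α₂ a₁ a₂)
    {R : ℝ} (hR : 0 < R) {CV : ℝ} (hVloc : ∀ᵐ x : RN N, ‖x‖ ≤ R + 1 → V x ≤ CV) {M : ℝ}
    {r : ℕ → ℝ} (hr : ∀ n, R + 1 < r n) {U : ℕ → RN N → ℝ} {w : ℕ → RN N → RN N}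
    (hu : ∀ n, IsCriticalOn (ball 0 (r n)) p V A g (U n) (w n) M) {B : ENNReal} (hB : B ≠ ⊤)
    (hwB : ∀ n, eLpNorm (w n) (ENNReal.ofReal p) ≤ B) {u₀ : RN N → ℝ}
    (hweak : WeaklyConvergesWV univ V p U u₀)
    (hae : ∀ᵐ x, Tendsto (fun n => U n x) atTop (𝓝 (u₀ x))) :
    Tendsto (fun n => normV (ball 0 R) V p (U n - u₀)) atTop (𝓝 0) := by
  have hp := D.one_lt_p
  have hp0 : 0 < p := by linarith
  obtain ⟨hu0, hgw0, hw0⟩ := hweak.2.1.exists_grad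
  have hV0 : ∀ᵐ x, 0 ≤ V x := D.le_V.mono fun x hx => D.c_pos.le.trans hx
  have T1 := tendsto_integral_norm_sub_rpow_of_pGap hp
    (fun n => (hu n).inW0.memLp_grad.restrict (ball 0 R)) (hw0.restrict _) hB
    (fun n => (eLpNorm_mono_measure _ Measure.restrict_le_self).trans (hwB n))
    (tendsto_integral_pGap D hR hVloc hr hu hB hwB hweak hae)
  have T2 := tendsto_integral_potential hp0 D.aemeasurable_V hV0 (R := R)
    (hVloc.mono fun x hx hxR => hx (by linarith)) (fun n => (hu n).aemeasurable)
    hu0.1.aemeasurable (fun n => (hu n).bound) hae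
  have T := T1.add T2
  rw [add_zero] at T
  have T' := T.rpow_const (p := 1 / p) (Or.inr (by positivity))
  rw [Real.zero_rpow (by positivity)] at T'
  refine T'.congr fun n => ?_
  rw [normV]
  congr 2
  refine integral_congr_ae ?_
  have := weakGradient_ae_eq (isOpen_ball (x := (0 : RN N)) (ε := R))
    (((hu n).inW0.isWeakGradient hp.le).sub hgw0).restrict
  filter_upwards [this] with x hx
  rw [hx, Pi.sub_apply]

/-- Bounds for critical points on balls, uniform in the radius. -/
theorem exists_uniform_bounds (hN : 2 ≤ N)
    (D : StructureConditions N p V A g α₀ μ q c α₁ α₂ a₁ a₂)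
    (hq : (q : EReal) < criticalExponent N p) (E : ℝ) :
    ∃ (B : ENNReal) (M : ℝ), B ≠ ⊤ ∧ ∀ (Ω : Set (RN N)), volume Ω ≠ ⊤ →
      ∀ (u : RN N → ℝ) (w : RN N → RN N) (m : ℝ), IsCriticalOn Ω p V A g u w m →
        energy p V A g u ≤ E →
        eLpNorm u (ENNReal.ofReal p) ≤ B ∧ eLpNorm w (ENNReal.ofReal p) ≤ B ∧
          IsCriticalOn Ω p V A g u w M := by
  have hp := D.one_lt_p
  have hp0 : 0 < p := by linarith
  have hα₀ := D.α₀_pos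
  have hα₁ := D.α₁_pos
  have hc := D.c_pos
  have hμp : 0 < μ - p := sub_pos.2 D.p_lt_μ
  have hμ0 : 0 < μ := by linarith
  -- K₁ and K₂ result from dropping one of the two nonnegative terms in the energy bound. B, and
  -- then M, depend only on these and on the structure constants, not on Ω or on the qualitative
  -- bound m.
  set K₁ := μ * E / (α₁ * α₀ / p)
  set K₂ := μ * E / ((μ - p) / p * c)
  set B : ENNReal := ENNReal.ofReal (max (K₁ ^ (1 / p)) (K₂ ^ (1 / p)))
  have hB : B ≠ ⊤ := ENNReal.ofReal_ne_top
  obtain ⟨M, -, hM⟩ := exists_bound_of_energy_inequality hN hp D.p_le_q hq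
    (C := ENNReal.ofReal ((a₁ + a₂) / (min 1 (α₂ / p) * α₀))) ENNReal.ofReal_ne_top hB
  refine ⟨B, M, hB, fun Ω hΩ u w m hu hE => ?_⟩
  have hen := (hu.energy_bound D).trans (mul_le_mul_of_nonneg_left hE hμ0.le)
  have n1 : 0 ≤ ∫ x, ‖w x‖ ^ p := integral_nonneg fun x => by positivity
  have n2 : 0 ≤ ∫ x, ‖u x‖ ^ p := integral_nonneg fun x => by positivity
  have hcV : c * ∫ x, ‖u x‖ ^ p ≤ ∫ x, V x * |u x| ^ p := by
    rw [← integral_const_mul]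
    refine integral_mono_ae ((MemLp.integrable_rpow hp0 hu.inW0.memLp).const_mul c)
      (hu.mem.integrable_potential hu.isOpen.measurableSet hp0) ?_
    filter_upwards [D.le_V] with x hx
    exact mul_le_mul_of_nonneg_right hx (by positivity)
  have k1 : 0 < α₁ * α₀ / p := by positivity
  have k2 : 0 < (μ - p) / p := by positivity
  have hcV' := mul_le_mul_of_nonneg_left hcV k2.le
  have b1 : ∫ x, ‖w x‖ ^ p ≤ K₁ := by
    rw [le_div_iff₀ k1]
    have : 0 ≤ (μ - p) / p * (c * ∫ x, ‖u x‖ ^ p) := by positivity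
    linarith
  have b2 : ∫ x, ‖u x‖ ^ p ≤ K₂ := by
    rw [le_div_iff₀ (by positivity)]
    have : 0 ≤ α₁ * α₀ / p * ∫ x, ‖w x‖ ^ p := by positivity
    linarith
  have huB : eLpNorm u (ENNReal.ofReal p) ≤ B := by
    rw [eLpNorm_eq_ofReal_integral hp0 hu.inW0.memLp]
    exact ENNReal.ofReal_le_ofReal
      ((Real.rpow_le_rpow n2 b2 (by positivity)).trans (le_max_right _ _))
  have hwB : eLpNorm w (ENNReal.ofReal p) ≤ B := by
    rw [eLpNorm_eq_ofReal_integral hp0 hu.inW0.memLp_grad]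
    exact ENNReal.ofReal_le_ofReal
      ((Real.rpow_le_rpow n1 b1 (by positivity)).trans (le_max_left _ _))
  refine ⟨huB, hwB, hu.isOpen, hu.mem, hu.inW0, ?_, hu.critical⟩
  exact hM Ω hΩ u w hu.inW0 huB hwB fun h k h1 hk =>
    hu.level_energy D h1 (by linarith)

end StrongConvergence

end QuasilinearSchrodinger

/-! ### Assembly of the main theorem. -/

theorem proposition6p7 (N : ℕ) (hN : 2 ≤ N) (p : ℝ) (hp : 1 < p)
    (V : RN N → ℝ) (A g : RN N → ℝ → ℝ)
    -- the potential `V`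
    (hV : AEMeasurable V volume)
    (hV1 : ∃ c : ℝ, 0 < c ∧ ∀ᵐ x : RN N, c ≤ V x)
    (hV2 : Tendsto (fun x : RN N => ∫ y in ball x 1, 1 / V y) (cocompact (RN N)) (𝓝 0))
    (hV3 : ∀ ρ : ℝ, 0 < ρ → ∃ C : ℝ, 0 < C ∧ ∀ᵐ x : RN N, ‖x‖ ≤ ρ → V x ≤ C)
    -- the coefficient `A`, with `A_t(x,t) = deriv (A x) t`
    (h0 : IsCaratheodory 1 A)
    (h1 : ∀ ρ : ℝ, 0 < ρ → ∃ C : ℝ, ∀ᵐ x : RN N, ∀ t : ℝ, |t| ≤ ρ →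
      |A x t| ≤ C ∧ |deriv (A x) t| ≤ C)
    (α₀ : ℝ) (hα₀ : 0 < α₀)
    (h2 : ∀ᵐ x : RN N, ∀ t : ℝ, α₀ ≤ A x t)
    (μ : ℝ) (hμ : p < μ)
    (h3 : ∃ α₁ : ℝ, 0 < α₁ ∧ ∀ᵐ x : RN N, ∀ t : ℝ,
      α₁ * A x t ≤ (μ - p) * A x t - deriv (A x) t * t)
    (h4 : ∃ α₂ : ℝ, 0 < α₂ ∧ ∀ᵐ x : RN N, ∀ t : ℝ,
      α₂ * A x t ≤ p * A x t + deriv (A x) t * t)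
    -- the nonlinearity `g`
    (g0 : IsCaratheodory 0 g)
    (q : ℝ) (hpq : p ≤ q) (hq : (q : EReal) < criticalExponent N p)
    (g1 : ∃ a₁ a₂ : ℝ, 0 < a₁ ∧ 0 < a₂ ∧ ∀ᵐ x : RN N, ∀ t : ℝ,
      |g x t| ≤ a₁ * |t| ^ (p - 1) + a₂ * |t| ^ (q - 1))
    (g2 : ∃ α : ℝ, α < α₀ / embeddingConstant V p ^ p ∧ ∀ ε : ℝ, 0 < ε → ∃ δ : ℝ, 0 < δ ∧
      ∀ᵐ x : RN N, ∀ t : ℝ, 0 < |t| → |t| < δ → |g x t / (|t| ^ (p - 2) * t) - α| < ε)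
    (g3 : ∀ᵐ x : RN N, ∀ t : ℝ, t ≠ 0 →
      0 < μ * (∫ s in (0 : ℝ)..t, g x s) ∧ μ * (∫ s in (0 : ℝ)..t, g x s) ≤ g x t * t)
    -- the sequence of critical points on the balls `B_k`, `k = 1, 2, …`
    (αLow αHigh : ℝ) (u : ℕ+ → RN N → ℝ)
    (hu_ball : ∀ k : ℕ+, MemXOn (ball 0 ((k : ℕ) : ℝ)) V p (u k))
    (hu_level : ∀ k, αLow ≤ energy p V A g (u k) ∧ energy p V A g (u k) ≤ αHigh)
    (hu_crit : ∀ k : ℕ+, ∀ v : RN N → ℝ, MemXOn (ball 0 ((k : ℕ) : ℝ)) V p v →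
      energyDifferential p V A g (u k) v = 0)
    -- its weak limit, along the whole sequence or along a subsequence
    (σ : ℕ → ℕ+) (hσ : StrictMono σ) (uInf : RN N → ℝ)
    (hu_weak : WeaklyConvergesWV univ V p (fun n => u (σ n)) uInf) :
    ∀ R : ℝ, 1 ≤ R →
      StronglyConvergesWV (ball (0 : RN N) R) V p (fun n => u (σ n)) uInf := by
  obtain ⟨c, hc, hcV⟩ := hV1
  obtain ⟨α₁, hα₁, h3⟩ := h3
  obtain ⟨α₂, hα₂, h4⟩ := h4
  obtain ⟨a₁, a₂, ha₁, ha₂, g1⟩ := g1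
  have D : StructureConditions N p V A g α₀ μ q c α₁ α₂ a₁ a₂ :=
    ⟨hp, hV, hc, hcV, h0, h1, hα₀, h2, hμ, hα₁, h3, hα₂, h4, g0, hpq, ha₁, ha₂, g1, g3⟩
  obtain ⟨B, M, hB, hBM⟩ := exists_uniform_bounds hN D hq αHigh
  have hcrit : ∀ k : ℕ+, ∃ w : RN N → RN N, eLpNorm (u k) (ENNReal.ofReal p) ≤ B ∧
      eLpNorm w (ENNReal.ofReal p) ≤ B ∧
      IsCriticalOn (ball 0 ((k : ℕ) : ℝ)) p V A g (u k) w M := fun k => by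
    obtain ⟨w, hw⟩ := (hu_ball k).exists_inW0 isOpen_ball hp.le
    obtain ⟨m, -, hm⟩ := (hu_ball k).exists_bound measurableSet_ball
    exact ⟨w, hBM _ measure_ball_lt_top.ne _ w m ⟨isOpen_ball, hu_ball k, hw, hm, hu_crit k⟩
      (hu_level k).2⟩
  choose w huB hwB hcrit using hcrit
  intro R hR
  have hR0 : 0 < R := by linarith
  obtain ⟨CV, -, hCV⟩ := hV3 (R + 1) (by linarith)
  refine ⟨fun n => (hu_weak.1 n).restrict, hu_weak.2.1.restrict, ?_⟩
  -- Almost everywhere convergence is available along subsequences only, so it suffices that every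
  -- subsequence has a further one along which the norms tend to 0.
  refine tendsto_of_subseq_tendsto fun ns hns => ?_
  have hweak := hu_weak.comp hns
  obtain ⟨ms, hms, hae⟩ := hweak.exists_subseq_tendsto_ae hp hc hcV hB (fun n => huB _) fun n => by
    rw [eLpNorm_congr_ae ((hcrit (σ (ns n))).weakGradient_ae_eq hp.le)]
    exact hwB _
  have hσn : ∀ n : ℕ, (n : ℝ) ≤ ((σ n : ℕ) : ℝ) := fun n => by
    have h : StrictMono fun n => (σ n : ℕ) := fun a b hab => hσ hab
    exact_mod_cast h.le_apply
  have hlim : Tendsto (fun n => ((σ (ns (ms n)) : ℕ) : ℝ)) atTop atTop :=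
    tendsto_atTop_mono (fun n => hσn _)
      (tendsto_natCast_atTop_atTop.comp (hns.comp hms.tendsto_atTop))
  -- Finitely many terms are discarded so that every remaining ball contains the support of the
  -- cut-off, which reaches radius R + 1.
  obtain ⟨n₀, hn₀⟩ := eventually_atTop.1 (hlim.eventually_gt_atTop (R + 1))
  have hshift : Tendsto (fun n => n + n₀) atTop atTop := tendsto_add_atTop_nat n₀
  refine ⟨fun n => ms (n + n₀), ?_⟩
  exact tendsto_normV_ball D hR0 hCV (fun n => hn₀ (n + n₀) (by omega))
    (fun n => hcrit (σ (ns (ms (n + n₀))))) hB (fun n => hwB _)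
    (hweak.comp (hms.tendsto_atTop.comp hshift)) (hae.mono fun x hx => hx.comp hshift)
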